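/- Let $1<p<2$ and let $p^*=p/(p-1)$ be its Hölder conjugate. For $q\ge 1$ write $\|x\|_q=(\sum_{i=1}^n|x_i|^q)^{1/q}$ for $x\in\mathbb R^n$ and $\xi_q=(\mathbb E|z|^q)^{1/q}$ for a standard Gaussian random variable $z$. For $n\ge 1$ let $G_n$ be an $n\times n$ random matrix with i.i.d. standard Gaussian entries, let $\bar G_n=(G_n+G_n^{T})/\sqrt2=(\bar g_{ij})$, let $e_1,\dots,e_n$ be the standard basis of $\mathbb R^n$, and for $1\le i\le n$ define $v_i\in\mathbb R^n$ by $$v_i(j)=\mathrm{sgn}(\bar g_{ij})\Bigl(\frac{|\bar g_{ij}|^{p^*}}{\|\bar G_ne_i\|_{p^*}^{p^*}}\Bigr)^{1/p},\qquad 1\le j\le n,$$ where $\mathrm{sgn}(a)=1$ if $a\ge 0$ and $\mathrm{sgn}(a)=-1$ if $a<0$. Put $$\mathcal O=\Bigl\{\pm\frac{e_i+v_i}{\|e_i+v_i\|_p}:1\le i\le n\Bigr\},\qquad \mathrm{dist}(x,\mathcal O)=\min_{y\in\mathcal O}\|x-y\|_p,$$ with the convention that a vector is replaced by $0$ if its denominator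 vanishes (for $n\ge2$ this has probability $0$). **Theorem 1.3 (Stability).** Let $1<p<2$, $0<\kappa<\frac1{3p}$ and $d>0$. There exist positive constants $C_1,C_2,C_3$, depending only on $p,\kappa,d$, such that for every $n\ge1$ and every (deterministic) $\delta$ with $n^{-\kappa}\le\delta\le1$, with probability at least $1-C_3n^{-d}$ the following holds: every $x\in\mathbb R^n$ with $\|x\|_p=1$ and $\mathrm{dist}(x,\mathcal O)\ge\delta$ satisfies $$\langle G_nx,x\rangle\le 2^{\frac12-\frac2p}\bigl(1-C_1\delta^6\bigr)\,\xi_{p^*}\,n^{1/p^*}+C_2\,n^{p/(2p^*)}\sqrt{\log n}.$$ In other words, on this event every $x$ with $\|x\|_p=1$ whose value $\langle G_nx,x\rangle$ exceeds the right-hand side lies within $\ell_p$-distance less than $\delta$ of $\mathcal O$. -/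

import Mathlib

open MeasureTheory ProbabilityTheory
open scoped Matrix

namespace GaussianGrothendieck

noncomputable section

/-- The `ℓ_p`-norm `(∑ |x_i|^p)^(1/p)` of `x ∈ ℝⁿ`, for a real exponent `p ≥ 1`. -/
def ellpNorm {n : ℕ} (p : ℝ) (x : Fin n → ℝ) : ℝ :=
  (∑ i, |x i| ^ p) ^ (1 / p)

/-- `ξ_q = (𝔼 |z|^q)^(1/q)` for a standard Gaussian random variable `z`. -/
def xi (q : ℝ) : ℝ :=
  (∫ z : ℝ, |z| ^ q ∂(gaussianReal 0 1)) ^ (1 / q)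

/-- The sign with the convention that the sign of `0` is `1`. -/
def sgn (a : ℝ) : ℝ :=
  if 0 ≤ a then 1 else -1

/-- The `i`-th standard basis vector `e_i` of `ℝⁿ`. -/
def basisVec {n : ℕ} (i : Fin n) : Fin n → ℝ :=
  Pi.single i 1

/-- The symmetrized matrix `(G + Gᵀ) / √2`. -/
def symm {n : ℕ} (G : Matrix (Fin n) (Fin n) ℝ) : Matrix (Fin n) (Fin n) ℝ :=
  (1 / √2) • (G + Gᵀ)

/-- The vector `v_i ∈ ℝⁿ` built from the `i`-th column of the symmetrized matrix; here
`Real.conjExponent p = p / (p - 1)` is the Hölder conjugate `p*` of `p`. -/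
def v {n : ℕ} (p : ℝ) (G : Matrix (Fin n) (Fin n) ℝ) (i : Fin n) : Fin n → ℝ :=
  fun j => sgn (symm G i j) *
    (|symm G i j| ^ Real.conjExponent p /
      ellpNorm (Real.conjExponent p) (symm G *ᵥ basisVec i) ^ Real.conjExponent p) ^ (1 / p)

/-- The set `𝒪` of the `2n` vectors `± (e_i + v_i) / ‖e_i + v_i‖_p`. -/
def nearOptimizers {n : ℕ} (p : ℝ) (G : Matrix (Fin n) (Fin n) ℝ) : Set (Fin n → ℝ) :=
  {y | ∃ i, y = (1 / ellpNorm p (basisVec i + v p G i)) • (basisVec i + v p G i) ∨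
    y = -((1 / ellpNorm p (basisVec i + v p G i)) • (basisVec i + v p G i))}

/-- The `ℓ_p`-distance from `x` to a set `S`. -/
def ellpDist {n : ℕ} (p : ℝ) (x : Fin n → ℝ) (S : Set (Fin n → ℝ)) : ℝ :=
  sInf ((fun y => ellpNorm p (x - y)) '' S)

/-- `G` is a random `n × n` matrix with independent standard Gaussian entries. -/
def IsStdGaussianMatrix {Ω : Type*} [MeasurableSpace Ω] {n : ℕ} (P : Measure Ω)
    (G : Ω → Matrix (Fin n) (Fin n) ℝ) : Prop :=
  (∀ i j, HasLaw (fun ω => G ω i j) (gaussianReal 0 1) P) ∧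
    iIndepFun (fun (ij : Fin n × Fin n) ω => G ω ij.1 ij.2) P

end

end GaussianGrothendieck

namespace GaussianGrothendieck

/-! ### Gaussian tails and Maurey–Pisier concentration -/

section GaussianConcentration

open scoped NNReal ENNReal

variable {E : Type*} [NormedAddCommGroup E] [InnerProductSpace ℝ E] [FiniteDimensional ℝ E]
  [MeasurableSpace E] [BorelSpace E]

/-! Write `q = p*`, `Ḡ = symm G` and `N = ξ_q n^{1/q}`. Split a unit vector as `x = y + z`, where
`y` carries the coordinates above a threshold of order `n^{-(p-1)/p}` and `z` the others. Dyadic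
layering bounds `⟨Gy,y⟩` and `⟨Gz,z⟩` by a multiple of `n^{(p-1)/2} √(log n)`, which is the error
term of the theorem because `p/(2q) = (p-1)/2`. What remains is `√2 ⟨Ḡy,z⟩`. Off the support of the
sparse vector `y`, the image `Ḡy` has `ℓ_q`-norm at most about `‖y‖₂ N`, so the cross term is at
most about `√2 ‖y‖₂ ‖z‖_p N`. With `a = ‖y‖_p^p` and `m = max |y_i|` one has `‖y‖₂² ≤ m^{2-p} a` and
`m^p ≤ a`, hence `(‖y‖₂ ‖z‖_p)^p ≤ a(1-a) ≤ 1/4`; this is the constant `√2 · 4^{-1/p} =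
2^{1/2-2/p}`.

If the value is within a factor `1 - τ⁴` of this maximum, every inequality is nearly tight
(`scalar_stability`): `a` is within `τ²` of `1/2`, and all but `O(τ⁴)` of the mass of `y` sits on
one coordinate `i`. The rest of `y` has `ℓ_2`-norm `O(τ²)`, so `z` is, up to sign, extremal for
Hölder's inequality against row `i` of `Ḡ` with relative deficit `O(τ²)`. Stability of Hölder
(`ellpNorm_sub_dualVec_le`) loses a square root and puts the normalized `z` within `O(τ)` of `±
v_i`; hence `x` is within `O(τ)` of `± 2^{-1/p}(e_i + v_i)` (`exists_close_of_large`). Taking `τ` a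
small multiple of `δ` yields a gain of order `δ⁴`, which is stronger than `δ⁶` for `δ ≤ 1`.

Randomness enters only through the events `SignBound` and `ColumnBound`, uniform estimates over sign
vectors and over integer vectors. Scalar Gaussian tails and concentration of the `ℓ_q`-norm give
each failure a probability `n^{-d}` times a power of `1/n` that grows with the support, which beats
the number of vectors in the union bound (`exists_signBound_columnBound`). -/

lemma map_dual_stdGaussian (L : StrongDual ℝ E) :
    (stdGaussian E).map L = gaussianReal 0 (‖L‖₊ ^ 2) := by
  rw [IsGaussian.map_eq_gaussianReal, integral_strongDual_stdGaussian, variance_dual_stdGaussian]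
  congr 1
  ext
  simp

lemma lintegral_exp_dual_stdGaussian (L : StrongDual ℝ E) :
    ∫⁻ x, ENNReal.ofReal (Real.exp (L x)) ∂(stdGaussian E)
      = ENNReal.ofReal (Real.exp (‖L‖ ^ 2 / 2)) := by
  have h := mgf_gaussianReal (p := stdGaussian E) (map_dual_stdGaussian L) 1
  have hi : Integrable (fun x => Real.exp (L x)) (stdGaussian E) := by
    have h1 := integrable_exp_mul_gaussianReal (μ := 0) (v := ‖L‖₊ ^ 2) 1
    rw [← map_dual_stdGaussian L] at h1
    have h2 := h1.comp_measurable (f := L) (by fun_prop)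
    simpa [Function.comp_def] using h2
  rw [← ofReal_integral_eq_lintegral_ofReal hi (ae_of_all _ fun x => (Real.exp_pos _).le)]
  congr 1
  simpa [mgf] using h

/-- Chernoff's bound with tilt `t / s`, the optimal one when `s` is the variance of `L`. Allowing
any upper bound `s` spares computing the variance exactly. -/
lemma stdGaussian_le_dual_le (L : StrongDual ℝ E) {s t : ℝ} (hs : 0 < s) (ht : 0 ≤ t)
    (hL : ‖L‖ ^ 2 ≤ s) :
    stdGaussian E {x | t ≤ L x} ≤ ENNReal.ofReal (Real.exp (-(t ^ 2 / (2 * s)))) := by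
  have hsub : {x | t ≤ L x} ⊆
      {x | ENNReal.ofReal (Real.exp (t ^ 2 / s)) ≤
        ENNReal.ofReal (Real.exp (((t / s) • L) x))} := by
    intro x hx
    have hx' : t ≤ L x := hx
    apply ENNReal.ofReal_le_ofReal
    apply Real.exp_le_exp.2
    have : t ^ 2 / s = t / s * t := by ring
    rw [this]
    simpa using mul_le_mul_of_nonneg_left hx' (div_nonneg ht hs.le)
  have hm := mul_meas_ge_le_lintegral₀ (μ := stdGaussian E)
    (f := fun x => ENNReal.ofReal (Real.exp (((t / s) • L) x))) (by fun_prop)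
    (ENNReal.ofReal (Real.exp (t ^ 2 / s)))
  rw [lintegral_exp_dual_stdGaussian] at hm
  have hnorm : ‖(t / s) • L‖ ^ 2 / 2 ≤ t ^ 2 / (2 * s) := by
    rw [norm_smul, Real.norm_of_nonneg (div_nonneg ht hs.le), mul_pow]
    calc (t / s) ^ 2 * ‖L‖ ^ 2 / 2 ≤ (t / s) ^ 2 * s / 2 := by gcongr
      _ = t ^ 2 / (2 * s) := by field_simp
  have h2 : ENNReal.ofReal (Real.exp (t ^ 2 / s)) * stdGaussian E {x | t ≤ L x} ≤
      ENNReal.ofReal (Real.exp (t ^ 2 / (2 * s))) := by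
    refine le_trans (mul_le_mul_right (measure_mono hsub) _) (hm.trans ?_)
    exact ENNReal.ofReal_le_ofReal (Real.exp_le_exp.2 hnorm)
  have h3 : ENNReal.ofReal (Real.exp (-(t ^ 2 / (2 * s)))) =
      ENNReal.ofReal (Real.exp (-(t ^ 2 / s))) * ENNReal.ofReal (Real.exp (t ^ 2 / (2 * s))) := by
    rw [← ENNReal.ofReal_mul (Real.exp_pos _).le, ← Real.exp_add]
    congr 2
    field_simp
    ring
  rw [h3]
  calc stdGaussian E {x | t ≤ L x}
      = ENNReal.ofReal (Real.exp (-(t ^ 2 / s))) *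
        (ENNReal.ofReal (Real.exp (t ^ 2 / s)) * stdGaussian E {x | t ≤ L x}) := by
        rw [← mul_assoc, ← ENNReal.ofReal_mul (Real.exp_pos _).le, ← Real.exp_add]
        simp
    _ ≤ _ := by gcongr

/-- Jensen's inequality for the exponential on an interval. -/
lemma exp_intervalIntegral_le {g : ℝ → ℝ} (hg : Continuous g) {T : ℝ} (hT : 0 < T) :
    Real.exp (∫ t in (0 : ℝ)..T, g t) ≤ T⁻¹ * ∫ t in (0 : ℝ)..T, Real.exp (T * g t) := by
  set I := ∫ t in (0 : ℝ)..T, g t with hI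
  have hmono : ∫ t in (0 : ℝ)..T, Real.exp I * (1 + (T * g t - I)) ≤
      ∫ t in (0 : ℝ)..T, Real.exp (T * g t) := by
    apply intervalIntegral.integral_mono_on hT.le
    · exact Continuous.intervalIntegrable (by fun_prop) _ _
    · exact Continuous.intervalIntegrable (by fun_prop) _ _
    · intro t _
      have h1 := Real.add_one_le_exp (T * g t - I)
      calc Real.exp I * (1 + (T * g t - I)) ≤ Real.exp I * Real.exp (T * g t - I) := by
            gcongr; linarith
        _ = Real.exp (T * g t) := by rw [← Real.exp_add]; congr 1; ring
  have hc : ∫ t in (0 : ℝ)..T, Real.exp I * (1 + (T * g t - I)) = T * Real.exp I := by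
    rw [intervalIntegral.integral_const_mul]
    have : ∀ t, 1 + (T * g t - I) = T * g t + (1 - I) := fun t => by ring
    simp_rw [this]
    rw [intervalIntegral.integral_add (Continuous.intervalIntegrable (by fun_prop) _ _)
      (by simp), intervalIntegral.integral_const_mul, intervalIntegral.integral_const, ← hI]
    simp only [sub_zero, smul_eq_mul]
    ring
  rw [hc] at hmono
  calc Real.exp I = T⁻¹ * (T * Real.exp I) := by field_simp
    _ ≤ _ := by gcongr

/-- Interpolation bound of Maurey and Pisier for functions of a standard Gaussian vector. -/
lemma lintegral_exp_sub_le_of_fderiv {F : E → ℝ} (hF : ContDiff ℝ 1 F)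
    (hL : ∀ x, ‖fderiv ℝ F x‖ ≤ 1) (c : ℝ) :
    ∫⁻ z, ENNReal.ofReal (Real.exp (c * (F z.2 - F z.1))) ∂(stdGaussian E).prod (stdGaussian E)
      ≤ ENNReal.ofReal (Real.exp (Real.pi ^ 2 * c ^ 2 / 8)) := by
  have hFc : Continuous F := hF.continuous
  have hDc : Continuous (fderiv ℝ F) := hF.continuous_fderiv one_ne_zero
  have hFd : Differentiable ℝ F := hF.differentiable one_ne_zero
  set γ := stdGaussian E with hγ
  have hpi : 0 < Real.pi / 2 := by positivity
  -- The first component of `R θ z` runs from `z.1` at `θ = 0` to `z.2` at `θ = π/2`, and its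
  -- velocity is the second component. So `F z.2 - F z.1` is an integral over `θ`, to which Jensen
  -- applies.
  obtain ⟨R, hR⟩ : ∃ R : ℝ → E × E → E × E, R = fun θ z => ContinuousLinearMap.rotation θ z :=
    ⟨_, rfl⟩
  have hRc : Continuous (fun w : ℝ × (E × E) => R w.1 w.2) := by
    simp only [hR, ContinuousLinearMap.rotation_apply]
    fun_prop
  obtain ⟨h, hh⟩ : ∃ h : E × E → ℝ,
      h = fun z => Real.exp (Real.pi / 2 * (c * fderiv ℝ F z.1 z.2)) := ⟨_, rfl⟩
  have hhc : Continuous h := by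
    have : Continuous (fun z : E × E => fderiv ℝ F z.1 z.2) :=
      (hDc.comp continuous_fst).clm_apply continuous_snd
    simp only [hh]
    fun_prop
  have hpt : ∀ z : E × E, ENNReal.ofReal (Real.exp (c * (F z.2 - F z.1))) ≤
      ENNReal.ofReal (Real.pi / 2)⁻¹ *
        ∫⁻ (θ : ℝ) in Set.Ioc 0 (Real.pi / 2), ENNReal.ofReal (h (R θ z)) := by
    intro z
    have hRθ : Continuous (fun θ => R θ z) := by
      simp only [hR, ContinuousLinearMap.rotation_apply]
      fun_prop
    have hder : ∀ θ : ℝ, HasDerivAt (fun θ => F (R θ z).1) (fderiv ℝ F (R θ z).1 (R θ z).2) θ := by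
      intro θ
      have h1 : HasDerivAt (fun θ => (R θ z).1) ((R θ z).2) θ := by
        simp only [hR, ContinuousLinearMap.rotation_apply]
        exact ((Real.hasDerivAt_cos θ).smul_const z.1).add ((Real.hasDerivAt_sin θ).smul_const z.2)
      exact HasFDerivAt.comp_hasDerivAt (f := fun θ => (R θ z).1) θ (hFd (R θ z).1).hasFDerivAt h1
    have hgc : Continuous (fun θ => fderiv ℝ F (R θ z).1 (R θ z).2) :=
      (hDc.comp (continuous_fst.comp hRθ)).clm_apply (continuous_snd.comp hRθ)
    have hftc : ∫ θ in (0 : ℝ)..(Real.pi / 2), fderiv ℝ F (R θ z).1 (R θ z).2 = F z.2 - F z.1 := by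
      rw [intervalIntegral.integral_eq_sub_of_hasDerivAt (fun θ _ => hder θ)
        (hgc.intervalIntegrable _ _)]
      simp [hR, ContinuousLinearMap.rotation_apply]
    have hJ := exp_intervalIntegral_le (g := fun θ => c * fderiv ℝ F (R θ z).1 (R θ z).2)
      (by fun_prop) hpi
    rw [intervalIntegral.integral_const_mul, hftc] at hJ
    refine (ENNReal.ofReal_le_ofReal hJ).trans ?_
    rw [ENNReal.ofReal_mul (by positivity)]
    gcongr
    rw [intervalIntegral.integral_of_le hpi.le, ofReal_integral_eq_lintegral_ofReal]
    · simp only [hh]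
      exact le_rfl
    · exact (Continuous.integrableOn_Icc (by fun_prop)).mono_set Set.Ioc_subset_Icc_self
    · exact ae_of_all _ fun _ => (Real.exp_pos _).le
  -- Rotations preserve `γ.prod γ`, so `R θ` may be dropped. With the first variable fixed, the
  -- exponent is then a linear functional of the independent second variable, of norm at most `π |c|
  -- / 2`.
  have hrot : ∀ θ, ∫⁻ z, ENNReal.ofReal (h (R θ z)) ∂(γ.prod γ) ≤
      ENNReal.ofReal (Real.exp (Real.pi ^ 2 * c ^ 2 / 8)) := by
    intro θ
    have hmap := IsGaussian.map_rotation_eq_self (μ := γ) (by simp [hγ]) θ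
    have hRθ : Continuous (R θ) := by
      simp only [hR]
      fun_prop
    have h1 : ∫⁻ z, ENNReal.ofReal (h (R θ z)) ∂(γ.prod γ) =
        ∫⁻ z, ENNReal.ofReal (h z) ∂(γ.prod γ) := by
      conv_rhs => rw [← hmap]
      rw [lintegral_map (by fun_prop) (by fun_prop)]
      simp only [hR]
    rw [h1, lintegral_prod _ (by fun_prop)]
    have h2 : ∀ x, ∫⁻ y, ENNReal.ofReal (h (x, y)) ∂γ ≤
        ENNReal.ofReal (Real.exp (Real.pi ^ 2 * c ^ 2 / 8)) := by
      intro x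
      have h3 := lintegral_exp_dual_stdGaussian ((Real.pi / 2 * c) • fderiv ℝ F x)
      have h4 : ∫⁻ y, ENNReal.ofReal (h (x, y)) ∂γ = ENNReal.ofReal (Real.exp
          (‖(Real.pi / 2 * c) • fderiv ℝ F x‖ ^ 2 / 2)) := by
        rw [← h3]
        simp only [hh, FunLike.coe_smul, Pi.smul_apply, smul_eq_mul, mul_assoc]
        rfl
      rw [h4]
      apply ENNReal.ofReal_le_ofReal
      apply Real.exp_le_exp.2
      rw [norm_smul, mul_pow, Real.norm_eq_abs, sq_abs]
      have h5 : ‖fderiv ℝ F x‖ ^ 2 ≤ 1 := pow_le_one₀ (norm_nonneg _) (hL x)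
      nlinarith [sq_nonneg (Real.pi / 2 * c), mul_le_mul_of_nonneg_left h5 (sq_nonneg (Real.pi / 2 * c))]
    calc ∫⁻ x, ∫⁻ y, ENNReal.ofReal (h (x, y)) ∂γ ∂γ ≤
        ∫⁻ _, ENNReal.ofReal (Real.exp (Real.pi ^ 2 * c ^ 2 / 8)) ∂γ := lintegral_mono h2
      _ = _ := by simp
  calc ∫⁻ z, ENNReal.ofReal (Real.exp (c * (F z.2 - F z.1))) ∂γ.prod γ
      ≤ ∫⁻ z, ENNReal.ofReal (Real.pi / 2)⁻¹ *
        (∫⁻ (θ : ℝ) in Set.Ioc 0 (Real.pi / 2), ENNReal.ofReal (h (R θ z))) ∂γ.prod γ := lintegral_mono hpt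
    _ = ENNReal.ofReal (Real.pi / 2)⁻¹ * ∫⁻ z,
        (∫⁻ (θ : ℝ) in Set.Ioc 0 (Real.pi / 2), ENNReal.ofReal (h (R θ z))) ∂γ.prod γ := by
        rw [lintegral_const_mul' _ _ ENNReal.ofReal_ne_top]
    _ = ENNReal.ofReal (Real.pi / 2)⁻¹ *
        ∫⁻ (θ : ℝ) in Set.Ioc 0 (Real.pi / 2), ∫⁻ z, ENNReal.ofReal (h (R θ z)) ∂γ.prod γ := by
        rw [lintegral_lintegral_swap]
        have : Continuous (fun w : (E × E) × ℝ => h (R w.2 w.1)) :=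
          hhc.comp (hRc.comp (continuous_snd.prodMk continuous_fst))
        exact (ENNReal.measurable_ofReal.comp this.measurable).aemeasurable
    _ ≤ ENNReal.ofReal (Real.pi / 2)⁻¹ * ∫⁻ _ in Set.Ioc (0 : ℝ) (Real.pi / 2),
        ENNReal.ofReal (Real.exp (Real.pi ^ 2 * c ^ 2 / 8)) := by
        gcongr with θ
        exact hrot θ
    _ = ENNReal.ofReal (Real.exp (Real.pi ^ 2 * c ^ 2 / 8)) := by
        rw [setLIntegral_const, Real.volume_Ioc, sub_zero, mul_comm (ENNReal.ofReal (Real.exp _)),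
          ← mul_assoc, ← ENNReal.ofReal_mul (by positivity), inv_mul_cancel₀ hpi.ne']
        simp

/-- Two-point form of Gaussian concentration. -/
lemma stdGaussian_mul_le_of_fderiv {F : E → ℝ} (hF : ContDiff ℝ 1 F)
    (hL : ∀ x, ‖fderiv ℝ F x‖ ≤ 1) {M r : ℝ} (hr : 0 ≤ r) :
    stdGaussian E {x | F x ≤ M} * stdGaussian E {x | M + r ≤ F x} ≤
      ENNReal.ofReal (Real.exp (-(2 * r ^ 2 / Real.pi ^ 2))) := by
  -- Minimizer of `π² c² / 8 - c r`.
  set c : ℝ := 4 * r / Real.pi ^ 2 with hc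
  have hc0 : 0 ≤ c := by positivity
  have hFc : Continuous F := hF.continuous
  have h1 := lintegral_exp_sub_le_of_fderiv hF hL c
  have hm := mul_meas_ge_le_lintegral₀ (μ := (stdGaussian E).prod (stdGaussian E))
    (f := fun z => ENNReal.ofReal (Real.exp (c * (F z.2 - F z.1)))) (by fun_prop)
    (ENNReal.ofReal (Real.exp (c * r)))
  have hsub : {x | F x ≤ M} ×ˢ {x | M + r ≤ F x} ⊆
      {z : E × E | ENNReal.ofReal (Real.exp (c * r)) ≤
        ENNReal.ofReal (Real.exp (c * (F z.2 - F z.1)))} := by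
    rintro ⟨x, y⟩ ⟨hx, hy⟩
    simp only [Set.mem_ofPred_eq] at hx hy ⊢
    apply ENNReal.ofReal_le_ofReal
    apply Real.exp_le_exp.2
    gcongr
    linarith
  rw [← Measure.prod_prod]
  have h2 := (mul_le_mul_right (measure_mono hsub) (ENNReal.ofReal (Real.exp (c * r)))).trans
    (hm.trans h1)
  set A := ((stdGaussian E).prod (stdGaussian E)) ({x | F x ≤ M} ×ˢ {x | M + r ≤ F x})
  calc A = ENNReal.ofReal (Real.exp (-(c * r))) * (ENNReal.ofReal (Real.exp (c * r)) * A) := by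
        rw [← mul_assoc, ← ENNReal.ofReal_mul (Real.exp_pos _).le, ← Real.exp_add]
        simp
    _ ≤ ENNReal.ofReal (Real.exp (-(c * r))) *
        ENNReal.ofReal (Real.exp (Real.pi ^ 2 * c ^ 2 / 8)) := by gcongr
    _ = _ := by
        rw [← ENNReal.ofReal_mul (Real.exp_pos _).le, ← Real.exp_add]
        congr 2
        rw [hc]
        field_simp
        ring

end GaussianConcentration

/-! ### Concentration of the ℓ_q-norm -/

section NormConcentration

open scoped NNReal ENNReal

/-- Each `|a j|` is at most the `ℓ_2`-norm, so `q - 2` of its powers can be pulled out of the sum.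
This is what makes the `ℓ_q`-norm Lipschitz for the Euclidean metric. -/
lemma rpow_sum_rpow_le_sqrt_sum_sq {J : Type*} (s : Finset J) (a : J → ℝ) {q : ℝ} (hq : 2 ≤ q) :
    (∑ j ∈ s, |a j| ^ q) ^ (1 / q) ≤ √(∑ j ∈ s, a j ^ 2) := by
  have hq0 : 0 < q := by linarith
  set S := √(∑ j ∈ s, a j ^ 2) with hS
  have hS0 : 0 ≤ S := Real.sqrt_nonneg _
  have hsq : S ^ 2 = ∑ j ∈ s, a j ^ 2 := Real.sq_sqrt (Finset.sum_nonneg fun _ _ => sq_nonneg _)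
  have hle : ∀ j ∈ s, |a j| ≤ S := fun j hj =>
    Real.abs_le_sqrt (Finset.single_le_sum (f := fun j => a j ^ 2) (fun _ _ => sq_nonneg _) hj)
  have hmain : ∑ j ∈ s, |a j| ^ q ≤ S ^ q := by
    have hsplit : ∀ t : ℝ, 0 ≤ t → t ^ q = t ^ (q - 2) * t ^ 2 := by
      intro t ht
      rw [← Real.rpow_natCast t 2, ← Real.rpow_add_of_nonneg ht (by linarith) (by norm_num)]
      norm_num
    calc ∑ j ∈ s, |a j| ^ q ≤ ∑ j ∈ s, S ^ (q - 2) * a j ^ 2 := by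
          apply Finset.sum_le_sum
          intro j hj
          rw [hsplit _ (abs_nonneg _), sq_abs]
          gcongr
          exact hle j hj
      _ = S ^ q := by rw [← Finset.mul_sum, ← hsq, ← hsplit _ hS0]
  calc (∑ j ∈ s, |a j| ^ q) ^ (1 / q) ≤ (S ^ q) ^ (1 / q) := by gcongr
    _ = S := by rw [← Real.rpow_mul hS0, mul_one_div_cancel hq0.ne', Real.rpow_one]

/-- The absolute moment `𝔼 |z|^q` of a standard Gaussian variable. -/
noncomputable def absMoment (q : ℝ) : ℝ := ∫ z : ℝ, |z| ^ q ∂(gaussianReal 0 1)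

lemma integrable_abs_rpow_gaussianReal {q : ℝ} (hq : 0 < q) :
    Integrable (fun z : ℝ => |z| ^ q) (gaussianReal 0 1) := by
  have h := (memLp_id_gaussianReal' (μ := 0) (v := 1) (ENNReal.ofReal q)
    ENNReal.ofReal_ne_top).integrable_norm_rpow (by simpa using hq) ENNReal.ofReal_ne_top
  simpa [ENNReal.toReal_ofReal hq.le] using h

lemma absMoment_pos {q : ℝ} (hq : 0 < q) : 0 < absMoment q := by
  unfold absMoment
  rw [integral_pos_iff_support_of_nonneg (fun z => by positivity)
    (integrable_abs_rpow_gaussianReal hq)]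
  have hs : Function.support (fun z : ℝ => |z| ^ q) = {0}ᶜ := by
    ext z
    simp [Function.mem_support, Real.rpow_eq_zero (abs_nonneg z) hq.ne']
  have := nullSingletonClass_gaussianReal (μ := 0) (v := 1) one_ne_zero
  rw [hs, prob_compl_eq_one_sub (measurableSet_singleton 0)]
  simp

variable {E : Type*} [NormedAddCommGroup E] [InnerProductSpace ℝ E] {J : Type*} [Fintype J]

/-- The added `1` keeps the base of the outer power away from `0`, giving the `C¹` regularity that
the interpolation argument needs. -/
lemma contDiff_regularized_norm {q : ℝ} (hq : 1 < q) (L : J → StrongDual ℝ E) :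
    ContDiff ℝ 1 (fun x => (1 + ∑ j, |L j x| ^ q) ^ (1 / q)) := by
  have h1 : ContDiff ℝ 1 (fun x => 1 + ∑ j, |L j x| ^ q) := by
    apply contDiff_const.add
    apply ContDiff.sum
    intro j _
    simpa using (L j).contDiff.norm_rpow hq
  rw [contDiff_iff_contDiffAt]
  intro x
  apply ContDiffAt.rpow_const_of_ne h1.contDiffAt
  positivity

/-- Minkowski's inequality over `Option J`: the regularizing `1` is an extra coordinate, constant in
the argument, so it disappears from the difference. -/
lemma regularized_norm_le_add {q : ℝ} (hq : 2 ≤ q) (L : J → StrongDual ℝ E)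
    (hL : ∀ x, ∑ j, L j x ^ 2 ≤ ‖x‖ ^ 2) (x y : E) :
    (1 + ∑ j, |L j x| ^ q) ^ (1 / q) ≤ (1 + ∑ j, |L j y| ^ q) ^ (1 / q) + ‖x - y‖ := by
  have hq0 : 0 < q := by linarith
  have h1 := Real.Lp_add_le (Finset.univ : Finset (Option J))
    (fun o => o.elim 1 (fun j => L j y)) (fun o => o.elim 0 (fun j => L j (x - y)))
    (p := q) (by linarith)
  simp only [Fintype.sum_option, Option.elim] at h1
  simp only [add_zero, abs_one, Real.one_rpow, abs_zero, Real.zero_rpow hq0.ne', zero_add,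
    map_sub, add_sub_cancel] at h1
  refine h1.trans (add_le_add le_rfl ?_)
  have h2 := rpow_sum_rpow_le_sqrt_sum_sq Finset.univ (fun j => L j (x - y)) hq
  simp only [map_sub] at h2
  refine h2.trans (Real.sqrt_le_iff.2 ⟨norm_nonneg _, ?_⟩)
  simpa using hL (x - y)

variable [FiniteDimensional ℝ E] [MeasurableSpace E] [BorelSpace E]

lemma lintegral_abs_rpow_dual_le {q : ℝ} (hq : 0 < q) (L : StrongDual ℝ E) (hL : ‖L‖ ≤ 1) :
    ∫⁻ x, ENNReal.ofReal (|L x| ^ q) ∂(stdGaussian E) ≤ ENNReal.ofReal (absMoment q) := by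
  have hm : Measurable (fun z : ℝ => ENNReal.ofReal (|z| ^ q)) := by fun_prop
  have h1 : ∫⁻ x, ENNReal.ofReal (|L x| ^ q) ∂(stdGaussian E) =
      ∫⁻ z, ENNReal.ofReal (|z| ^ q) ∂(gaussianReal 0 (‖L‖₊ ^ 2)) := by
    rw [← map_dual_stdGaussian, lintegral_map hm (by fun_prop)]
  have h2 : gaussianReal 0 (‖L‖₊ ^ 2) = (gaussianReal 0 1).map (fun z => ‖L‖ * z) := by
    rw [gaussianReal_map_const_mul]
    congr 1
    · simp
    · ext; simp
  rw [h1, h2, lintegral_map hm (by fun_prop), absMoment, ofReal_integral_eq_lintegral_ofReal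
    (integrable_abs_rpow_gaussianReal hq) (ae_of_all _ fun z => by positivity)]
  apply lintegral_mono
  intro z
  apply ENNReal.ofReal_le_ofReal
  apply Real.rpow_le_rpow (abs_nonneg _) _ hq.le
  rw [abs_mul, abs_of_nonneg (norm_nonneg L)]
  exact mul_le_of_le_one_left (abs_nonneg _) hL

/-- Concentration of the `ℓ_q`-norm of a Gaussian vector with not necessarily independent
coordinates. -/
lemma stdGaussian_le_rpow_sum_le {q : ℝ} (hq : 2 ≤ q) (L : J → StrongDual ℝ E)
    (hL : ∀ x, ∑ j, L j x ^ 2 ≤ ‖x‖ ^ 2) {n : ℕ} (hn : Fintype.card J ≤ n) {r : ℝ} (hr : 0 ≤ r) :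
    stdGaussian E {x | (n * absMoment q) ^ (1 / q) + 2 + r ≤ (∑ j, |L j x| ^ q) ^ (1 / q)} ≤
      ENNReal.ofReal ((n * absMoment q + 2) * Real.exp (-(2 * r ^ 2 / Real.pi ^ 2))) := by
  have hq0 : 0 < q := by linarith
  set m := absMoment q with hm
  have hm0 : 0 < m := absMoment_pos hq0
  set F : E → ℝ := fun x => (1 + ∑ j, |L j x| ^ q) ^ (1 / q) with hF
  -- `F ^ q` has mean at most `n m + 1`, so Markov gives `F ≤ M` probability at least `1 / (n m +
  -- 2)`. This replaces a median in the two-point inequality, at the price of the prefactor `n m +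
  -- 2`.
  set M := (n * m + 2) ^ (1 / q) with hM
  have hFd : ContDiff ℝ 1 F := contDiff_regularized_norm (by linarith) L
  have hlip : LipschitzWith 1 F := by
    apply LipschitzWith.of_le_add
    intro x y
    rw [dist_eq_norm]
    exact regularized_norm_le_add hq L hL x y
  have hconc := stdGaussian_mul_le_of_fderiv hFd
    (fun x => by simpa using norm_fderiv_le_of_lipschitz ℝ hlip (x₀ := x)) (M := M) hr
  have hMle : M ≤ (n * m) ^ (1 / q) + 2 := by
    calc M ≤ (n * m) ^ (1 / q) + 2 ^ (1 / q) :=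
          Real.rpow_add_le_add_rpow (by positivity) (by norm_num) (by positivity)
            ((div_le_one hq0).2 (by linarith))
      _ ≤ (n * m) ^ (1 / q) + 2 ^ (1 : ℝ) := by
          gcongr
          · norm_num
          · exact (div_le_one hq0).2 (by linarith)
      _ = _ := by simp
  have hLn : ∀ j, ‖L j‖ ≤ 1 := by
    intro j
    apply ContinuousLinearMap.opNorm_le_bound _ zero_le_one
    intro x
    rw [one_mul, Real.norm_eq_abs]
    exact abs_le_of_sq_le_sq ((Finset.single_le_sum (f := fun j => L j x ^ 2)
      (fun _ _ => sq_nonneg _) (Finset.mem_univ j)).trans (hL x)) (norm_nonneg _)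
  have hint : ∫⁻ x, ENNReal.ofReal (1 + ∑ j, |L j x| ^ q) ∂(stdGaussian E) ≤
      ENNReal.ofReal (n * m + 1) := by
    have h1 : ∀ x, ENNReal.ofReal (1 + ∑ j, |L j x| ^ q) =
        1 + ∑ j, ENNReal.ofReal (|L j x| ^ q) := by
      intro x
      rw [ENNReal.ofReal_add zero_le_one (by positivity), ENNReal.ofReal_one,
        ENNReal.ofReal_sum_of_nonneg (fun j _ => by positivity)]
    simp_rw [h1]
    rw [lintegral_add_left measurable_const, lintegral_finsetSum _ (fun j _ => by fun_prop)]
    simp only [lintegral_const, measure_univ, mul_one]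
    calc 1 + ∑ j, ∫⁻ x, ENNReal.ofReal (|L j x| ^ q) ∂(stdGaussian E)
        ≤ 1 + ∑ _j : J, ENNReal.ofReal m := by
          gcongr with j
          exact lintegral_abs_rpow_dual_le hq0 _ (hLn j)
      _ = 1 + Fintype.card J * ENNReal.ofReal m := by simp
      _ ≤ 1 + n * ENNReal.ofReal m := by gcongr
      _ = ENNReal.ofReal (n * m + 1) := by
          rw [ENNReal.ofReal_add (by positivity) zero_le_one, ENNReal.ofReal_mul (by positivity)]
          simp [add_comm]
  have hgt : stdGaussian E {x | M < F x} ≤ ENNReal.ofReal ((n * m + 1) / (n * m + 2)) := by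
    have hsub : {x | M < F x} ⊆
        {x | ENNReal.ofReal (n * m + 2) ≤ ENNReal.ofReal (1 + ∑ j, |L j x| ^ q)} := by
      intro x hx
      apply ENNReal.ofReal_le_ofReal
      have hx' : M < F x := hx
      exact ((Real.rpow_lt_rpow_iff (by positivity) (by positivity) (by positivity)).1 hx').le
    have h1 := (mul_meas_ge_le_lintegral₀ (μ := stdGaussian E)
      (f := fun x => ENNReal.ofReal (1 + ∑ j, |L j x| ^ q)) (by fun_prop)
      (ENNReal.ofReal (n * m + 2))).trans hint
    rw [ENNReal.ofReal_div_of_pos (by positivity), ENNReal.le_div_iff_mul_le (by left; simp; positivity)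
      (by simp), mul_comm]
    exact (mul_le_mul_right (measure_mono hsub) _).trans h1
  have hle : ENNReal.ofReal (1 / (n * m + 2)) ≤ stdGaussian E {x | F x ≤ M} := by
    have hmeas : MeasurableSet {x | M < F x} :=
      measurableSet_lt measurable_const hFd.continuous.measurable
    have hc : {x | F x ≤ M} = {x | M < F x}ᶜ := by ext x; simp
    rw [hc, prob_compl_eq_one_sub hmeas]
    refine le_trans ?_ (tsub_le_tsub_left hgt 1)
    rw [← ENNReal.ofReal_one, ← ENNReal.ofReal_sub _ (by positivity)]
    apply ENNReal.ofReal_le_ofReal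
    apply le_of_eq
    field_simp
    ring
  have hsub : {x | (n * m) ^ (1 / q) + 2 + r ≤ (∑ j, |L j x| ^ q) ^ (1 / q)} ⊆
      {x | M + r ≤ F x} := by
    intro x hx
    have hx' : (n * m) ^ (1 / q) + 2 + r ≤ (∑ j, |L j x| ^ q) ^ (1 / q) := hx
    have : (∑ j, |L j x| ^ q) ^ (1 / q) ≤ F x := by
      simp only [hF]
      gcongr
      linarith
    simp only [Set.mem_ofPred_eq]
    linarith
  refine (measure_mono hsub).trans ?_
  have hpos : (0 : ℝ) < n * m + 2 := by positivity
  calc stdGaussian E {x | M + r ≤ F x}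
      = ENNReal.ofReal (n * m + 2) *
        (ENNReal.ofReal (1 / (n * m + 2)) * stdGaussian E {x | M + r ≤ F x}) := by
        rw [← mul_assoc, ← ENNReal.ofReal_mul hpos.le, mul_one_div_cancel hpos.ne']
        simp
    _ ≤ ENNReal.ofReal (n * m + 2) * (stdGaussian E {x | F x ≤ M} *
        stdGaussian E {x | M + r ≤ F x}) := by gcongr
    _ ≤ ENNReal.ofReal (n * m + 2) * ENNReal.ofReal (Real.exp (-(2 * r ^ 2 / Real.pi ^ 2))) := by
        gcongr
    _ = _ := by rw [← ENNReal.ofReal_mul hpos.le]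

end NormConcentration

/-! ### The two good events; union bound over sign vectors -/

section GoodEvent

open scoped NNReal ENNReal

/-- The number of nonzero coordinates of an integer vector. -/
def suppCard {n : ℕ} (f : Fin n → ℤ) : ℕ := (Finset.univ.filter fun i => f i ≠ 0).card

/-- The bilinear form `∑ x_i G_ij y_j`. -/
def bil {n : ℕ} (G : Matrix (Fin n) (Fin n) ℝ) (x y : Fin n → ℝ) : ℝ :=
  ∑ i, ∑ j, x i * G i j * y j

/-- All sign vectors satisfy the bound expected from scalar Gaussian tails. -/
def SignBound {n : ℕ} (K : ℝ) (G : Matrix (Fin n) (Fin n) ℝ) : Prop :=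
  ∀ f g : Fin n → ℤ, (∀ i, f i ∈ Finset.Icc (-1 : ℤ) 1) → (∀ i, g i ∈ Finset.Icc (-1 : ℤ) 1) →
    bil G (fun i => f i) (fun i => g i) ≤
      K * √(Real.log n) * (suppCard f * √(suppCard g) + suppCard g * √(suppCard f))

/-- The images under the symmetrized matrix of integer vectors, restricted to the complement of
the support, have `ℓ_q`-norms close to their expected size. -/
def ColumnBound {n : ℕ} (q K : ℝ) (G : Matrix (Fin n) (Fin n) ℝ) : Prop :=
  ∀ m : Fin n → ℤ, (∀ i, m i ∈ Finset.Icc (-(n ^ 2 : ℕ) : ℤ) (n ^ 2 : ℕ)) →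
    (∑ j with m j = 0, |∑ i, m i * symm G i j| ^ q) ^ (1 / q) ≤
      √(∑ i, (m i : ℝ) ^ 2) *
        ((n * absMoment q) ^ (1 / q) + K * √(suppCard m) * √(Real.log n))

/-- The sum factors over coordinates: the value `0` contributes `1`, and each of the `2 N` nonzero
values contributes `t`. With `t` of order `1 / (n N)` the total stays bounded, which is how the
union bounds close. -/
lemma sum_pow_suppCard (n N : ℕ) (t : ℝ) :
    ∑ f ∈ Fintype.piFinset (fun _ : Fin n => Finset.Icc (-N : ℤ) N), t ^ suppCard f =
      (1 + 2 * N * t) ^ n := by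
  have h1 : ∀ f : Fin n → ℤ, t ^ suppCard f = ∏ i, (if f i ≠ 0 then t else 1) := by
    intro f
    rw [suppCard, Finset.prod_ite]
    simp
  simp_rw [h1]
  rw [← Finset.prod_univ_sum (fun _ : Fin n => Finset.Icc (-N : ℤ) N)
    (fun _ k => if k ≠ 0 then t else 1)]
  have h2 : ∑ k ∈ Finset.Icc (-N : ℤ) N, (if k ≠ 0 then t else 1) = 1 + 2 * N * t := by
    rw [← Finset.sum_erase_add _ _ (show (0 : ℤ) ∈ Finset.Icc (-N : ℤ) N by simp)]
    rw [Finset.sum_congr rfl (g := fun _ => t)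
      (fun x hx => if_pos (Finset.ne_of_mem_erase hx))]
    rw [Finset.sum_const, Finset.card_erase_of_mem (by simp), Int.card_Icc]
    have : (N + 1 - (-N : ℤ)).toNat - 1 = 2 * N := by omega
    rw [this]
    simp
    ring
  rw [Finset.prod_const, h2]
  simp

lemma sum_sq_le_suppCard {n : ℕ} (f : Fin n → ℤ) (hf : ∀ i, f i ∈ Finset.Icc (-1 : ℤ) 1) :
    ∑ i, (f i : ℝ) ^ 2 = suppCard f := by
  rw [suppCard, Finset.card_filter, Nat.cast_sum]
  apply Finset.sum_congr rfl
  intro i _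
  have := Finset.mem_Icc.1 (hf i)
  have h3 : f i = -1 ∨ f i = 0 ∨ f i = 1 := by omega
  rcases h3 with h | h | h <;> simp [h]

lemma sum_sq_pos_of_ne {n : ℕ} {m : Fin n → ℤ} (hm : m ≠ 0) : 0 < ∑ i, (m i : ℝ) ^ 2 := by
  obtain ⟨i, hi⟩ := Function.ne_iff.1 hm
  apply Finset.sum_pos' (fun _ _ => sq_nonneg _)
  refine ⟨i, Finset.mem_univ _, ?_⟩
  have : (m i : ℝ) ≠ 0 := by exact_mod_cast hi
  positivity

lemma suppCard_pos_of_ne {n : ℕ} {m : Fin n → ℤ} (hm : m ≠ 0) : 1 ≤ suppCard m := by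
  obtain ⟨i, hi⟩ := Function.ne_iff.1 hm
  exact Finset.card_pos.2 ⟨i, by simpa using hi⟩

/-- The Euclidean space of `n × n` matrices. -/
abbrev MatSpace (n : ℕ) := EuclideanSpace ℝ (Fin n × Fin n)

/-- The matrix with the given coordinates. -/
def toMat {n : ℕ} (x : MatSpace n) : Matrix (Fin n) (Fin n) ℝ := fun i j => x (i, j)

lemma exp_neg_mul_log {n : ℕ} (hn : 2 ≤ n) (d : ℝ) (k : ℕ) :
    Real.exp (-((d + k) * Real.log n)) = (n : ℝ) ^ (-d) * ((n : ℝ)⁻¹) ^ k := by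
  have hn0 : (0 : ℝ) < n := by positivity
  rw [inv_pow, ← Real.rpow_natCast, ← Real.rpow_neg hn0.le, ← Real.rpow_add hn0,
    Real.rpow_def_of_pos hn0]
  congr 1
  ring

lemma one_add_div_pow_le (n : ℕ) (hn : 2 ≤ n) (c : ℝ) (hc : 0 ≤ c) :
    (1 + c * (n : ℝ)⁻¹) ^ n ≤ Real.exp c := by
  have hn0 : (0 : ℝ) < n := by positivity
  calc (1 + c * (n : ℝ)⁻¹) ^ n ≤ (Real.exp (c * (n : ℝ)⁻¹)) ^ n := by
        gcongr
        linarith [Real.add_one_le_exp (c * (n : ℝ)⁻¹)]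
    _ = Real.exp c := by
        rw [← Real.exp_nat_mul]
        congr 1
        field_simp

/-- For supports of sizes `a` and `b` the form is Gaussian of variance `a b`, while the squared
threshold is at least `K² log n · a b (a + b)`. The tail is therefore at most `n^{-(d+a+b)}`; the
powers `a` and `b` pay for the choice of the two sign vectors. -/
lemma stdGaussian_not_bil_le {n : ℕ} (hn : 2 ≤ n) {d K : ℝ} (hd : 0 < d) (hK0 : 0 < K)
    (hK : d + 1 ≤ K ^ 2 / 2) (f g : Fin n → ℤ) (hf : ∀ i, f i ∈ Finset.Icc (-1 : ℤ) 1)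
    (hg : ∀ i, g i ∈ Finset.Icc (-1 : ℤ) 1) :
    stdGaussian (MatSpace n) {x | K * √(Real.log n) *
      (suppCard f * √(suppCard g) + suppCard g * √(suppCard f)) <
        bil (toMat x) (fun i => f i) (fun i => g i)} ≤
      ENNReal.ofReal ((n : ℝ) ^ (-d) * (((n : ℝ)⁻¹) ^ suppCard f * ((n : ℝ)⁻¹) ^ suppCard g)) := by
  -- Zero vectors are set aside because the tail bound needs a positive variance proxy `a b`.
  by_cases hf0 : f = 0
  · have : {x : MatSpace n | K * √(Real.log n) *
      (suppCard f * √(suppCard g) + suppCard g * √(suppCard f)) <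
        bil (toMat x) (fun i => f i) (fun i => g i)} = ∅ := by
      ext x
      simp only [Set.mem_ofPred_eq, Set.mem_empty_iff_false, iff_false, not_lt]
      simp only [hf0, bil, Pi.zero_apply, Int.cast_zero, zero_mul, Finset.sum_const_zero]
      positivity
    rw [this]
    simp
  by_cases hg0 : g = 0
  · have : {x : MatSpace n | K * √(Real.log n) *
      (suppCard f * √(suppCard g) + suppCard g * √(suppCard f)) <
        bil (toMat x) (fun i => f i) (fun i => g i)} = ∅ := by
      ext x
      simp only [Set.mem_ofPred_eq, Set.mem_empty_iff_false, iff_false, not_lt]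
      simp only [hg0, bil, Pi.zero_apply, Int.cast_zero, mul_zero, Finset.sum_const_zero]
      positivity
    rw [this]
    simp
  set a : ℝ := (suppCard f : ℝ) with ha
  set b : ℝ := (suppCard g : ℝ) with hb
  have ha1 : 1 ≤ a := by rw [ha]; exact_mod_cast suppCard_pos_of_ne hf0
  have hb1 : 1 ≤ b := by rw [hb]; exact_mod_cast suppCard_pos_of_ne hg0
  have hlog : 0 ≤ Real.log n := Real.log_natCast_nonneg n
  set L : StrongDual ℝ (MatSpace n) :=
    innerSL ℝ (WithLp.toLp 2 (fun ij : Fin n × Fin n => (f ij.1 : ℝ) * g ij.2)) with hL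
  have hLx : ∀ x : MatSpace n, L x = bil (toMat x) (fun i => f i) (fun i => g i) := by
    intro x
    simp only [hL, innerSL_apply_apply, PiLp.inner_apply, bil, toMat, Fintype.sum_prod_type]
    refine Finset.sum_congr rfl fun i _ => Finset.sum_congr rfl fun j _ => ?_
    simp
    ring
  have hLn : ‖L‖ ^ 2 ≤ a * b := by
    rw [hL, innerSL_apply_norm, EuclideanSpace.real_norm_sq_eq, Fintype.sum_prod_type]
    simp only [mul_pow]
    rw [← Finset.sum_mul_sum, sum_sq_le_suppCard f hf, sum_sq_le_suppCard g hg]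
  set t := K * √(Real.log n) * (a * √b + b * √a) with ht
  have htail := stdGaussian_le_dual_le L (s := a * b) (t := t) (by positivity) (by positivity) hLn
  have hsub : {x | t < bil (toMat x) (fun i => f i) (fun i => g i)} ⊆ {x | t ≤ L x} := by
    intro x hx
    have hx' : t < bil (toMat x) (fun i => f i) (fun i => g i) := hx
    rw [← hLx] at hx'
    exact hx'.le
  refine (measure_mono hsub).trans (htail.trans (ENNReal.ofReal_le_ofReal ?_))
  rw [← pow_add, ← exp_neg_mul_log hn]
  apply Real.exp_le_exp.2
  rw [neg_le_neg_iff, le_div_iff₀ (by positivity), Nat.cast_add, ← ha, ← hb]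
  have hsq : (a * √b + b * √a) ^ 2 ≥ a * b * (a + b) := by
    have h1 : √a ^ 2 = a := Real.sq_sqrt (by positivity)
    have h2 : √b ^ 2 = b := Real.sq_sqrt (by positivity)
    have h3 : 0 ≤ 2 * (a * √b) * (b * √a) := by positivity
    calc a * b * (a + b) = a ^ 2 * √b ^ 2 + b ^ 2 * √a ^ 2 := by rw [h1, h2]; ring
      _ ≤ _ := by nlinarith
  have hK2 : d + (a + b) ≤ K ^ 2 / 2 * (a + b) := by nlinarith
  calc (d + (a + b)) * Real.log n * (2 * (a * b))
      ≤ K ^ 2 / 2 * (a + b) * Real.log n * (2 * (a * b)) := by gcongr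
    _ = K ^ 2 * Real.log n * (a * b * (a + b)) := by ring
    _ ≤ K ^ 2 * Real.log n * (a * √b + b * √a) ^ 2 := by gcongr
    _ = t ^ 2 := by
        rw [ht, mul_pow, mul_pow, Real.sq_sqrt hlog]

lemma stdGaussian_not_signBound {n : ℕ} (hn : 2 ≤ n) {d K : ℝ} (hd : 0 < d) (hK0 : 0 < K)
    (hK : d + 1 ≤ K ^ 2 / 2) :
    stdGaussian (MatSpace n) {x | ¬ SignBound K (toMat x)} ≤
      ENNReal.ofReal (Real.exp 4 * (n : ℝ) ^ (-d)) := by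
  set V := Fintype.piFinset (fun _ : Fin n => Finset.Icc (-(1 : ℕ) : ℤ) (1 : ℕ)) with hV
  have hn0 : (0 : ℝ) < n := by positivity
  have hsub : {x : MatSpace n | ¬ SignBound K (toMat x)} ⊆ ⋃ fg ∈ V ×ˢ V,
      {x | K * √(Real.log n) *
      (suppCard fg.1 * √(suppCard fg.2) + suppCard fg.2 * √(suppCard fg.1)) <
        bil (toMat x) (fun i => fg.1 i) (fun i => fg.2 i)} := by
    intro x hx
    have hx' : ¬ SignBound K (toMat x) := hx
    unfold SignBound at hx'
    push Not at hx'
    obtain ⟨f, g, hf, hg, hlt⟩ := hx'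
    simp only [Set.mem_iUnion]
    exact ⟨(f, g), by simpa [hV] using ⟨by simpa using hf, by simpa using hg⟩, hlt⟩
  refine (measure_mono hsub).trans ((measure_biUnion_finset_le _ _).trans ?_)
  calc _ ≤ ∑ fg ∈ V ×ˢ V, ENNReal.ofReal ((n : ℝ) ^ (-d) *
        (((n : ℝ)⁻¹) ^ suppCard fg.1 * ((n : ℝ)⁻¹) ^ suppCard fg.2)) := by
        apply Finset.sum_le_sum
        rintro ⟨f, g⟩ hfg
        rw [Finset.mem_product, hV, Fintype.mem_piFinset, Fintype.mem_piFinset] at hfg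
        exact stdGaussian_not_bil_le hn hd hK0 hK f g (by simpa using hfg.1) (by simpa using hfg.2)
    _ = ENNReal.ofReal (∑ fg ∈ V ×ˢ V, (n : ℝ) ^ (-d) *
        (((n : ℝ)⁻¹) ^ suppCard fg.1 * ((n : ℝ)⁻¹) ^ suppCard fg.2)) := by
        rw [ENNReal.ofReal_sum_of_nonneg (fun _ _ => by positivity)]
    _ ≤ _ := by
        apply ENNReal.ofReal_le_ofReal
        rw [← Finset.mul_sum, Finset.sum_product]
        simp only
        rw [← Finset.sum_mul_sum, hV, sum_pow_suppCard]
        have := one_add_div_pow_le n hn 2 (by norm_num)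
        rw [mul_comm (Real.exp 4)]
        gcongr
        calc _ = (1 + 2 * (n : ℝ)⁻¹) ^ n * (1 + 2 * (n : ℝ)⁻¹) ^ n := by simp
          _ ≤ Real.exp 2 * Real.exp 2 := by gcongr
          _ = Real.exp 4 := by rw [← Real.exp_add]; norm_num

end GoodEvent

/-! ### Union bound over integer vectors, and transfer to the random matrix -/

section ColumnEvent

open scoped NNReal ENNReal

/-- Only rows in the support of `m` and columns off it occur, so the entries `(i, j)` and `(j, i)`
that appear form two disjoint blocks and each is counted once. Restricting to the complement of the
support is thus what keeps the Lipschitz constant equal to `‖m‖₂` despite the symmetrization. -/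
lemma sum_sq_symm_mulVec_le {n : ℕ} (m : Fin n → ℤ) (x : MatSpace n) :
    ∑ j with m j = 0, (∑ i, m i * symm (toMat x) i j) ^ 2 ≤
      (∑ i, (m i : ℝ) ^ 2) * ‖x‖ ^ 2 := by
  have hsymm : ∀ i j, symm (toMat x) i j ^ 2 ≤ x (i, j) ^ 2 + x (j, i) ^ 2 := by
    intro i j
    have h : symm (toMat x) i j = 1 / √2 * (x (i, j) + x (j, i)) := rfl
    rw [h, mul_pow, div_pow, Real.sq_sqrt (by norm_num)]
    nlinarith [sq_nonneg (x (i, j) - x (j, i))]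
  have hcs : ∀ j, (∑ i, m i * symm (toMat x) i j) ^ 2 ≤
      (∑ i, (m i : ℝ) ^ 2) * ∑ i with m i ≠ 0, (x (i, j) ^ 2 + x (j, i) ^ 2) := by
    intro j
    have h1 : ∑ i, m i * symm (toMat x) i j = ∑ i with m i ≠ 0, m i * symm (toMat x) i j := by
      rw [Finset.sum_filter]
      refine Finset.sum_congr rfl fun i _ => ?_
      split_ifs with h
      · rfl
      · simp [not_not.1 h]
    rw [h1]
    refine (Finset.sum_mul_sq_le_sq_mul_sq _ _ _).trans ?_
    gcongr
    · exact Finset.filter_subset _ _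
    · exact hsymm _ _
  calc ∑ j with m j = 0, (∑ i, m i * symm (toMat x) i j) ^ 2
      ≤ ∑ j with m j = 0,
        (∑ i, (m i : ℝ) ^ 2) * ∑ i with m i ≠ 0, (x (i, j) ^ 2 + x (j, i) ^ 2) :=
        Finset.sum_le_sum fun j _ => hcs j
    _ = (∑ i, (m i : ℝ) ^ 2) * (∑ j with m j = 0, ∑ i with m i ≠ 0, x (i, j) ^ 2 +
          ∑ j with m j = 0, ∑ i with m i ≠ 0, x (j, i) ^ 2) := by
        rw [← Finset.mul_sum]
        simp_rw [Finset.sum_add_distrib]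
    _ ≤ (∑ i, (m i : ℝ) ^ 2) * ‖x‖ ^ 2 := by
        gcongr
        rw [EuclideanSpace.real_norm_sq_eq, Fintype.sum_prod_type, Finset.sum_comm,
          ← Finset.sum_filter_add_sum_filter_not Finset.univ (fun i => m i = 0)
            (fun i => ∑ j, x (i, j) ^ 2), add_comm]
        gcongr
        · exact Finset.filter_subset _ _
        · exact Finset.filter_subset _ _

/-- Norm concentration for the functionals scaled by `1 / ‖m‖₂`. The power `n^{-3}` per support
coordinate pays for the `2 n²` possible nonzero values and leaves a factor `1 / n`. -/
lemma stdGaussian_not_column_le {n : ℕ} (hn : 2 ≤ n) {q d K : ℝ} (hq : 2 ≤ q) (hd : 0 < d)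
    (hK4 : 4 ≤ K) (hK : d + 4 ≤ 2 * (K - 4) ^ 2 / Real.pi ^ 2) (m : Fin n → ℤ) :
    stdGaussian (MatSpace n) {x | √(∑ i, (m i : ℝ) ^ 2) *
        ((n * absMoment q) ^ (1 / q) + K * √(suppCard m) * √(Real.log n)) <
      (∑ j with m j = 0, |∑ i, m i * symm (toMat x) i j| ^ q) ^ (1 / q)} ≤
      ENNReal.ofReal ((absMoment q + 2) * (n : ℝ) ^ (-d) * (((n : ℝ)⁻¹) ^ 3) ^ suppCard m) := by
  have hq0 : 0 < q := by linarith
  have hμ := absMoment_pos hq0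
  by_cases hm0 : m = 0
  · have : {x : MatSpace n | √(∑ i, (m i : ℝ) ^ 2) *
        ((n * absMoment q) ^ (1 / q) + K * √(suppCard m) * √(Real.log n)) <
      (∑ j with m j = 0, |∑ i, m i * symm (toMat x) i j| ^ q) ^ (1 / q)} = ∅ := by
      ext x
      simp only [Set.mem_ofPred_eq, Set.mem_empty_iff_false, iff_false, not_lt]
      have h0 : (∑ j with m j = 0, |∑ i, m i * symm (toMat x) i j| ^ q) ^ (1 / q) = 0 := by
        simp [hm0, Real.zero_rpow hq0.ne', hq0.ne']
      rw [h0]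
      positivity
    rw [this]
    simp
  set s := √(∑ i, (m i : ℝ) ^ 2) with hs
  have hs0 : 0 < s := Real.sqrt_pos.2 (sum_sq_pos_of_ne hm0)
  have hs2 : s ^ 2 = ∑ i, (m i : ℝ) ^ 2 := Real.sq_sqrt (sum_sq_pos_of_ne hm0).le
  set a : ℝ := (suppCard m : ℝ) with ha
  have ha1 : 1 ≤ a := by rw [ha]; exact_mod_cast suppCard_pos_of_ne hm0
  have hsa : 1 ≤ √a := Real.one_le_sqrt.2 ha1
  have hn2 : (2 : ℝ) ≤ n := by exact_mod_cast hn
  have hlog : 1 / 2 ≤ √(Real.log n) := by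
    apply Real.le_sqrt_of_sq_le
    have h1 := Real.log_two_gt_d9
    have h2 : Real.log 2 ≤ Real.log n := Real.log_le_log (by norm_num) hn2
    linarith
  have hlog0 : 0 ≤ Real.log n := Real.log_natCast_nonneg n
  set L : {j : Fin n // m j = 0} → StrongDual ℝ (MatSpace n) := fun j =>
    ∑ i, (s⁻¹ * m i * (1 / √2)) •
      (EuclideanSpace.proj (i, j.1) + EuclideanSpace.proj (j.1, i) :
        StrongDual ℝ (MatSpace n)) with hL
  have hLx : ∀ j x, L j x = s⁻¹ * ∑ i, m i * symm (toMat x) i j.1 := by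
    intro j x
    simp only [hL, sum_apply, Finset.mul_sum]
    refine Finset.sum_congr rfl fun i _ => ?_
    have h : symm (toMat x) i j.1 = 1 / √2 * (x (i, j.1) + x (j.1, i)) := rfl
    rw [h]
    simp
    ring
  have hsum : ∀ g : Fin n → ℝ, ∑ j : {j : Fin n // m j = 0}, g j.1 = ∑ j with m j = 0, g j := by
    intro g
    rw [← Finset.sum_subtype_eq_sum_filter]
    simp
  have hL1 : ∀ x, ∑ j, L j x ^ 2 ≤ ‖x‖ ^ 2 := by
    intro x
    simp only [hLx, mul_pow]
    rw [← Finset.mul_sum, hsum (fun j => (∑ i, m i * symm (toMat x) i j) ^ 2)]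
    calc s⁻¹ ^ 2 * ∑ j with m j = 0, (∑ i, m i * symm (toMat x) i j) ^ 2
        ≤ s⁻¹ ^ 2 * (s ^ 2 * ‖x‖ ^ 2) := by
          rw [hs2]
          gcongr
          exact sum_sq_symm_mulVec_le m x
      _ = ‖x‖ ^ 2 := by field_simp
  have hLq : ∀ x, (∑ j, |L j x| ^ q) ^ (1 / q) =
      s⁻¹ * (∑ j with m j = 0, |∑ i, m i * symm (toMat x) i j| ^ q) ^ (1 / q) := by
    intro x
    have h1 : ∀ j, |L j x| ^ q = s⁻¹ ^ q * |∑ i, m i * symm (toMat x) i j.1| ^ q := by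
      intro j
      rw [hLx, abs_mul, abs_of_pos (inv_pos.2 hs0), Real.mul_rpow (by positivity) (by positivity)]
    simp_rw [h1]
    rw [← Finset.mul_sum, hsum (fun j => |∑ i, m i * symm (toMat x) i j| ^ q),
      Real.mul_rpow (by positivity) (Finset.sum_nonneg fun _ _ => by positivity),
      ← Real.rpow_mul (by positivity), mul_one_div_cancel hq0.ne', Real.rpow_one]
  -- Since `√a √(log n) ≥ 1/2`, the withheld `4` covers the additive `2` of the concentration bound.
  set r := (K - 4) * √a * √(Real.log n) with hr
  have hr0 : 0 ≤ r := by
    have : 0 ≤ K - 4 := by linarith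
    positivity
  have hcard : Fintype.card {j : Fin n // m j = 0} ≤ n := by
    simpa using Fintype.card_subtype_le (fun j : Fin n => m j = 0)
  have hconc := stdGaussian_le_rpow_sum_le hq L hL1 hcard hr0
  have hsub : {x | s * ((n * absMoment q) ^ (1 / q) + K * √a * √(Real.log n)) <
      (∑ j with m j = 0, |∑ i, m i * symm (toMat x) i j| ^ q) ^ (1 / q)} ⊆
      {x | (n * absMoment q) ^ (1 / q) + 2 + r ≤ (∑ j, |L j x| ^ q) ^ (1 / q)} := by
    intro x hx
    have hx' : s * ((n * absMoment q) ^ (1 / q) + K * √a * √(Real.log n)) <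
      (∑ j with m j = 0, |∑ i, m i * symm (toMat x) i j| ^ q) ^ (1 / q) := hx
    simp only [Set.mem_ofPred_eq]
    rw [hLq, inv_mul_eq_div, le_div_iff₀ hs0, mul_comm]
    refine le_trans ?_ hx'.le
    refine mul_le_mul_of_nonneg_left ?_ hs0.le
    rw [hr]
    have : 1 * (1 / 2) ≤ √a * √(Real.log n) := by gcongr
    linarith
  refine (measure_mono hsub).trans (hconc.trans (ENNReal.ofReal_le_ofReal ?_))
  have hexp : Real.exp (-(2 * r ^ 2 / Real.pi ^ 2)) ≤
      (n : ℝ) ^ (-d) * ((n : ℝ)⁻¹) ^ (4 * suppCard m) := by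
    rw [← exp_neg_mul_log hn]
    apply Real.exp_le_exp.2
    rw [neg_le_neg_iff, hr, mul_pow, mul_pow, Real.sq_sqrt hlog0, Real.sq_sqrt (by positivity)]
    push_cast
    rw [← ha]
    calc (d + 4 * a) * Real.log n ≤ (d + 4) * a * Real.log n := by gcongr; nlinarith
      _ ≤ 2 * (K - 4) ^ 2 / Real.pi ^ 2 * a * Real.log n := by gcongr
      _ = _ := by ring
  have hn0 : (0 : ℝ) < n := by positivity
  calc (n * absMoment q + 2) * Real.exp (-(2 * r ^ 2 / Real.pi ^ 2))
      ≤ (n * (absMoment q + 2)) * ((n : ℝ) ^ (-d) * ((n : ℝ)⁻¹) ^ (4 * suppCard m)) := by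
        gcongr
        nlinarith
    -- The tail supplies `4` powers of `1 / n` per support coordinate; as the support is nonempty,
    -- one of them can be spent on the prefactor `n`.
    _ ≤ (n * (absMoment q + 2)) * ((n : ℝ) ^ (-d) * ((n : ℝ)⁻¹) ^ (1 + 3 * suppCard m)) := by
        have h1 := suppCard_pos_of_ne hm0
        have h2 : ((n : ℝ)⁻¹) ^ (4 * suppCard m) ≤ ((n : ℝ)⁻¹) ^ (1 + 3 * suppCard m) :=
          pow_le_pow_of_le_one (by positivity) (inv_le_one_of_one_le₀ (by linarith)) (by omega)
        gcongr
    _ = _ := by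
        rw [pow_add, pow_one, ← pow_mul]
        field_simp

lemma stdGaussian_not_columnBound {n : ℕ} (hn : 2 ≤ n) {q d K : ℝ} (hq : 2 ≤ q) (hd : 0 < d)
    (hK4 : 4 ≤ K) (hK : d + 4 ≤ 2 * (K - 4) ^ 2 / Real.pi ^ 2) :
    stdGaussian (MatSpace n) {x | ¬ ColumnBound q K (toMat x)} ≤
      ENNReal.ofReal ((absMoment q + 2) * Real.exp 2 * (n : ℝ) ^ (-d)) := by
  have hμ := absMoment_pos (q := q) (by linarith)
  have hn0 : (0 : ℝ) < n := by positivity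
  set V := Fintype.piFinset (fun _ : Fin n => Finset.Icc (-(n ^ 2 : ℕ) : ℤ) (n ^ 2 : ℕ)) with hV
  have hsub : {x : MatSpace n | ¬ ColumnBound q K (toMat x)} ⊆ ⋃ m ∈ V,
      {x | √(∑ i, (m i : ℝ) ^ 2) *
        ((n * absMoment q) ^ (1 / q) + K * √(suppCard m) * √(Real.log n)) <
      (∑ j with m j = 0, |∑ i, m i * symm (toMat x) i j| ^ q) ^ (1 / q)} := by
    intro x hx
    have hx' : ¬ ColumnBound q K (toMat x) := hx
    unfold ColumnBound at hx'
    push Not at hx'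
    obtain ⟨m, hm, hlt⟩ := hx'
    simp only [Set.mem_iUnion]
    exact ⟨m, by rw [hV, Fintype.mem_piFinset]; exact hm, hlt⟩
  refine (measure_mono hsub).trans ((measure_biUnion_finset_le _ _).trans ?_)
  calc _ ≤ ∑ m ∈ V, ENNReal.ofReal
        ((absMoment q + 2) * (n : ℝ) ^ (-d) * (((n : ℝ)⁻¹) ^ 3) ^ suppCard m) :=
        Finset.sum_le_sum fun m _ => stdGaussian_not_column_le hn hq hd hK4 hK m
    _ = ENNReal.ofReal (∑ m ∈ V,
        ((absMoment q + 2) * (n : ℝ) ^ (-d) * (((n : ℝ)⁻¹) ^ 3) ^ suppCard m)) := by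
        rw [ENNReal.ofReal_sum_of_nonneg (fun _ _ => by positivity)]
    _ ≤ _ := by
        apply ENNReal.ofReal_le_ofReal
        rw [← Finset.mul_sum, hV, sum_pow_suppCard, mul_right_comm _ (Real.exp 2)]
        gcongr
        refine le_trans (le_of_eq ?_) (one_add_div_pow_le n hn 2 (by norm_num))
        push_cast
        congr 2
        field_simp

lemma map_toLp_eq_stdGaussian {Ω : Type*} [MeasurableSpace Ω] {n : ℕ} {P : Measure Ω}
    [IsProbabilityMeasure P] {G : Ω → Matrix (Fin n) (Fin n) ℝ} (hG : IsStdGaussianMatrix P G) :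
    AEMeasurable (fun ω => (WithLp.toLp 2 (fun ij => G ω ij.1 ij.2) : MatSpace n)) P ∧
      P.map (fun ω => (WithLp.toLp 2 (fun ij => G ω ij.1 ij.2) : MatSpace n)) =
        stdGaussian (MatSpace n) := by
  have hm : ∀ ij : Fin n × Fin n, AEMeasurable (fun ω => G ω ij.1 ij.2) P :=
    fun ij => (hG.1 ij.1 ij.2).aemeasurable
  have h1 := hG.2.map_fun_eq_pi_map hm
  have hlaw : ∀ ij : Fin n × Fin n, P.map (fun ω => G ω ij.1 ij.2) = gaussianReal 0 1 :=
    fun ij => (hG.1 ij.1 ij.2).map_eq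
  simp_rw [hlaw] at h1
  have hm2 : AEMeasurable (fun ω (ij : Fin n × Fin n) => G ω ij.1 ij.2) P := aemeasurable_pi_iff.2 hm
  have hlp : Measurable (WithLp.toLp 2 : (Fin n × Fin n → ℝ) → MatSpace n) := by fun_prop
  refine ⟨hlp.comp_aemeasurable hm2, ?_⟩
  rw [← map_pi_eq_stdGaussian, ← h1, AEMeasurable.map_map_of_aemeasurable hlp.aemeasurable hm2]
  rfl

/-- With overwhelming probability both bounds hold. -/
lemma exists_signBound_columnBound {q d : ℝ} (hq : 2 ≤ q) (hd : 0 < d) :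
    ∃ K C : ℝ, 0 < K ∧ 0 < C ∧ ∀ n : ℕ, 2 ≤ n →
      ∀ (Ω : Type*) [MeasurableSpace Ω] (P : Measure Ω) [IsProbabilityMeasure P]
        (G : Ω → Matrix (Fin n) (Fin n) ℝ), IsStdGaussianMatrix P G →
        P {ω | ¬ (SignBound K (G ω) ∧ ColumnBound q K (G ω))} ≤
          ENNReal.ofReal (C * (n : ℝ) ^ (-d)) := by
  have hμ := absMoment_pos (q := q) (by linarith)
  have hpi := Real.pi_pos
  -- Chosen so that `(K - 4)² / π² = (d + 4)²`.
  set K : ℝ := 4 + (d + 4) * Real.pi with hKdef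
  refine ⟨K, Real.exp 4 + (absMoment q + 2) * Real.exp 2, by positivity, by positivity, ?_⟩
  intro n hn Ω _ P _ G hG
  obtain ⟨hm, hmap⟩ := map_toLp_eq_stdGaussian hG
  have hK1 : d + 1 ≤ K ^ 2 / 2 := by
    have h3 := Real.pi_gt_three
    have : d + 4 ≤ K := by rw [hKdef]; nlinarith
    nlinarith
  have hK2 : d + 4 ≤ 2 * (K - 4) ^ 2 / Real.pi ^ 2 := by
    rw [le_div_iff₀ (by positivity), hKdef]
    have : 0 ≤ Real.pi ^ 2 := by positivity
    have h2 : d + 4 ≤ 2 * (d + 4) ^ 2 := by nlinarith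
    calc (d + 4) * Real.pi ^ 2 ≤ 2 * (d + 4) ^ 2 * Real.pi ^ 2 := by gcongr
      _ = _ := by ring
  have hn0 : (0 : ℝ) < n := by positivity
  calc P {ω | ¬ (SignBound K (G ω) ∧ ColumnBound q K (G ω))}
      ≤ P.map (fun ω => (WithLp.toLp 2 (fun ij => G ω ij.1 ij.2) : MatSpace n))
        ({x | ¬ SignBound K (toMat x)} ∪ {x | ¬ ColumnBound q K (toMat x)}) := by
        -- This direction of the comparison with the image measure holds for arbitrary sets, so the
        -- bad events need not be shown measurable.
        refine le_trans (measure_mono ?_) (Measure.le_map_apply hm _)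
        intro ω hω
        have hω' : ¬ (SignBound K (G ω) ∧ ColumnBound q K (G ω)) := hω
        exact not_and_or.1 hω'
    _ ≤ stdGaussian (MatSpace n) {x | ¬ SignBound K (toMat x)} +
        stdGaussian (MatSpace n) {x | ¬ ColumnBound q K (toMat x)} := by
        rw [hmap]
        exact measure_union_le _ _
    _ ≤ ENNReal.ofReal (Real.exp 4 * (n : ℝ) ^ (-d)) +
        ENNReal.ofReal ((absMoment q + 2) * Real.exp 2 * (n : ℝ) ^ (-d)) := by
        gcongr
        · exact stdGaussian_not_signBound hn hd (by positivity) hK1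
        · exact stdGaussian_not_columnBound hn hq hd (by rw [hKdef]; nlinarith) hK2
    _ = _ := by
        rw [← ENNReal.ofReal_add (by positivity) (by positivity)]
        congr 1
        ring

end ColumnEvent

/-! ### Elementary facts on ℓ_p-norms -/

section EllpNorm

variable {n : ℕ} {p : ℝ}

lemma ellpNorm_nonneg (p : ℝ) (x : Fin n → ℝ) : 0 ≤ ellpNorm p x :=
  Real.rpow_nonneg (Finset.sum_nonneg fun _ _ => Real.rpow_nonneg (abs_nonneg _) _) _

lemma ellpNorm_rpow (hp : 0 < p) (x : Fin n → ℝ) : ellpNorm p x ^ p = ∑ i, |x i| ^ p := by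
  rw [ellpNorm, ← Real.rpow_mul (Finset.sum_nonneg fun _ _ => Real.rpow_nonneg (abs_nonneg _) _),
    one_div_mul_cancel hp.ne', Real.rpow_one]

lemma ellpNorm_le_of_sum_le (hp : 0 < p) {x : Fin n → ℝ} {B : ℝ} (hB : 0 ≤ B)
    (h : ∑ i, |x i| ^ p ≤ B ^ p) : ellpNorm p x ≤ B := by
  rw [← ellpNorm_rpow hp] at h
  exact (Real.rpow_le_rpow_iff (ellpNorm_nonneg p x) hB hp).1 h

lemma ellpNorm_add_le (hp : 1 ≤ p) (x y : Fin n → ℝ) :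
    ellpNorm p (x + y) ≤ ellpNorm p x + ellpNorm p y :=
  Real.Lp_add_le Finset.univ x y hp

lemma ellpNorm_smul (hp : 0 < p) (c : ℝ) (x : Fin n → ℝ) :
    ellpNorm p (c • x) = |c| * ellpNorm p x := by
  simp only [ellpNorm, Pi.smul_apply, smul_eq_mul, abs_mul]
  simp_rw [Real.mul_rpow (abs_nonneg c) (abs_nonneg _)]
  rw [← Finset.mul_sum, Real.mul_rpow (by positivity)
    (Finset.sum_nonneg fun _ _ => Real.rpow_nonneg (abs_nonneg _) _),
    ← Real.rpow_mul (abs_nonneg c), mul_one_div_cancel hp.ne', Real.rpow_one]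

lemma ellpNorm_neg (p : ℝ) (x : Fin n → ℝ) : ellpNorm p (-x) = ellpNorm p x := by
  simp [ellpNorm]

lemma ellpNorm_eq_zero (hp : 0 < p) {x : Fin n → ℝ} (h : ellpNorm p x = 0) : x = 0 := by
  have h1 := ellpNorm_rpow hp x
  rw [h, Real.zero_rpow hp.ne', eq_comm,
    Finset.sum_eq_zero_iff_of_nonneg (fun _ _ => Real.rpow_nonneg (abs_nonneg _) _)] at h1
  ext i
  have := (Real.rpow_eq_zero (abs_nonneg (x i)) hp.ne').1 (h1 i (Finset.mem_univ i))
  simpa using this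

lemma abs_le_ellpNorm (hp : 0 < p) (x : Fin n → ℝ) (i : Fin n) : |x i| ≤ ellpNorm p x := by
  rw [← Real.rpow_le_rpow_iff (abs_nonneg _) (ellpNorm_nonneg p x) hp, ellpNorm_rpow hp]
  exact Finset.single_le_sum (f := fun i => |x i| ^ p)
    (fun _ _ => Real.rpow_nonneg (abs_nonneg _) _) (Finset.mem_univ i)

lemma ellpNorm_basisVec (hp : 0 < p) (i : Fin n) : ellpNorm p (basisVec i) = 1 := by
  have : ∑ j, |basisVec i j| ^ p = 1 := by
    rw [Finset.sum_eq_single i]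
    · simp [basisVec]
    · intro j _ hj
      simp [basisVec, Pi.single_eq_of_ne hj, Real.zero_rpow hp.ne']
    · simp
  rw [ellpNorm, this, Real.one_rpow]

lemma sum_mul_le_ellpNorm {q : ℝ} (h : p.HolderConjugate q) (x y : Fin n → ℝ) :
    ∑ i, x i * y i ≤ ellpNorm p x * ellpNorm q y :=
  Real.inner_le_Lp_mul_Lq _ _ _ h

end EllpNorm

/-! ### Quantitative Young inequality -/

section HolderStability

variable {p : ℝ}

lemma add_rpow_le_two_mul (hp1 : 1 < p) (hp2 : p < 2) {a b : ℝ} (ha : 0 ≤ a) (hb : 0 ≤ b) :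
    (a + b) ^ p ≤ 2 * (a ^ p + b ^ p) := by
  lift a to NNReal using ha
  lift b to NNReal using hb
  have h : ((a : ℝ) + b) ^ p ≤ 2 ^ (p - 1) * ((a : ℝ) ^ p + (b : ℝ) ^ p) := by
    exact_mod_cast NNReal.rpow_add_le_mul_rpow_add_rpow a b hp1.le
  refine h.trans ?_
  gcongr
  calc (2 : ℝ) ^ (p - 1) ≤ 2 ^ (1 : ℝ) := by
        gcongr
        · norm_num
        · linarith
    _ = 2 := Real.rpow_one 2

/-- The difference of the two sides vanishes at `1` and is decreasing on `[0, 1]`: its derivative is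
nonpositive by Bernoulli's inequality for the exponent `p - 1 ≤ 1`. -/
lemma young_deficit_of_le_one (hp1 : 1 < p) (hp2 : p < 2) {t : ℝ} (ht0 : 0 ≤ t) (ht1 : t ≤ 1) :
    (p - 1) / 2 * (t - 1) ^ 2 ≤ t ^ p / p + (1 - 1 / p) - t := by
  have hp0 : 0 < p := by linarith
  set g : ℝ → ℝ := fun t => t ^ p / p + (1 - 1 / p) - t - (p - 1) / 2 * (t - 1) ^ 2 with hg
  have hder : ∀ t : ℝ, 0 < t → HasDerivAt g (t ^ (p - 1) - 1 - (p - 1) * (t - 1)) t := by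
    intro t ht
    have h1 := (Real.hasDerivAt_rpow_const (x := t) (p := p) (Or.inl ht.ne')).div_const p
    have h2 := (((hasDerivAt_id t).sub_const 1).pow 2).const_mul ((p - 1) / 2)
    have h3 := ((h1.add_const (1 - 1 / p)).sub (hasDerivAt_id t)).sub h2
    refine h3.congr_deriv ?_
    simp
    field_simp
  have hanti : AntitoneOn g (Set.Icc 0 1) := by
    apply antitoneOn_of_deriv_nonpos (convex_Icc 0 1)
    · have : Continuous g := by
        have : Continuous (fun t : ℝ => t ^ p) := Real.continuous_rpow_const hp0.le
        simp only [hg]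
        fun_prop
      exact this.continuousOn
    · intro t ht
      rw [interior_Icc] at ht
      exact (hder t ht.1).differentiableAt.differentiableWithinAt
    · intro t ht
      rw [interior_Icc] at ht
      rw [(hder t ht.1).deriv]
      have := rpow_one_add_le_one_add_mul_self (s := t - 1) (by linarith [ht.1]) (p := p - 1)
        (by linarith) (by linarith)
      rw [add_sub_cancel] at this
      linarith
  have h := hanti ⟨ht0, ht1⟩ ⟨zero_le_one, le_rfl⟩ ht1
  simp only [hg, Real.one_rpow] at h
  linarith

/-- The range `t > 1` of Young's inequality, rewritten with `s = 1 / t` after division by `t ^ p`.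
-/
lemma dual_young_deficit_of_le_one (hp1 : 1 < p) (hp2 : p < 2) {s : ℝ} (hs0 : 0 ≤ s)
    (hs1 : s ≤ 1) :
    (p - 1) / 2 * (1 - s) ^ 2 ≤ 1 / p + (1 - 1 / p) * s ^ p - s ^ (p - 1) := by
  have hp0 : 0 < p := by linarith
  set g : ℝ → ℝ := fun s => 1 / p + (1 - 1 / p) * s ^ p - s ^ (p - 1) - (p - 1) / 2 * (1 - s) ^ 2
    with hg
  have hder : ∀ s : ℝ, 0 < s → HasDerivAt g ((p - 1) * (1 - s) * (1 - s ^ (p - 2))) s := by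
    intro s hs
    have h1 := (Real.hasDerivAt_rpow_const (x := s) (p := p) (Or.inl hs.ne')).const_mul (1 - 1 / p)
    have h0 := Real.hasDerivAt_rpow_const (x := s) (p := p - 1) (Or.inl hs.ne')
    have h2 := (((hasDerivAt_id s).const_sub 1).pow 2).const_mul ((p - 1) / 2)
    have h3 := ((h1.const_add (1 / p)).sub h0).sub h2
    refine h3.congr_deriv ?_
    have e1 : s ^ (p - 1) = s ^ (p - 2) * s := by
      rw [show p - 1 = p - 2 + 1 by ring, Real.rpow_add hs, Real.rpow_one]
    rw [show p - 1 - 1 = p - 2 by ring, e1]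
    simp
    field_simp
    ring
  have hanti : AntitoneOn g (Set.Icc 0 1) := by
    apply antitoneOn_of_deriv_nonpos (convex_Icc 0 1)
    · have : Continuous g := by
        have h1 : Continuous (fun t : ℝ => t ^ p) := Real.continuous_rpow_const hp0.le
        have h2 : Continuous (fun t : ℝ => t ^ (p - 1)) :=
          Real.continuous_rpow_const (by linarith)
        simp only [hg]
        fun_prop
      exact this.continuousOn
    · intro t ht
      rw [interior_Icc] at ht
      exact (hder t ht.1).differentiableAt.differentiableWithinAt
    · intro t ht
      rw [interior_Icc] at ht
      rw [(hder t ht.1).deriv]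
      have h1 : 1 ≤ t ^ (p - 2) :=
        Real.one_le_rpow_of_pos_of_le_one_of_nonpos ht.1 ht.2.le (by linarith)
      exact mul_nonpos_of_nonneg_of_nonpos
        (mul_nonneg (by linarith) (by linarith [ht.2])) (by linarith)
  have h := hanti ⟨hs0, hs1⟩ ⟨zero_le_one, le_rfl⟩ hs1
  simp only [hg, Real.one_rpow] at h
  linarith

/-- For large `|t|` the deficit grows only like `|t| ^ p`, so a quadratic bound needs the weight
`(|t| + 1) ^ (2 - p)`. The ranges `[0, 1]` and `t > 1` use the two lemmas above; for `t < 0` the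
deficit has no cancellation and convexity of the power suffices. -/
lemma sq_sub_one_le_young_deficit (hp1 : 1 < p) (hp2 : p < 2) (t : ℝ) :
    (t - 1) ^ 2 ≤ 4 / (p - 1) * (|t| ^ p / p + (1 - 1 / p) - t) * (|t| + 1) ^ (2 - p) := by
  have hp0 : 0 < p := by linarith
  have hpm : 0 < p - 1 := by linarith
  have hinv : 0 < 1 - 1 / p := by
    rw [sub_pos, div_lt_one hp0]
    exact hp1
  have key : ∀ f M : ℝ, (p - 1) / 2 * (t - 1) ^ 2 ≤ f * M → 0 ≤ f → 0 ≤ M →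
      M ≤ (|t| + 1) ^ (2 - p) → (t - 1) ^ 2 ≤ 4 / (p - 1) * f * (|t| + 1) ^ (2 - p) := by
    intro f M h hf hM0 hM
    have h1 : f * M ≤ f * (|t| + 1) ^ (2 - p) := mul_le_mul_of_nonneg_left hM hf
    have h2 : (t - 1) ^ 2 ≤ 2 / (p - 1) * (f * (|t| + 1) ^ (2 - p)) := by
      rw [div_mul_eq_mul_div, le_div_iff₀ hpm]
      nlinarith
    have h3 : 0 ≤ f * (|t| + 1) ^ (2 - p) := le_trans (mul_nonneg hf hM0) h1
    calc (t - 1) ^ 2 ≤ 2 / (p - 1) * (f * (|t| + 1) ^ (2 - p)) := h2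
      _ ≤ 4 / (p - 1) * (f * (|t| + 1) ^ (2 - p)) := by gcongr; norm_num
      _ = _ := by ring
  rcases le_or_gt 0 t with ht | ht
  · rw [abs_of_nonneg ht] at key ⊢
    rcases le_or_gt t 1 with ht1 | ht1
    · have h := young_deficit_of_le_one hp1 hp2 ht ht1
      refine key _ 1 (by linarith) ?_ zero_le_one
        (Real.one_le_rpow (by linarith) (by linarith))
      exact le_trans (by positivity) h
    · have ht0 : 0 < t := by linarith
      have h := dual_young_deficit_of_le_one hp1 hp2 (s := t⁻¹) (by positivity)
        (inv_le_one_of_one_le₀ ht1.le)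
      have hid : t ^ p / p + (1 - 1 / p) - t =
          t ^ p * (1 / p + (1 - 1 / p) * t⁻¹ ^ p - t⁻¹ ^ (p - 1)) := by
        have e1 : t ^ p * t⁻¹ ^ p = 1 := by
          rw [← Real.mul_rpow ht0.le (by positivity), mul_inv_cancel₀ ht0.ne', Real.one_rpow]
        have e2 : t ^ p * t⁻¹ ^ (p - 1) = t := by
          have : t ^ p = t ^ (p - 1) * t := by
            rw [← Real.rpow_add_one ht0.ne', sub_add_cancel]
          rw [this, mul_right_comm, ← Real.mul_rpow ht0.le (by positivity),
            mul_inv_cancel₀ ht0.ne', Real.one_rpow, one_mul]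
        rw [mul_sub, mul_add, e2]
        linear_combination (-(1 - 1 / p)) * e1
      have hf0 : 0 ≤ t ^ p / p + (1 - 1 / p) - t := by
        rw [hid]
        exact mul_nonneg (by positivity) (le_trans (by positivity) h)
      refine key _ (t ^ (2 - p)) ?_ hf0 (by positivity)
        (Real.rpow_le_rpow ht (by linarith) (by linarith))
      have e3 : t ^ p * t ^ (2 - p) = t ^ 2 := by
        rw [← Real.rpow_add ht0, add_sub_cancel]
        norm_num
      rw [hid]
      calc (p - 1) / 2 * (t - 1) ^ 2 = (p - 1) / 2 * (1 - t⁻¹) ^ 2 * t ^ 2 := by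
            field_simp
        _ ≤ (1 / p + (1 - 1 / p) * t⁻¹ ^ p - t⁻¹ ^ (p - 1)) * t ^ 2 := by gcongr
        _ = _ := by rw [← e3]; ring
  · rw [abs_of_neg ht]
    set u := -t with hu
    have hu0 : 0 < u := by linarith
    have htu : t = -u := by linarith
    have hconv : (u + 1) ^ p ≤ 2 * (u ^ p + 1) := by
      simpa using add_rpow_le_two_mul hp1 hp2 hu0.le zero_le_one
    have hsplit : (u + 1) ^ 2 = (u + 1) ^ p * (u + 1) ^ (2 - p) := by
      rw [← Real.rpow_add (by linarith), add_sub_cancel]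
      norm_num
    have hf : 2 * (u ^ p + 1) ≤ 4 / (p - 1) * (u ^ p / p + (1 - 1 / p) - t) := by
      rw [div_mul_eq_mul_div, le_div_iff₀ hpm]
      have hup : 0 ≤ u ^ p := by positivity
      have e : 4 * (u ^ p / p + (1 - 1 / p) - t) * p = 4 * (u ^ p + (p - 1) + u * p) := by
        rw [htu]
        field_simp
        ring
      have h4 : 2 * (u ^ p + 1) * (p - 1) * p ≤ 4 * (u ^ p / p + (1 - 1 / p) - t) * p := by
        rw [e]
        have h5 : (p - 1) * p ≤ 2 * (p - 1) := by nlinarith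
        have h6 : u ^ p * ((p - 1) * p) ≤ u ^ p * 2 := by gcongr; nlinarith
        nlinarith [mul_pos hu0 hp0]
      exact le_of_mul_le_mul_right h4 hp0
    calc (t - 1) ^ 2 = (u + 1) ^ 2 := by rw [htu]; ring
      _ = (u + 1) ^ p * (u + 1) ^ (2 - p) := hsplit
      _ ≤ 2 * (u ^ p + 1) * (u + 1) ^ (2 - p) := by gcongr
      _ ≤ _ := by gcongr

lemma sq_sub_le_young_deficit (hp1 : 1 < p) (hp2 : p < 2) (s : ℝ) {a : ℝ} (ha : 0 ≤ a) :
    (s - a) ^ 2 ≤ 4 / (p - 1) * (|s| ^ p / p + (1 - 1 / p) * a ^ p - a ^ (p - 1) * s) *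
      (|s| + a) ^ (2 - p) := by
  have hp0 : 0 < p := by linarith
  have hpm : 0 < p - 1 := by linarith
  rcases ha.eq_or_lt with rfl | ha
  · rw [Real.zero_rpow hp0.ne', Real.zero_rpow hpm.ne']
    rcases eq_or_ne s 0 with rfl | hs
    · simp [Real.zero_rpow hp0.ne']
    · have hs0 : 0 < |s| := abs_pos.2 hs
      have e : |s| ^ p * |s| ^ (2 - p) = |s| ^ 2 := by
        rw [← Real.rpow_add hs0, add_sub_cancel]
        norm_num
      have h1 : 1 ≤ 4 / (p - 1) / p := by
        rw [div_div, one_le_div (by positivity)]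
        nlinarith
      calc (s - 0) ^ 2 = 1 * |s| ^ 2 := by simp
        _ ≤ 4 / (p - 1) / p * |s| ^ 2 := by gcongr
        _ = _ := by rw [← e]; simp; ring
  · have h := sq_sub_one_le_young_deficit hp1 hp2 (s / a)
    have e1 : |s / a| ^ p = |s| ^ p / a ^ p := by
      rw [abs_div, abs_of_pos ha, Real.div_rpow (abs_nonneg _) ha.le]
    have e2 : (|s / a| + 1) ^ (2 - p) = (|s| + a) ^ (2 - p) / a ^ (2 - p) := by
      rw [← Real.div_rpow (by positivity) ha.le, abs_div, abs_of_pos ha, add_div, div_self ha.ne']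
    have e3 : a ^ p * a ^ (2 - p) = a ^ 2 := by
      rw [← Real.rpow_add ha, add_sub_cancel]
      norm_num
    have e4 : a ^ p = a ^ (p - 1) * a := by
      rw [← Real.rpow_add_one ha.ne', sub_add_cancel]
    rw [e1, e2] at h
    have hap : 0 < a ^ p := by positivity
    have ha2 : 0 < a ^ (2 - p) := by positivity
    calc (s - a) ^ 2 = (s / a - 1) ^ 2 * a ^ 2 := by field_simp
      _ ≤ 4 / (p - 1) * (|s| ^ p / a ^ p / p + (1 - 1 / p) - s / a) *
          ((|s| + a) ^ (2 - p) / a ^ (2 - p)) * a ^ 2 := by gcongr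
      _ = 4 / (p - 1) * ((|s| ^ p / a ^ p / p + (1 - 1 / p) - s / a) * a ^ p) *
          (|s| + a) ^ (2 - p) := by
          rw [← e3]
          field_simp
      _ = _ := by
          congr 2
          have : s / a * a ^ p = a ^ (p - 1) * s := by rw [e4]; field_simp
          rw [sub_mul, add_mul, this]
          congr 2
          field_simp

end HolderStability

/-! ### Stability of Hölder's inequality -/

section DualVector

variable {n : ℕ} {p q : ℝ}

/-- The unit vector of `ℓ_p` at which the functional `w` attains its `ℓ_q`-norm. -/
noncomputable def dualVec (p q : ℝ) (w : Fin n → ℝ) : Fin n → ℝ :=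
  fun j => sgn (w j) * (|w j| ^ q / ellpNorm q w ^ q) ^ (1 / p)

lemma sgn_mul_abs (a : ℝ) : sgn a * |a| = a := by
  unfold sgn
  split_ifs with h
  · rw [abs_of_nonneg h, one_mul]
  · rw [abs_of_neg (not_le.1 h)]
    ring

lemma sgn_mul_self (a : ℝ) : sgn a * sgn a = 1 := by
  unfold sgn
  split_ifs <;> norm_num

lemma abs_sgn (a : ℝ) : |sgn a| = 1 := by
  unfold sgn
  split_ifs <;> norm_num

/-- Stability of Hölder's inequality. -/
lemma ellpNorm_sub_dualVec_le (hp1 : 1 < p) (hp2 : p < 2) (hpq : p.HolderConjugate q)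
    {w z : Fin n → ℝ} (hw : 0 < ellpNorm q w) (hz : ellpNorm p z = 1) {η : ℝ} (hη : 0 ≤ η)
    (h : (1 - η) * ellpNorm q w ≤ ∑ j, w j * z j) :
    ellpNorm p (z - dualVec p q w) ≤ 4 * √(η / (p - 1)) := by
  have hp0 : 0 < p := by linarith
  have hpm : 0 < p - 1 := by linarith
  have hq0 : 0 < q := hpq.symm.pos
  set W := ellpNorm q w with hW
  set a : Fin n → ℝ := fun j => (|w j| ^ q / W ^ q) ^ (1 / p) with ha
  set s : Fin n → ℝ := fun j => sgn (w j) * z j with hs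
  have ha0 : ∀ j, 0 ≤ a j := fun j => by positivity
  have hap : ∀ j, a j ^ p = |w j| ^ q / W ^ q := by
    intro j
    rw [ha, ← Real.rpow_mul (by positivity), one_div_mul_cancel hp0.ne', Real.rpow_one]
  have hap1 : ∀ j, a j ^ (p - 1) = |w j| / W := by
    intro j
    have e : 1 / p * (p - 1) = 1 / q := by
      have := hpq.inv_add_inv_eq_one
      rw [one_div, one_div, mul_sub, inv_mul_cancel₀ hp0.ne']
      linarith
    rw [ha, ← Real.rpow_mul (by positivity), e, ← Real.div_rpow (abs_nonneg _) hw.le,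
      ← Real.rpow_mul (by positivity), mul_one_div_cancel hq0.ne', Real.rpow_one]
  have hasum : ∑ j, a j ^ p = 1 := by
    simp_rw [hap]
    rw [← Finset.sum_div, ← ellpNorm_rpow hq0, div_self (by positivity)]
  have hsabs : ∀ j, |s j| = |z j| := fun j => by rw [hs, abs_mul, abs_sgn, one_mul]
  have hssum : ∑ j, |s j| ^ p = 1 := by
    simp_rw [hsabs]
    rw [← ellpNorm_rpow hp0, hz, Real.one_rpow]
  have hdiff : ∀ j, |(z - dualVec p q w) j| = |s j - a j| := by
    intro j
    have : (z - dualVec p q w) j = sgn (w j) * (s j - a j) := by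
      simp only [Pi.sub_apply, dualVec, hs, ha, mul_sub]
      rw [← mul_assoc, sgn_mul_self, one_mul]
    rw [this, abs_mul, abs_sgn, one_mul]
  -- Coordinatewise Young deficits. Since `a` and `s` have unit `ℓ_p`-norm and `a j ^ (p - 1) = |w
  -- j| / W`, they add up to the Hölder deficit `1 - ⟨w, z⟩ / W`.
  set T : Fin n → ℝ := fun j => |s j| ^ p / p + (1 - 1 / p) * a j ^ p - a j ^ (p - 1) * s j with hT
  have hTle : ∀ j, (s j - a j) ^ 2 ≤ 4 / (p - 1) * T j * (|s j| + a j) ^ (2 - p) :=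
    fun j => sq_sub_le_young_deficit hp1 hp2 (s j) (ha0 j)
  -- Read off from `hTle`: a negative deficit would bound a square by a negative number.
  have hT0 : ∀ j, 0 ≤ T j := by
    intro j
    rcases (add_nonneg (abs_nonneg (s j)) (ha0 j)).eq_or_lt with h0 | h0
    · have h1 : |s j| = 0 := by linarith [abs_nonneg (s j), ha0 j]
      have h2 : a j = 0 := by linarith [abs_nonneg (s j), ha0 j]
      simp [hT, h1, h2, Real.zero_rpow hp0.ne', Real.zero_rpow hpm.ne']
    · by_contra hneg
      have h1 : 4 / (p - 1) * T j * (|s j| + a j) ^ (2 - p) < 0 :=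
        mul_neg_of_neg_of_pos (mul_neg_of_pos_of_neg (by positivity) (not_le.1 hneg))
          (by positivity)
      linarith [hTle j, sq_nonneg (s j - a j)]
  have hTsum : ∑ j, T j ≤ η := by
    have e1 : ∑ j, a j ^ (p - 1) * s j = (∑ j, w j * z j) / W := by
      rw [Finset.sum_div]
      refine Finset.sum_congr rfl fun j _ => ?_
      rw [hap1]
      conv_rhs => rw [← sgn_mul_abs (w j)]
      rw [hs]
      ring
    have e2 : ∑ j, T j = 1 - (∑ j, w j * z j) / W := by
      simp only [hT]
      rw [Finset.sum_sub_distrib, Finset.sum_add_distrib, ← Finset.sum_div, ← Finset.mul_sum,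
        hasum, hssum, e1]
      ring
    have e3 : 1 - η ≤ (∑ j, w j * z j) / W := (le_div_iff₀ hw).2 h
    linarith
  set A := 4 / (p - 1) with hA
  have hA0 : 0 < A := by positivity
  have hpt : ∀ j, |s j - a j| ^ p ≤ (A * T j) ^ (p / 2) * ((|s j| + a j) ^ (2 - p)) ^ (p / 2) := by
    intro j
    have hb := ha0 j
    have h0 := hT0 j
    rw [← Real.mul_rpow (by positivity) (by positivity)]
    calc |s j - a j| ^ p = ((s j - a j) ^ 2) ^ (p / 2) := by
          rw [← sq_abs, ← Real.rpow_natCast, ← Real.rpow_mul (abs_nonneg _)]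
          congr 1
          push_cast
          ring
      _ ≤ _ := by
          gcongr
          exact hTle j
  -- Hölder with these exponents converts the weighted quadratic bound into an `ℓ_p` bound; the
  -- weights contribute `∑ (|s j| + a j) ^ p ≤ 4`.
  have hconj : (2 / p).HolderConjugate (2 / (2 - p)) := by
    rw [Real.holderConjugate_iff]
    refine ⟨(one_lt_div hp0).2 hp2, ?_⟩
    rw [inv_div, inv_div]
    ring
  have hH := Real.inner_le_Lp_mul_Lq_of_nonneg Finset.univ hconj
    (f := fun j => (A * T j) ^ (p / 2)) (g := fun j => ((|s j| + a j) ^ (2 - p)) ^ (p / 2))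
    (fun j _ => Real.rpow_nonneg (mul_nonneg hA0.le (hT0 j)) _)
    (fun j _ => by have := ha0 j; positivity)
  have h2p : (2 - p) ≠ 0 := by linarith
  have e1 : ∑ j, ((A * T j) ^ (p / 2)) ^ (2 / p) = A * ∑ j, T j := by
    rw [Finset.mul_sum]
    refine Finset.sum_congr rfl fun j _ => ?_
    rw [← Real.rpow_mul (mul_nonneg hA0.le (hT0 j))]
    have : p / 2 * (2 / p) = 1 := by field_simp
    rw [this, Real.rpow_one]
  have e2 : ∑ j, (((|s j| + a j) ^ (2 - p)) ^ (p / 2)) ^ (2 / (2 - p)) ≤ 4 := by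
    calc ∑ j, (((|s j| + a j) ^ (2 - p)) ^ (p / 2)) ^ (2 / (2 - p))
        = ∑ j, (|s j| + a j) ^ p := by
          refine Finset.sum_congr rfl fun j _ => ?_
          have := ha0 j
          rw [← Real.rpow_mul (by positivity), ← Real.rpow_mul (by positivity)]
          congr 1
          field_simp
      _ ≤ ∑ j, 2 * (|s j| ^ p + a j ^ p) :=
          Finset.sum_le_sum fun j _ => add_rpow_le_two_mul hp1 hp2 (abs_nonneg _) (ha0 j)
      _ = 4 := by
          rw [← Finset.mul_sum, Finset.sum_add_distrib, hasum, hssum]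
          norm_num
  rw [e1, one_div_div, one_div_div] at hH
  apply ellpNorm_le_of_sum_le hp0 (by positivity)
  have hTs0 : 0 ≤ ∑ j, T j := Finset.sum_nonneg fun j _ => hT0 j
  calc ∑ j, |(z - dualVec p q w) j| ^ p
      ≤ ∑ j, (A * T j) ^ (p / 2) * ((|s j| + a j) ^ (2 - p)) ^ (p / 2) := by
        refine Finset.sum_le_sum fun j _ => ?_
        rw [hdiff]
        exact hpt j
    _ ≤ _ := hH
    _ ≤ (A * η) ^ (p / 2) * 4 ^ ((2 - p) / 2) := by
        have : 0 ≤ ∑ j, (((|s j| + a j) ^ (2 - p)) ^ (p / 2)) ^ (2 / (2 - p)) :=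
          Finset.sum_nonneg fun j _ => by have := ha0 j; positivity
        gcongr
    _ ≤ (A * η) ^ (p / 2) * 4 ^ (p / 2) := by
        gcongr
        · norm_num
        · linarith
    _ = (4 * √(η / (p - 1))) ^ p := by
        have : 4 * √(η / (p - 1)) = √(A * η * 4) := by
          rw [hA, show 4 / (p - 1) * η * 4 = 4 ^ 2 * (η / (p - 1)) by ring,
            Real.sqrt_mul (by norm_num), Real.sqrt_sq (by norm_num)]
        rw [this, ← Real.mul_rpow (by positivity) (by norm_num), Real.sqrt_eq_rpow,
          ← Real.rpow_mul (by positivity)]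
        congr 1
        ring

end DualVector

/-! ### Dyadic layering of the bilinear form -/

section Dyadic

variable {n : ℕ}

/-- A linear form on a cube is maximal at the vertex with the signs of its coefficients. The sign of
a zero coefficient is taken to be `1`, so that the support is all of `S`. -/
lemma exists_sign_vector (c : Fin n → ℝ) (S : Finset (Fin n)) :
    ∃ ε : Fin n → ℤ, (∀ i, ε i ∈ Finset.Icc (-1 : ℤ) 1) ∧ suppCard ε = S.card ∧
      ∀ (u : Fin n → ℝ) (α : ℝ), (∀ i, |u i| ≤ α) → (∀ i, i ∉ S → u i = 0) →
        ∑ i, u i * c i ≤ α * ∑ i, ε i * c i := by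
  refine ⟨fun i => if i ∈ S then (if 0 ≤ c i then 1 else -1) else 0, ?_, ?_, ?_⟩
  · intro i
    simp only
    split_ifs <;> simp
  · rw [suppCard]
    congr 1
    ext i
    by_cases h : i ∈ S
    · by_cases h2 : 0 ≤ c i <;> simp [h, h2]
    · simp [h]
  · intro u α hu hS
    rw [Finset.mul_sum]
    apply Finset.sum_le_sum
    intro i _
    by_cases h : i ∈ S
    · have h1 : u i * c i ≤ α * |c i| := by
        calc u i * c i ≤ |u i * c i| := le_abs_self _
          _ = |u i| * |c i| := abs_mul _ _
          _ ≤ α * |c i| := by gcongr; exact hu i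
      by_cases h2 : 0 ≤ c i
      · simpa [h, h2, abs_of_nonneg h2] using h1
      · simpa [h, h2, abs_of_neg (not_le.1 h2)] using h1
    · simp [h, hS i h]

lemma bil_eq_sum_left (G : Matrix (Fin n) (Fin n) ℝ) (x y : Fin n → ℝ) :
    bil G x y = ∑ i, x i * ∑ j, G i j * y j := by
  simp only [bil, Finset.mul_sum, mul_assoc]

lemma bil_eq_sum_right (G : Matrix (Fin n) (Fin n) ℝ) (x y : Fin n → ℝ) :
    bil G x y = ∑ j, y j * ∑ i, x i * G i j := by
  rw [bil, Finset.sum_comm]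
  refine Finset.sum_congr rfl fun j _ => ?_
  rw [Finset.mul_sum]
  refine Finset.sum_congr rfl fun i _ => ?_
  ring

lemma bil_add_left (G : Matrix (Fin n) (Fin n) ℝ) (x x' y : Fin n → ℝ) :
    bil G (x + x') y = bil G x y + bil G x' y := by
  simp [bil_eq_sum_left, add_mul, Finset.sum_add_distrib]

lemma bil_add_right (G : Matrix (Fin n) (Fin n) ℝ) (x y y' : Fin n → ℝ) :
    bil G x (y + y') = bil G x y + bil G x y' := by
  simp [bil_eq_sum_right, add_mul, Finset.sum_add_distrib]

lemma bil_sum_sum (G : Matrix (Fin n) (Fin n) ℝ) (I J : Finset ℕ) (u v : ℕ → Fin n → ℝ) :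
    bil G (∑ k ∈ I, u k) (∑ l ∈ J, v l) = ∑ k ∈ I, ∑ l ∈ J, bil G (u k) (v l) := by
  have h1 : ∀ y, bil G (∑ k ∈ I, u k) y = ∑ k ∈ I, bil G (u k) y := by
    intro y
    simp only [bil_eq_sum_left, Finset.sum_apply, Finset.sum_mul]
    rw [Finset.sum_comm]
  have h2 : ∀ x, bil G x (∑ l ∈ J, v l) = ∑ l ∈ J, bil G x (v l) := by
    intro x
    simp only [bil_eq_sum_right, Finset.sum_apply, Finset.sum_mul]
    rw [Finset.sum_comm]
  rw [h1]
  exact Finset.sum_congr rfl fun k _ => h2 _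

/-- On products of cubes the bilinear form is controlled by its values at sign vectors. -/
lemma SignBound.bil_le {K : ℝ} {G : Matrix (Fin n) (Fin n) ℝ} (hG : SignBound K G)
    {u v : Fin n → ℝ} {α β : ℝ} {S T : Finset (Fin n)} (hα : 0 ≤ α) (hβ : 0 ≤ β)
    (hu : ∀ i, |u i| ≤ α) (hv : ∀ i, |v i| ≤ β) (hS : ∀ i, i ∉ S → u i = 0)
    (hT : ∀ i, i ∉ T → v i = 0) :
    bil G u v ≤ α * β * (K * √(Real.log n) * (S.card * √T.card + T.card * √S.card)) := by
  obtain ⟨ε, hε, hεS, h1⟩ := exists_sign_vector (fun i => ∑ j, G i j * v j) S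
  obtain ⟨η, hη, hηT, h2⟩ := exists_sign_vector (fun j => ∑ i, (ε i : ℝ) * G i j) T
  have hb := hG ε η hε hη
  rw [hεS, hηT] at hb
  calc bil G u v ≤ α * bil G (fun i => ε i) v := by
        rw [bil_eq_sum_left, bil_eq_sum_left]
        exact h1 u α hu hS
    _ ≤ α * (β * bil G (fun i => ε i) (fun i => η i)) := by
        gcongr
        rw [bil_eq_sum_right, bil_eq_sum_right]
        exact h2 v β hv hT
    _ ≤ α * (β * (K * √(Real.log n) * (S.card * √T.card + T.card * √S.card))) := by gcongr
    _ = _ := by ring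

/-- The constant in the dyadic estimate. -/
noncomputable def dyadicConst (p : ℝ) : ℝ :=
  16 * (2 ^ (p - 1) / (2 ^ (p - 1) - 1)) * (1 / (1 - 2 ^ (p / 2 - 1)))

lemma one_lt_two_rpow {p : ℝ} (hp1 : 1 < p) : (1 : ℝ) < 2 ^ (p - 1) :=
  Real.one_lt_rpow (by norm_num) (by linarith)

lemma two_rpow_lt_one {p : ℝ} (hp2 : p < 2) : (2 : ℝ) ^ (p / 2 - 1) < 1 :=
  Real.rpow_lt_one_of_one_lt_of_neg (by norm_num) (by linarith)

lemma dyadicConst_pos {p : ℝ} (hp1 : 1 < p) (hp2 : p < 2) : 0 < dyadicConst p := by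
  have h1 := one_lt_two_rpow hp1
  have h2 := two_rpow_lt_one hp2
  have h3 : (0 : ℝ) < 2 ^ (p - 1) - 1 := by linarith
  have h4 : (0 : ℝ) < 1 - 2 ^ (p / 2 - 1) := by linarith
  unfold dyadicConst
  positivity

lemma sum_pow_le_of_one_lt {σ : ℝ} (hσ : 1 < σ) {I : Finset ℕ} {L : ℕ} (hI : ∀ l ∈ I, l ≤ L) :
    ∑ l ∈ I, σ ^ l ≤ σ / (σ - 1) * σ ^ L := by
  have hσ1 : 0 < σ - 1 := by linarith
  calc ∑ l ∈ I, σ ^ l ≤ ∑ l ∈ Finset.range (L + 1), σ ^ l := by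
        apply Finset.sum_le_sum_of_subset_of_nonneg
        · intro l hl
          have := hI l hl
          simp
          omega
        · intro l _ _
          positivity
    _ = (σ ^ (L + 1) - 1) / (σ - 1) := geom_sum_eq hσ.ne' _
    _ ≤ σ ^ (L + 1) / (σ - 1) := by gcongr; linarith
    _ = _ := by rw [pow_succ]; ring

lemma sum_pow_le_of_lt_one {ρ : ℝ} (hρ0 : 0 < ρ) (hρ : ρ < 1) {I : Finset ℕ} {k L : ℕ}
    (hI : ∀ l ∈ I, k ≤ l ∧ l ≤ L) : ∑ l ∈ I, ρ ^ l ≤ 1 / (1 - ρ) * ρ ^ k := by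
  have hρ1 : 0 < 1 - ρ := by linarith
  calc ∑ l ∈ I, ρ ^ l ≤ ∑ l ∈ Finset.Ico k (L + 1), ρ ^ l := by
        apply Finset.sum_le_sum_of_subset_of_nonneg
        · intro l hl
          have := hI l hl
          simp
          omega
        · intro l _ _
          positivity
    _ = ρ ^ k * ∑ l ∈ Finset.range (L + 1 - k), ρ ^ l := by
        rw [Finset.sum_Ico_eq_sum_range, Finset.mul_sum]
        simp_rw [pow_add]
    _ ≤ ρ ^ k * (1 / (1 - ρ)) := by
        gcongr
        rw [geom_sum_eq hρ.ne, le_div_iff₀ hρ1, ← neg_div_neg_eq, neg_sub, neg_sub,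
          div_mul_cancel₀ _ hρ1.ne']
        have : 0 < ρ ^ (L + 1 - k) := by positivity
        linarith
    _ = _ := by ring

/-- Layer `l` has height `2^{-l}` and at most `4 · 2^{pl}` coordinates, so the layers `k, l`
interact with strength at most a multiple of `σ^k ρ^l + σ^l ρ^k`, where `σ = 2^{p-1} > 1` and `ρ =
2^{p/2-1} < 1`. One geometric series is governed by the finest layer and the other by the coarsest.
-/
lemma SignBound.bil_sum_le {K p : ℝ} (hK : 0 ≤ K) (hp1 : 1 < p) (hp2 : p < 2)
    {G : Matrix (Fin n) (Fin n) ℝ} (hG : SignBound K G) {I : Finset ℕ} {k L : ℕ}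
    (hI : ∀ l ∈ I, k ≤ l ∧ l ≤ L) (u : ℕ → Fin n → ℝ) (S : ℕ → Finset (Fin n))
    (hu : ∀ l ∈ I, ∀ i, |u l i| ≤ (1 / 2) ^ l) (hS : ∀ l ∈ I, ∀ i, i ∉ S l → u l i = 0)
    (hcard : ∀ l ∈ I, ((S l).card : ℝ) ≤ 4 * (2 ^ p) ^ l) :
    bil G (∑ l ∈ I, u l) (∑ l ∈ I, u l) ≤
      dyadicConst p * (K * √(Real.log n)) * ((2 ^ (p - 1)) ^ L * (2 ^ (p / 2 - 1)) ^ k) := by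
  set σ : ℝ := 2 ^ (p - 1) with hσ
  set ρ : ℝ := 2 ^ (p / 2 - 1) with hρ
  have hσ1 : 1 < σ := one_lt_two_rpow hp1
  have hρ1 : ρ < 1 := two_rpow_lt_one hp2
  have hρ0 : 0 < ρ := by positivity
  set h := K * √(Real.log n) with hh
  have hh0 : 0 ≤ h := by positivity
  have eσ : ∀ l : ℕ, (1 / 2 : ℝ) ^ l * (2 ^ p) ^ l = σ ^ l := by
    intro l
    rw [← mul_pow, hσ, Real.rpow_sub (by norm_num), Real.rpow_one]
    ring
  have eρ : ∀ l : ℕ, (1 / 2 : ℝ) ^ l * √((2 ^ p) ^ l) = ρ ^ l := by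
    intro l
    have : √(((2 : ℝ) ^ p) ^ l) = (2 ^ (p / 2)) ^ l := by
      rw [Real.sqrt_eq_iff_eq_sq (by positivity) (by positivity), ← pow_mul, mul_comm l 2,
        pow_mul, ← Real.rpow_natCast ((2 : ℝ) ^ (p / 2)) 2, ← Real.rpow_mul (by norm_num)]
      congr 2
      push_cast
      ring
    rw [this, ← mul_pow, hρ, Real.rpow_sub (by norm_num), Real.rpow_one]
    ring
  have hcross : ∀ k ∈ I, ∀ l ∈ I, (1 / 2 : ℝ) ^ k * (1 / 2) ^ l * ((S k).card * √(S l).card) ≤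
      8 * (σ ^ k * ρ ^ l) := by
    intro k hk l hl
    have h4 : √(4 * (2 ^ p) ^ l) = 2 * √(((2 : ℝ) ^ p) ^ l) := by
      rw [Real.sqrt_mul (by norm_num), show (4 : ℝ) = 2 ^ 2 by norm_num,
        Real.sqrt_sq (by norm_num)]
    calc (1 / 2 : ℝ) ^ k * (1 / 2) ^ l * ((S k).card * √(S l).card)
        ≤ (1 / 2 : ℝ) ^ k * (1 / 2) ^ l * ((4 * (2 ^ p) ^ k) * √(4 * (2 ^ p) ^ l)) := by
          gcongr
          · exact hcard k hk
          · exact hcard l hl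
      _ = 8 * (((1 / 2 : ℝ) ^ k * (2 ^ p) ^ k) * ((1 / 2 : ℝ) ^ l * √((2 ^ p) ^ l))) := by
          rw [h4]
          ring
      _ = _ := by rw [eσ, eρ]
  have hpair : ∀ k ∈ I, ∀ l ∈ I, bil G (u k) (u l) ≤
      h * (8 * (σ ^ k * ρ ^ l) + 8 * (σ ^ l * ρ ^ k)) := by
    intro k hk l hl
    refine (hG.bil_le (by positivity) (by positivity) (hu k hk) (hu l hl) (hS k hk)
      (hS l hl)).trans ?_
    have h1 := hcross k hk l hl
    have h2 := hcross l hl k hk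
    calc _ = h * ((1 / 2 : ℝ) ^ k * (1 / 2) ^ l * ((S k).card * √(S l).card) +
          (1 / 2 : ℝ) ^ l * (1 / 2) ^ k * ((S l).card * √(S k).card)) := by ring
      _ ≤ _ := by gcongr
  rw [bil_sum_sum]
  have hs1 := sum_pow_le_of_one_lt hσ1 (fun l hl => (hI l hl).2)
  have hs2 := sum_pow_le_of_lt_one hρ0 hρ1 hI
  have hs3 : 0 ≤ ∑ l ∈ I, ρ ^ l := Finset.sum_nonneg fun _ _ => by positivity
  have hσ2 : 0 < σ - 1 := by linarith
  calc ∑ k ∈ I, ∑ l ∈ I, bil G (u k) (u l)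
      ≤ ∑ k ∈ I, ∑ l ∈ I, h * (8 * (σ ^ k * ρ ^ l) + 8 * (σ ^ l * ρ ^ k)) :=
        Finset.sum_le_sum fun k hk => Finset.sum_le_sum fun l hl => hpair k hk l hl
    _ = 16 * h * ((∑ l ∈ I, σ ^ l) * ∑ l ∈ I, ρ ^ l) := by
        have e1 : ∑ k ∈ I, ∑ l ∈ I, σ ^ k * ρ ^ l = (∑ l ∈ I, σ ^ l) * ∑ l ∈ I, ρ ^ l := by
          rw [Finset.sum_mul_sum]
        have e2 : ∑ k ∈ I, ∑ l ∈ I, σ ^ l * ρ ^ k = (∑ l ∈ I, σ ^ l) * ∑ l ∈ I, ρ ^ l := by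
          rw [Finset.sum_comm, Finset.sum_mul_sum]
        simp_rw [← Finset.mul_sum, Finset.sum_add_distrib, ← Finset.mul_sum]
        simp_rw [← Finset.mul_sum] at e1 e2
        rw [e1, e2]
        ring
    _ ≤ 16 * h * ((σ / (σ - 1) * σ ^ L) * (1 / (1 - ρ) * ρ ^ k)) := by gcongr
    _ = _ := by
        rw [dyadicConst]
        ring

/-- The part of `x` consisting of the coordinates of size at most `t`. -/
noncomputable def trunc (x : Fin n → ℝ) (t : ℝ) : Fin n → ℝ := fun i => if |x i| ≤ t then x i else 0

/-- The indices of the coordinates of size larger than `t`. -/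
noncomputable def bigSet (x : Fin n → ℝ) (t : ℝ) : Finset (Fin n) :=
  Finset.univ.filter fun i => t < |x i|

lemma card_bigSet_mul_le {p : ℝ} (hp : 0 < p) {x : Fin n → ℝ} (hx : ∑ i, |x i| ^ p ≤ 1) {t : ℝ}
    (ht : 0 ≤ t) : (bigSet x t).card * t ^ p ≤ 1 := by
  calc (bigSet x t).card * t ^ p = ∑ _i ∈ bigSet x t, t ^ p := by simp
    _ ≤ ∑ i ∈ bigSet x t, |x i| ^ p := by
        refine Finset.sum_le_sum fun i hi => ?_
        have : t < |x i| := by simpa [bigSet] using hi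
        gcongr
    _ ≤ ∑ i, |x i| ^ p := Finset.sum_le_sum_of_subset_of_nonneg (Finset.subset_univ _)
        (fun _ _ _ => by positivity)
    _ ≤ 1 := hx

lemma card_bigSet_le {p : ℝ} (hp : 0 < p) {x : Fin n → ℝ} (hx : ∑ i, |x i| ^ p ≤ 1) (l : ℕ) :
    ((bigSet x ((1 / 2) ^ l)).card : ℝ) ≤ (2 ^ p) ^ l := by
  have h := card_bigSet_mul_le hp hx (t := (1 / 2) ^ l) (by positivity)
  have e : (((1 : ℝ) / 2) ^ l) ^ p * (2 ^ p) ^ l = 1 := by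
    rw [← Real.rpow_natCast, ← Real.rpow_natCast, ← Real.rpow_mul (by norm_num), mul_comm (l : ℝ) p,
      Real.rpow_mul (by norm_num), ← Real.mul_rpow (by positivity) (by positivity),
      ← Real.mul_rpow (by norm_num) (by norm_num)]
    norm_num
  calc ((bigSet x ((1 / 2) ^ l)).card : ℝ)
      = (bigSet x ((1 / 2) ^ l)).card * (((1 : ℝ) / 2) ^ l) ^ p * (2 ^ p) ^ l := by
        rw [mul_assoc, e, mul_one]
    _ ≤ 1 * (2 ^ p) ^ l := by gcongr
    _ = _ := one_mul _

lemma trunc_sub_trunc_abs_le (x : Fin n → ℝ) {s t : ℝ} (hst : t ≤ s) (hs : 0 ≤ s) (i : Fin n) :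
    |(trunc x s - trunc x t) i| ≤ s := by
  simp only [Pi.sub_apply, trunc]
  split_ifs with h1 h2
  · simpa using hs
  · simpa using h1
  · linarith
  · simpa using hs

lemma trunc_sub_trunc_eq_zero (x : Fin n → ℝ) {s t : ℝ} (hst : t ≤ s) (i : Fin n)
    (hi : i ∉ bigSet x t) : (trunc x s - trunc x t) i = 0 := by
  have : |x i| ≤ t := by simpa [bigSet] using hi
  simp [trunc, this, this.trans hst]

lemma half_pow_succ_le (l : ℕ) : (1 / 2 : ℝ) ^ (l + 1) ≤ (1 / 2) ^ l :=
  pow_le_pow_of_le_one (by norm_num) (by norm_num) (Nat.le_succ l)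

lemma card_bigSet_succ_le {p : ℝ} (hp1 : 1 < p) (hp2 : p < 2) {x : Fin n → ℝ}
    (hx : ∑ i, |x i| ^ p ≤ 1) (l : ℕ) :
    ((bigSet x ((1 / 2) ^ (l + 1))).card : ℝ) ≤ 4 * (2 ^ p) ^ l := by
  refine (card_bigSet_le (by linarith) hx (l + 1)).trans ?_
  rw [pow_succ, mul_comm]
  gcongr
  calc (2 : ℝ) ^ p ≤ 2 ^ (2 : ℝ) := by
        gcongr
        norm_num
    _ = 4 := by norm_num

lemma SignBound.bil_big_le {K p : ℝ} (hK : 0 ≤ K) (hp1 : 1 < p) (hp2 : p < 2)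
    {G : Matrix (Fin n) (Fin n) ℝ} (hG : SignBound K G) {x : Fin n → ℝ}
    (hx : ∑ i, |x i| ^ p ≤ 1) (hx1 : ∀ i, |x i| ≤ 1) (k : ℕ) :
    bil G (x - trunc x ((1 / 2) ^ k)) (x - trunc x ((1 / 2) ^ k)) ≤
      dyadicConst p * (K * √(Real.log n)) * (2 ^ (p - 1)) ^ k := by
  have hsum : x - trunc x ((1 / 2) ^ k) =
      ∑ l ∈ Finset.range k, (trunc x ((1 / 2) ^ l) - trunc x ((1 / 2) ^ (l + 1))) := by
    rw [Finset.sum_range_sub' (fun l => trunc x ((1 / 2) ^ l)) k]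
    congr 1
    ext i
    simp [trunc, hx1 i]
  rw [hsum]
  -- The layers stop at `k - 1`; using `k` as the upper level costs only a constant factor.
  refine (hG.bil_sum_le hK hp1 hp2 (k := 0) (L := k) ?_ _
    (fun l => bigSet x ((1 / 2) ^ (l + 1))) ?_ ?_ ?_).trans ?_
  · intro l hl
    have := Finset.mem_range.1 hl
    omega
  · exact fun l _ i => trunc_sub_trunc_abs_le x (half_pow_succ_le l) (by positivity) i
  · exact fun l _ i hi => trunc_sub_trunc_eq_zero x (half_pow_succ_le l) i hi
  · exact fun l _ => card_bigSet_succ_le hp1 hp2 hx l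
  · simp

lemma SignBound.bil_small_le {K p : ℝ} (hK : 0 ≤ K) (hp1 : 1 < p) (hp2 : p < 2)
    {G : Matrix (Fin n) (Fin n) ℝ} (hG : SignBound K G) {x : Fin n → ℝ}
    (hx : ∑ i, |x i| ^ p ≤ 1) {k L : ℕ} (hkL : k ≤ L) (hL : (n : ℝ) ≤ 4 * (2 ^ p) ^ L) :
    bil G (trunc x ((1 / 2) ^ k)) (trunc x ((1 / 2) ^ k)) ≤
      dyadicConst p * (K * √(Real.log n)) * ((2 ^ (p - 1)) ^ L * (2 ^ (p / 2 - 1)) ^ k) := by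
  -- The bottom layer gathers everything of size at most `2^{-L}`. Its support is bounded only by
  -- `n`, which is why `hL` is required.
  set u : ℕ → Fin n → ℝ := fun l => if l < L then
    trunc x ((1 / 2) ^ l) - trunc x ((1 / 2) ^ (l + 1)) else trunc x ((1 / 2) ^ L) with hu
  set S : ℕ → Finset (Fin n) := fun l => if l < L then bigSet x ((1 / 2) ^ (l + 1))
    else Finset.univ with hS
  have hsum : trunc x ((1 / 2) ^ k) = ∑ l ∈ Finset.Ico k (L + 1), u l := by
    rw [Finset.sum_Ico_succ_top hkL]
    have h1 : ∑ l ∈ Finset.Ico k L, u l =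
        ∑ l ∈ Finset.Ico k L, (trunc x ((1 / 2) ^ l) - trunc x ((1 / 2) ^ (l + 1))) := by
      refine Finset.sum_congr rfl fun l hl => ?_
      simp only [hu, if_pos (Finset.mem_Ico.1 hl).2]
    have h2 : ∑ l ∈ Finset.Ico k L, (trunc x ((1 / 2) ^ l) - trunc x ((1 / 2) ^ (l + 1))) =
        trunc x ((1 / 2) ^ k) - trunc x ((1 / 2) ^ L) := by
      have := Finset.sum_Ico_sub (fun l => -trunc x ((1 / 2 : ℝ) ^ l)) hkL
      simpa [sub_eq_add_neg, add_comm] using this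
    rw [h1, h2]
    simp [hu]
  rw [hsum]
  refine hG.bil_sum_le hK hp1 hp2 ?_ u S ?_ ?_ ?_
  · intro l hl
    have := Finset.mem_Ico.1 hl
    omega
  · intro l hl i
    have := Finset.mem_Ico.1 hl
    by_cases hlL : l < L
    · simp only [hu, if_pos hlL]
      exact trunc_sub_trunc_abs_le x (half_pow_succ_le l) (by positivity) i
    · obtain rfl : l = L := by omega
      simp only [hu, if_neg hlL, trunc]
      split_ifs with h
      · exact h
      · simp
  · intro l hl i hi
    by_cases hlL : l < L
    · simp only [hu, hS, if_pos hlL] at hi ⊢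
      exact trunc_sub_trunc_eq_zero x (half_pow_succ_le l) i hi
    · simp [hS, hlL] at hi
  · intro l hl
    have := Finset.mem_Ico.1 hl
    by_cases hlL : l < L
    · simp only [hS, if_pos hlL]
      exact card_bigSet_succ_le hp1 hp2 hx l
    · have : l = L := by omega
      simpa [hS, hlL, this] using hL

end Dyadic

/-! ### Choice of the dyadic scales -/

section Scales

lemma two_rpow_pow (s : ℝ) (k : ℕ) : ((2 : ℝ) ^ s) ^ k = ((2 : ℝ) ^ k) ^ s := by
  rw [← Real.rpow_natCast, ← Real.rpow_natCast, ← Real.rpow_mul (by norm_num),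
    ← Real.rpow_mul (by norm_num), mul_comm]

lemma exists_two_pow_near {X : ℝ} (hX : 1 ≤ X) : ∃ k : ℕ, X < 2 ^ (k + 1) ∧ 2 ^ k ≤ X := by
  obtain ⟨k, h1, h2⟩ := exists_nat_pow_near hX (by norm_num : (1 : ℝ) < 2)
  exact ⟨k, h2, h1⟩

/-- Take `2^k` of order `n^{(p-1)/p}` and `2^L` of order `n^{1/p}`. Both the small-small error and
the square root of the number of large coordinates are then of order `n^{(p-1)/2}`; the big-big
error is no larger because `2(p-1) ≤ p`. -/
lemma exists_dyadic_scales {p : ℝ} (hp1 : 1 < p) (hp2 : p < 2) {n : ℕ} (hn : 1 ≤ n) :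
    ∃ k L : ℕ, k ≤ L ∧ (n : ℝ) ≤ 4 * (2 ^ p) ^ L ∧
      ((2 : ℝ) ^ (p - 1)) ^ L * (2 ^ (p / 2 - 1)) ^ k ≤ 2 * (n : ℝ) ^ ((p - 1) / 2) ∧
      ((2 : ℝ) ^ (p - 1)) ^ k ≤ 2 * (n : ℝ) ^ ((p - 1) / 2) ∧
      ((2 : ℝ) ^ p) ^ k ≤ 4 * (n : ℝ) ^ (p - 1) := by
  have hp0 : 0 < p := by linarith
  have hn1 : (1 : ℝ) ≤ n := by exact_mod_cast hn
  have hn0 : (0 : ℝ) < n := by linarith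
  set X : ℝ := (n : ℝ) ^ ((p - 1) / p) with hX
  set M : ℝ := (n : ℝ) ^ (1 / p) with hM
  have hX1 : 1 ≤ X := Real.one_le_rpow hn1 (div_nonneg (by linarith) hp0.le)
  have hM1 : 1 ≤ M := Real.one_le_rpow hn1 (by positivity)
  obtain ⟨k, hk1, hk2⟩ := exists_two_pow_near hX1
  obtain ⟨L, hL1, hL2⟩ := exists_two_pow_near hM1
  have hk3 : (2 : ℝ) ^ (k + 1) ≤ 2 * X := by rw [pow_succ]; linarith
  have hL3 : (2 : ℝ) ^ (L + 1) ≤ 2 * M := by rw [pow_succ]; linarith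
  have htwo : ∀ s : ℝ, s ≤ 1 → (2 : ℝ) ^ s ≤ 2 := by
    intro s hs
    calc (2 : ℝ) ^ s ≤ 2 ^ (1 : ℝ) := by
          gcongr
          norm_num
      _ = 2 := Real.rpow_one 2
  have hpow : ∀ A s : ℝ, 0 ≤ A → 0 ≤ s → s ≤ 1 → (2 * A) ^ s ≤ 2 * A ^ s := by
    intro A s hA hs hs1
    rw [Real.mul_rpow (by norm_num) hA]
    gcongr
    exact htwo s hs1
  refine ⟨k + 1, L + 1, ?_, ?_, ?_, ?_, ?_⟩
  · have hXM : X ≤ M := by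
      apply Real.rpow_le_rpow_of_exponent_le hn1
      gcongr
      linarith
    have : (2 : ℝ) ^ k < 2 ^ (L + 1) := by linarith
    have := (pow_lt_pow_iff_right₀ (by norm_num : (1 : ℝ) < 2)).1 this
    omega
  · rw [two_rpow_pow]
    have h1 : M ^ p = n := by
      rw [hM, ← Real.rpow_mul hn0.le, one_div_mul_cancel hp0.ne', Real.rpow_one]
    have h2 : M ^ p ≤ ((2 : ℝ) ^ (L + 1)) ^ p := by gcongr
    have h3 : 0 ≤ ((2 : ℝ) ^ (L + 1)) ^ p := by positivity
    linarith
  · rw [two_rpow_pow, two_rpow_pow]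
    have h1 : ((2 : ℝ) ^ (L + 1)) ^ (p - 1) ≤ 2 * M ^ (p - 1) :=
      (Real.rpow_le_rpow (by positivity) hL3 (by linarith)).trans
        (hpow M _ (by positivity) (by linarith) (by linarith))
    have h2 : ((2 : ℝ) ^ (k + 1)) ^ (p / 2 - 1) ≤ X ^ (p / 2 - 1) :=
      Real.rpow_le_rpow_of_nonpos (by positivity) hk1.le (by linarith)
    calc ((2 : ℝ) ^ (L + 1)) ^ (p - 1) * ((2 : ℝ) ^ (k + 1)) ^ (p / 2 - 1)
        ≤ (2 * M ^ (p - 1)) * X ^ (p / 2 - 1) := by gcongr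
      _ = 2 * (n : ℝ) ^ ((p - 1) / 2) := by
        rw [mul_assoc, hM, hX, ← Real.rpow_mul hn0.le, ← Real.rpow_mul hn0.le,
          ← Real.rpow_add hn0]
        congr 2
        field_simp
        ring
  · rw [two_rpow_pow]
    calc ((2 : ℝ) ^ (k + 1)) ^ (p - 1) ≤ (2 * X) ^ (p - 1) :=
          Real.rpow_le_rpow (by positivity) hk3 (by linarith)
      _ ≤ 2 * X ^ (p - 1) := hpow X _ (by positivity) (by linarith) (by linarith)
      _ ≤ 2 * (n : ℝ) ^ ((p - 1) / 2) := by
        rw [hX, ← Real.rpow_mul hn0.le]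
        gcongr ?_ * ?_
        apply Real.rpow_le_rpow_of_exponent_le hn1
        rw [div_mul_eq_mul_div, div_le_div_iff₀ hp0 (by norm_num)]
        nlinarith
  · rw [two_rpow_pow]
    calc ((2 : ℝ) ^ (k + 1)) ^ p ≤ (2 * X) ^ p := by gcongr
      _ = 2 ^ p * X ^ p := Real.mul_rpow (by norm_num) (by positivity)
      _ ≤ 4 * X ^ p := by
        gcongr
        calc (2 : ℝ) ^ p ≤ 2 ^ (2 : ℝ) := by
              gcongr
              norm_num
          _ = 4 := by norm_num
      _ = 4 * (n : ℝ) ^ (p - 1) := by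
        rw [hX, ← Real.rpow_mul hn0.le, div_mul_cancel₀ _ hp0.ne']

end Scales

/-! ### Interaction of a sparse vector with its complement -/

section ColumnEstimate

variable {n : ℕ}

/-- Rounding towards zero: it increases neither the absolute value nor the support. -/
lemma exists_int_round (N : ℕ) {y : ℝ} (hy : |y| ≤ 1) :
    ∃ m : ℤ, m ∈ Finset.Icc (-N : ℤ) N ∧ |(m : ℝ)| ≤ N * |y| ∧ |N * y - m| ≤ 1 ∧
      (y = 0 → m = 0) := by
  have key : ∀ y : ℝ, 0 ≤ y → y ≤ 1 → ∃ m : ℤ, m ∈ Finset.Icc (-N : ℤ) N ∧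
      |(m : ℝ)| ≤ N * |y| ∧ |N * y - m| ≤ 1 ∧ (y = 0 → m = 0) := by
    intro y hy0 hy1
    have h0 : 0 ≤ N * y := by positivity
    have hf0 : 0 ≤ ⌊N * y⌋ := Int.floor_nonneg.2 h0
    have h1 := Int.floor_le (N * y)
    have h2 := Int.lt_floor_add_one (N * y)
    refine ⟨⌊N * y⌋, ?_, ?_, ?_, ?_⟩
    · rw [Finset.mem_Icc]
      refine ⟨by omega, ?_⟩
      have h3 : N * y ≤ N * 1 := by gcongr
      have : ((⌊N * y⌋ : ℤ) : ℝ) ≤ ((N : ℤ) : ℝ) := by push_cast; linarith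
      exact_mod_cast this
    · rw [abs_of_nonneg (by exact_mod_cast hf0), abs_of_nonneg hy0]
      exact h1
    · rw [abs_of_nonneg (by linarith)]
      linarith
    · rintro rfl
      simp
  rcases le_total 0 y with h | h
  · exact key y h (by rwa [abs_of_nonneg h] at hy)
  · obtain ⟨m, h1, h2, h3, h4⟩ := key (-y) (by linarith) (by rwa [abs_of_nonpos h] at hy)
    refine ⟨-m, ?_, ?_, ?_, ?_⟩
    · rw [Finset.mem_Icc] at h1 ⊢
      omega
    · simpa using h2
    · rw [← abs_neg]
      have : -(N * y - ((-m : ℤ) : ℝ)) = N * -y - m := by push_cast; ring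
      rwa [this]
    · intro hy
      simp [h4 (by simp [hy])]

lemma bil_symm (G : Matrix (Fin n) (Fin n) ℝ) (x y : Fin n → ℝ) :
    bil (symm G) x y = 1 / √2 * (bil G x y + bil G y x) := by
  have h : bil G y x = ∑ i, ∑ j, x i * G j i * y j := by
    rw [bil, Finset.sum_comm]
    refine Finset.sum_congr rfl fun i _ => Finset.sum_congr rfl fun j _ => ?_
    ring
  rw [h]
  simp only [bil]
  rw [← Finset.sum_add_distrib, Finset.mul_sum]
  refine Finset.sum_congr rfl fun i _ => ?_
  rw [← Finset.sum_add_distrib, Finset.mul_sum]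
  refine Finset.sum_congr rfl fun j _ => ?_
  have : symm G i j = 1 / √2 * (G i j + G j i) := rfl
  rw [this]
  ring

lemma one_div_sqrt_two_le : 1 / √2 ≤ 1 := by
  rw [div_le_one (by positivity)]
  exact Real.one_le_sqrt.2 (by norm_num)

lemma SignBound.bil_symm_le {K : ℝ} (hK : 0 ≤ K) {G : Matrix (Fin n) (Fin n) ℝ}
    (hG : SignBound K G) {u v : Fin n → ℝ} {α β : ℝ} {S T : Finset (Fin n)} (hα : 0 ≤ α)
    (hβ : 0 ≤ β) (hu : ∀ i, |u i| ≤ α) (hv : ∀ i, |v i| ≤ β) (hS : ∀ i, i ∉ S → u i = 0)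
    (hT : ∀ i, i ∉ T → v i = 0) :
    bil (symm G) u v ≤
      2 * (α * β * (K * √(Real.log n) * (S.card * √T.card + T.card * √S.card))) := by
  have h1 := hG.bil_le hα hβ hu hv hS hT
  have h2 := hG.bil_le hβ hα hv hu hT hS
  have h3 : bil G v u ≤ α * β * (K * √(Real.log n) * (S.card * √T.card + T.card * √S.card)) := by
    refine h2.trans (le_of_eq ?_)
    ring
  have h0 : 0 ≤ α * β * (K * √(Real.log n) * (S.card * √T.card + T.card * √S.card)) := by
    positivity
  rw [bil_symm]
  calc 1 / √2 * (bil G u v + bil G v u) ≤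
      1 / √2 * (2 * (α * β * (K * √(Real.log n) * (S.card * √T.card + T.card * √S.card)))) := by
        gcongr
        linarith
    _ ≤ 1 * (2 * (α * β * (K * √(Real.log n) * (S.card * √T.card + T.card * √S.card)))) := by
        gcongr
        exact one_div_sqrt_two_le
    _ = _ := one_mul _

/-- The sharp bound for the interaction of a sparse vector with a vector supported off it. -/
lemma bil_symm_le_of_bounds {K p q : ℝ} (hK : 0 ≤ K) (hpq : p.HolderConjugate q)
    {G : Matrix (Fin n) (Fin n) ℝ} (hn : 1 ≤ n) (hG : SignBound K G) (hG2 : ColumnBound q K G)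
    {y z : Fin n → ℝ} (hy : ∀ i, |y i| ≤ 1) (S : Finset (Fin n)) (hS : ∀ i, i ∉ S → y i = 0)
    (hz : ∀ i, i ∈ S → z i = 0) :
    bil (symm G) y z ≤ ellpNorm p z * (√(∑ i, y i ^ 2) *
      ((n * absMoment q) ^ (1 / q) + K * √S.card * √(Real.log n)) + 4 * K * √(Real.log n)) := by
  have hp0 : 0 < p := hpq.pos
  have hq0 : 0 < q := hpq.symm.pos
  have hμ := absMoment_pos hq0
  have hn1 : (1 : ℝ) ≤ n := by exact_mod_cast hn
  have hn0 : (0 : ℝ) < n := by linarith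
  have hZ0 := ellpNorm_nonneg p z
  choose m hm1 hm2 hm3 hm4 using fun i => exists_int_round (n ^ 2) (hy i)
  have hcast : ((n ^ 2 : ℕ) : ℝ) = (n : ℝ) ^ 2 := by push_cast; rfl
  rw [hcast] at hm2 hm3
  set y' : Fin n → ℝ := fun i => ((n : ℝ) ^ 2)⁻¹ * m i with hy'
  have hsplit : bil (symm G) y z = bil (symm G) y' z + bil (symm G) (y - y') z := by
    rw [← bil_add_left, add_sub_cancel]
  have hcol := hG2 m hm1
  -- Erasing the columns in the support of `m` is harmless, since that support lies in `S`, where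
  -- `z` vanishes.
  set c : Fin n → ℝ := fun j => if m j = 0 then ∑ i, m i * symm G i j else 0 with hc
  have hcq : ellpNorm q c = (∑ j with m j = 0, |∑ i, m i * symm G i j| ^ q) ^ (1 / q) := by
    rw [ellpNorm, Finset.sum_filter]
    congr 1
    refine Finset.sum_congr rfl fun j _ => ?_
    simp only [hc]
    split_ifs
    · rfl
    · simp [Real.zero_rpow hq0.ne']
  have hfirst : bil (symm G) y' z = ((n : ℝ) ^ 2)⁻¹ * ∑ j, z j * c j := by
    rw [bil_eq_sum_right, Finset.mul_sum]
    refine Finset.sum_congr rfl fun j _ => ?_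
    by_cases hj : m j = 0
    · simp only [hc, hj, if_true, hy', Finset.mul_sum]
      refine Finset.sum_congr rfl fun i _ => ?_
      ring
    · have hjS : j ∈ S := by
        by_contra h
        exact hj (hm4 j (hS j h))
      rw [hz j hjS]
      simp
  have hsupp : suppCard m ≤ S.card := by
    apply Finset.card_le_card
    intro i hi
    by_contra h
    exact (Finset.mem_filter.1 hi).2 (hm4 i (hS i h))
  have hm_norm : √(∑ i, (m i : ℝ) ^ 2) ≤ (n : ℝ) ^ 2 * √(∑ i, y i ^ 2) := by
    rw [← Real.sqrt_sq (show (0 : ℝ) ≤ (n : ℝ) ^ 2 by positivity), ← Real.sqrt_mul (by positivity),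
      Finset.mul_sum]
    apply Real.sqrt_le_sqrt
    refine Finset.sum_le_sum fun i _ => ?_
    rw [← sq_abs, ← sq_abs (y i), ← mul_pow]
    gcongr
    exact hm2 i
  have h1 : bil (symm G) y' z ≤ ellpNorm p z * (√(∑ i, y i ^ 2) *
      ((n * absMoment q) ^ (1 / q) + K * √S.card * √(Real.log n))) := by
    rw [hfirst]
    calc ((n : ℝ) ^ 2)⁻¹ * ∑ j, z j * c j ≤ ((n : ℝ) ^ 2)⁻¹ * (ellpNorm p z * ellpNorm q c) := by
          gcongr
          exact sum_mul_le_ellpNorm hpq z c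
      _ ≤ ((n : ℝ) ^ 2)⁻¹ * (ellpNorm p z * (((n : ℝ) ^ 2 * √(∑ i, y i ^ 2)) *
          ((n * absMoment q) ^ (1 / q) + K * √S.card * √(Real.log n)))) := by
          rw [hcq]
          have h0 : 0 ≤ (n * absMoment q) ^ (1 / q) + K * √(suppCard m) * √(Real.log n) := by
            positivity
          gcongr
          refine hcol.trans ?_
          gcongr
      _ = _ := by field_simp
  have hdiff : ∀ i, |(y - y') i| ≤ ((n : ℝ) ^ 2)⁻¹ := by
    intro i
    have : (y - y') i = ((n : ℝ) ^ 2)⁻¹ * ((n : ℝ) ^ 2 * y i - m i) := by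
      simp only [Pi.sub_apply, hy']
      field_simp
    rw [this, abs_mul, abs_of_pos (by positivity)]
    exact mul_le_of_le_one_right (by positivity) (hm3 i)
  -- The crude sign bound on full supports costs a multiple of `n √n`, absorbed by the rounding
  -- precision `n^{-2}`.
  have h2 : bil (symm G) (y - y') z ≤ ellpNorm p z * (4 * K * √(Real.log n)) := by
    refine (hG.bil_symm_le hK (S := Finset.univ) (T := Finset.univ) (by positivity) hZ0 hdiff
      (abs_le_ellpNorm hp0 z) (by simp) (by simp)).trans ?_
    simp only [Finset.card_univ, Fintype.card_fin]
    have hsq : (n : ℝ) * √n ≤ (n : ℝ) ^ 2 := by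
      rw [sq]
      gcongr
      exact Real.sqrt_le_iff.2 ⟨hn0.le, by nlinarith⟩
    calc 2 * (((n : ℝ) ^ 2)⁻¹ * ellpNorm p z * (K * √(Real.log n) * (n * √n + n * √n)))
        = (4 * K * √(Real.log n)) * ellpNorm p z * (((n : ℝ) ^ 2)⁻¹ * (n * √n)) := by ring
      _ ≤ (4 * K * √(Real.log n)) * ellpNorm p z * (((n : ℝ) ^ 2)⁻¹ * (n : ℝ) ^ 2) := by gcongr
      _ = _ := by field_simp
  rw [hsplit, mul_add]
  exact add_le_add h1 h2

/-- The column norms of the symmetrized matrix. -/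
lemma ellpNorm_symm_row_le {K q : ℝ} (hK : 0 ≤ K) (hq : 1 ≤ q) (hn : 1 ≤ n)
    {G : Matrix (Fin n) (Fin n) ℝ} (hG : SignBound K G) (hG2 : ColumnBound q K G) (i : Fin n) :
    ellpNorm q (symm G i) ≤ (n * absMoment q) ^ (1 / q) + 5 * K * √(Real.log n) := by
  have hq0 : 0 < q := by linarith
  -- `ColumnBound` at `e_i` controls row `i` off the diagonal; the diagonal entry comes from
  -- `SignBound` applied to `± e_i` and `e_i`.
  have hcol := hG2 (Pi.single i 1) (by
    intro j
    have : (1 : ℤ) ≤ (n ^ 2 : ℕ) := by exact_mod_cast Nat.one_le_pow _ _ hn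
    rw [Finset.mem_Icc]
    by_cases hj : j = i
    · subst hj
      simp only [Pi.single_eq_same]
      omega
    · simp only [Pi.single_eq_of_ne hj]
      omega)
  have hcard : suppCard (Pi.single i 1 : Fin n → ℤ) = 1 := by
    rw [suppCard, Finset.card_eq_one]
    refine ⟨i, ?_⟩
    ext j
    by_cases hj : j = i
    · subst hj
      simp
    · simp [hj]
  have hsum : ∀ j, ∑ k, ((Pi.single i 1 : Fin n → ℤ) k : ℝ) * symm G k j = symm G i j := by
    intro j
    rw [Finset.sum_eq_single i]
    · simp
    · intro k _ hk
      simp [hk]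
    · simp
  have hsq : ∑ k, ((Pi.single i 1 : Fin n → ℤ) k : ℝ) ^ 2 = 1 := by
    rw [Finset.sum_eq_single i]
    · simp
    · intro k _ hk
      simp [hk]
    · simp
  simp_rw [hsum] at hcol
  rw [hsq, hcard, Nat.cast_one, Real.sqrt_one, one_mul, mul_one] at hcol
  set w₁ : Fin n → ℝ := fun j => if (Pi.single i 1 : Fin n → ℤ) j = 0 then symm G i j else 0
    with hw₁
  have hw : symm G i = w₁ + symm G i i • basisVec i := by
    ext j
    by_cases hj : j = i
    · subst hj
      simp [hw₁, basisVec]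
    · simp [hw₁, basisVec, hj]
  have h1 : ellpNorm q w₁ ≤ (n * absMoment q) ^ (1 / q) + K * √(Real.log n) := by
    refine le_trans (le_of_eq ?_) hcol
    rw [ellpNorm, Finset.sum_filter]
    congr 1
    refine Finset.sum_congr rfl fun j _ => ?_
    simp only [hw₁]
    split_ifs
    · rfl
    · simp [Real.zero_rpow hq0.ne']
  have hbil : ∀ c : ℝ, bil (symm G) (Pi.single i c) (Pi.single i 1) = c * symm G i i := by
    intro c
    rw [bil, Finset.sum_eq_single i, Finset.sum_eq_single i]
    · simp
    · intro k _ hk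
      simp [hk]
    · simp
    · intro k _ hk
      simp [hk]
    · simp
  have habs : ∀ c : ℝ, |c| ≤ 1 → ∀ j, |(Pi.single i c : Fin n → ℝ) j| ≤ 1 := by
    intro c hc j
    by_cases hj : j = i
    · subst hj
      simpa using hc
    · simp [hj]
  have hdiag : ∀ c : ℝ, |c| ≤ 1 → c * symm G i i ≤ 4 * K * √(Real.log n) := by
    intro c hc
    rw [← hbil]
    refine (hG.bil_symm_le hK (S := {i}) (T := {i}) zero_le_one zero_le_one (habs c hc)
      (habs 1 (by simp)) ?_ ?_).trans (le_of_eq ?_)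
    · intro j hj
      simp [Finset.notMem_singleton.1 hj]
    · intro j hj
      simp [Finset.notMem_singleton.1 hj]
    · simp
      ring
  have h2 : |symm G i i| ≤ 4 * K * √(Real.log n) := by
    rw [abs_le]
    have h3 := hdiag 1 (by simp)
    have h4 := hdiag (-1) (by simp)
    constructor <;> linarith
  rw [hw]
  refine (ellpNorm_add_le hq _ _).trans ?_
  rw [ellpNorm_smul hq0, ellpNorm_basisVec hq0, mul_one]
  linarith

end ColumnEstimate

/-! ### The scalar optimization problem -/

section Optimization

variable {p : ℝ}

/-- Writing `t ^ p = t * t ^ (p - 1)` shows that the difference quotients of `t ^ p` at `c` are at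
least `c ^ (p - 1) ≥ 1 / 2` on either side. -/
lemma abs_sub_le_two_mul_abs_rpow_sub (hp1 : 1 < p) (hp2 : p < 2) {c Z : ℝ} (hc : 1 / 2 ≤ c)
    (hc1 : c ≤ 1) (hZ : 0 ≤ Z) : |Z - c| ≤ 2 * |Z ^ p - c ^ p| := by
  have hc0 : 0 < c := by linarith
  have hcp : 1 / 2 ≤ c ^ (p - 1) := by
    refine hc.trans ?_
    conv_lhs => rw [← Real.rpow_one c]
    exact Real.rpow_le_rpow_of_exponent_ge hc0 hc1 (by linarith)
  have e : ∀ t : ℝ, 0 ≤ t → t ^ p = t * t ^ (p - 1) := by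
    intro t ht
    have : p = 1 + (p - 1) := by ring
    conv_lhs => rw [this]
    rw [Real.rpow_add_of_nonneg ht zero_le_one (by linarith), Real.rpow_one]
  rw [e Z hZ, e c hc0.le]
  rcases le_total c Z with h | h
  · have h1 : c ^ (p - 1) ≤ Z ^ (p - 1) := Real.rpow_le_rpow hc0.le h (by linarith)
    have h2 : (Z - c) * (1 / 2) ≤ Z * Z ^ (p - 1) - c * c ^ (p - 1) := by nlinarith
    rw [abs_of_nonneg (by linarith)]
    linarith [le_abs_self (Z * Z ^ (p - 1) - c * c ^ (p - 1))]
  · have h1 : Z ^ (p - 1) ≤ c ^ (p - 1) := Real.rpow_le_rpow hZ h (by linarith)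
    have h2 : (c - Z) * (1 / 2) ≤ c * c ^ (p - 1) - Z * Z ^ (p - 1) := by nlinarith
    rw [abs_of_nonpos (by linarith)]
    linarith [neg_abs_le (Z * Z ^ (p - 1) - c * c ^ (p - 1))]

/-- Near-optimality in the scalar optimization problem forces the extremal configuration. -/
lemma scalar_stability (hp1 : 1 < p) (hp2 : p < 2) {a m W Z b η : ℝ} (ha0 : 0 ≤ a)
    (ha1 : a ≤ 1) (hm : 0 ≤ m) (hW : 0 ≤ W) (hZ : 0 ≤ Z) (hZp : Z ^ p = 1 - a) (hma : m ^ p ≤ a)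
    (hWm : W ^ 2 ≤ m ^ (2 - p) * a) (hb : 0 < b) (hbp : b ^ p = 1 / 4) (hη0 : 0 ≤ η)
    (hη1 : η < 1) (h : b * (1 - η) ≤ Z * W) :
    (a - 1 / 2) ^ 2 ≤ η ∧ a - m ^ p ≤ 4 / (2 - p) * η ∧ m * Z ≤ b := by
  have hp0 : 0 < p := by linarith
  have h2p : 0 < 2 - p := by linarith
  have hZW : 0 < Z * W := lt_of_lt_of_le (mul_pos hb (by linarith)) h
  have hW0 : 0 < W := pos_of_mul_pos_right hZW hZ
  have hapos : 0 < a := by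
    rcases ha0.eq_or_lt with h0 | h0
    · rw [← h0, mul_zero] at hWm
      have : 0 < W ^ 2 := by positivity
      linarith
    · exact h0
  set θ : ℝ := (2 - p) / 2 with hθ
  have hθ0 : 0 < θ := by positivity
  -- `r` measures how much of the mass of `y` its largest coordinate carries. It is kept as a factor
  -- in `(Z W) ^ p ≤ r ^ θ · a (1 - a)`, so that near-equality forces both `r` near `1` and `a` near
  -- `1/2`.
  set r : ℝ := m ^ p / a with hr
  have hr0 : 0 ≤ r := by positivity
  have hr1 : r ≤ 1 := (div_le_one hapos).2 hma
  have hWp : W ^ p ≤ r ^ θ * a := by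
    calc W ^ p = (W ^ 2) ^ (p / 2) := by
          rw [← Real.rpow_natCast, ← Real.rpow_mul hW]
          congr 1
          push_cast
          ring
      _ ≤ (m ^ (2 - p) * a) ^ (p / 2) := by gcongr
      _ = (m ^ p) ^ θ * a ^ (p / 2) := by
          rw [Real.mul_rpow (by positivity) ha0, ← Real.rpow_mul hm, ← Real.rpow_mul hm, hθ]
          congr 2
          ring
      _ = r ^ θ * a := by
          rw [hr, Real.div_rpow (by positivity) ha0]
          have : a ^ θ * a ^ (p / 2) = a := by
            rw [← Real.rpow_add hapos, hθ]
            ring_nf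
            exact Real.rpow_one a
          have haθ : 0 < a ^ θ := by positivity
          rw [eq_comm, div_mul_eq_mul_div, div_eq_iff haθ.ne', mul_assoc]
          congr 1
          rw [mul_comm]
          exact this.symm
  have hrθ : r ^ θ ≤ 1 := Real.rpow_le_one hr0 hr1 hθ0.le
  have hmain : 1 / 4 * (1 - η) ^ p ≤ r ^ θ * (a * (1 - a)) := by
    calc 1 / 4 * (1 - η) ^ p = (b * (1 - η)) ^ p := by
          rw [Real.mul_rpow hb.le (by linarith), hbp]
      _ ≤ (Z * W) ^ p := Real.rpow_le_rpow (mul_nonneg hb.le (by linarith)) h hp0.le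
      _ = (1 - a) * W ^ p := by rw [Real.mul_rpow hZ hW, hZp]
      _ ≤ (1 - a) * (r ^ θ * a) := mul_le_mul_of_nonneg_left hWp (by linarith)
      _ = _ := by ring
  have hbern : 1 - 2 * η ≤ (1 - η) ^ p := by
    have := one_add_mul_self_le_rpow_one_add (s := -η) (by linarith) hp1.le
    rw [← sub_eq_add_neg] at this
    nlinarith
  have haa : 0 ≤ a * (1 - a) := mul_nonneg ha0 (by linarith)
  have haa4 : a * (1 - a) ≤ 1 / 4 := by nlinarith [sq_nonneg (a - 1 / 2)]
  refine ⟨?_, ?_, ?_⟩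
  · have : r ^ θ * (a * (1 - a)) ≤ a * (1 - a) := mul_le_of_le_one_left haa hrθ
    nlinarith
  · have h1 : (1 - η) ^ p ≤ r ^ θ := by
      have : r ^ θ * (a * (1 - a)) ≤ r ^ θ * (1 / 4) :=
        mul_le_mul_of_nonneg_left haa4 (by positivity)
      linarith
    have h2 : (1 - η) ^ (p / θ) ≤ r := by
      calc (1 - η) ^ (p / θ) = ((1 - η) ^ p) ^ (1 / θ) := by
            rw [← Real.rpow_mul (by linarith)]
            congr 1
            ring
        _ ≤ (r ^ θ) ^ (1 / θ) := by
            have : 0 ≤ (1 - η) ^ p := Real.rpow_nonneg (by linarith) _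
            gcongr
        _ = r := by rw [← Real.rpow_mul hr0, mul_one_div_cancel hθ0.ne', Real.rpow_one]
    have h3 : 1 ≤ p / θ := by
      rw [le_div_iff₀ hθ0, hθ]
      linarith
    have h4 := one_add_mul_self_le_rpow_one_add (s := -η) (by linarith) h3
    rw [← sub_eq_add_neg] at h4
    have h5 : p / θ ≤ 4 / (2 - p) := by
      rw [hθ, div_div_eq_mul_div]
      gcongr
      linarith
    have h6 : 1 - r ≤ 4 / (2 - p) * η := by
      have : p / θ * η ≤ 4 / (2 - p) * η := by gcongr
      linarith
    have h7 : a - m ^ p = a * (1 - r) := by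
      rw [hr]
      field_simp
    rw [h7]
    calc a * (1 - r) ≤ 1 * (1 - r) := by
          apply mul_le_mul_of_nonneg_right ha1
          linarith
      _ ≤ _ := by linarith
  · rw [← Real.rpow_le_rpow_iff (mul_nonneg hm hZ) hb.le hp0, Real.mul_rpow hm hZ, hZp, hbp]
    calc m ^ p * (1 - a) ≤ a * (1 - a) := mul_le_mul_of_nonneg_right hma (by linarith)
      _ ≤ 1 / 4 := haa4

end Optimization

/-! ### Disjoint supports, distance to the near optimizers -/

section Decomposition

variable {n : ℕ}

lemma sum_abs_rpow_add_of_disjoint {p : ℝ} (hp : 0 < p) {x y z : Fin n → ℝ} (hxyz : x = y + z)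
    (S : Finset (Fin n)) (hy : ∀ i, i ∉ S → y i = 0) (hz : ∀ i, i ∈ S → z i = 0) :
    ∑ i, |x i| ^ p = ∑ i, |y i| ^ p + ∑ i, |z i| ^ p := by
  rw [← Finset.sum_add_distrib]
  refine Finset.sum_congr rfl fun i _ => ?_
  by_cases hi : i ∈ S
  · simp [hxyz, hz i hi, Real.zero_rpow hp.ne']
  · simp [hxyz, hy i hi, Real.zero_rpow hp.ne']

lemma sum_sq_le_rpow_mul {p : ℝ} (hp2 : p < 2) (hp0 : 0 < p) {y : Fin n → ℝ} {m : ℝ}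
    (hm : ∀ i, |y i| ≤ m) : ∑ i, y i ^ 2 ≤ m ^ (2 - p) * ∑ i, |y i| ^ p := by
  rw [Finset.mul_sum]
  refine Finset.sum_le_sum fun i _ => ?_
  calc y i ^ 2 = |y i| ^ (2 - p) * |y i| ^ p := by
        rw [← Real.rpow_add_of_nonneg (abs_nonneg _) (by linarith) hp0.le, sub_add_cancel]
        simp
    _ ≤ m ^ (2 - p) * |y i| ^ p := by
        gcongr
        exact hm i

lemma ellpDist_le {p : ℝ} (x : Fin n → ℝ) {S : Set (Fin n → ℝ)} {y : Fin n → ℝ} (hy : y ∈ S) :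
    ellpDist p x S ≤ ellpNorm p (x - y) := by
  apply csInf_le
  · refine ⟨0, ?_⟩
    rintro _ ⟨w, _, rfl⟩
    exact ellpNorm_nonneg p _
  · exact ⟨y, hy, rfl⟩

/-- Normalizing an approximation of a unit vector at most doubles the error. -/
lemma ellpNorm_sub_normalize_le {p : ℝ} (hp : 1 ≤ p) {x u : Fin n → ℝ} (hx : ellpNorm p x = 1)
    {c ε : ℝ} (hc : 0 ≤ c) (hε : ε < 1) (h : ellpNorm p (x - c • u) ≤ ε) :
    ellpNorm p (x - (1 / ellpNorm p u) • u) ≤ 2 * ε := by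
  have hp0 : 0 < p := by linarith
  set N := ellpNorm p u with hN
  have hN0 : 0 ≤ N := ellpNorm_nonneg p u
  have h1 : 1 ≤ ε + c * N := by
    have := ellpNorm_add_le hp (x - c • u) (c • u)
    rw [sub_add_cancel, hx, ellpNorm_smul hp0, abs_of_nonneg hc] at this
    linarith
  have h2 : c * N ≤ 1 + ε := by
    have := ellpNorm_add_le hp x (-(x - c • u))
    rw [ellpNorm_neg, hx, show x + -(x - c • u) = c • u by abel, ellpNorm_smul hp0,
      abs_of_nonneg hc] at this
    linarith
  have hNpos : 0 < N := by
    rcases hN0.eq_or_lt with h0 | h0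
    · rw [← h0] at h1
      linarith
    · exact h0
  have hsplit : x - (1 / N) • u = (x - c • u) + (c - 1 / N) • u := by
    rw [sub_smul]
    abel
  rw [hsplit]
  refine (ellpNorm_add_le hp _ _).trans ?_
  rw [ellpNorm_smul hp0, ← hN]
  have h3 : |c - 1 / N| * N = |c * N - 1| := by
    rw [← abs_of_pos hNpos, ← abs_mul, abs_of_pos hNpos, sub_mul, one_div_mul_cancel hNpos.ne']
  rw [h3]
  have h4 : |c * N - 1| ≤ ε := by
    rw [abs_le]
    constructor <;> linarith
  linarith

lemma ellpNorm_dualVec {p q : ℝ} (hp : 0 < p) (hq : 0 < q) {w : Fin n → ℝ}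
    (hw : 0 < ellpNorm q w) : ellpNorm p (dualVec p q w) = 1 := by
  have : ∑ j, |dualVec p q w j| ^ p = 1 := by
    have h1 : ∀ j, |dualVec p q w j| ^ p = |w j| ^ q / ellpNorm q w ^ q := by
      intro j
      rw [dualVec, abs_mul, abs_sgn, one_mul, abs_of_nonneg (by positivity),
        ← Real.rpow_mul (by positivity), one_div_mul_cancel hp.ne', Real.rpow_one]
    simp_rw [h1]
    rw [← Finset.sum_div, ← ellpNorm_rpow hq, div_self (by positivity)]
  rw [ellpNorm, this, Real.one_rpow]

lemma symm_mulVec_basisVec (G : Matrix (Fin n) (Fin n) ℝ) (i : Fin n) :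
    symm G *ᵥ basisVec i = symm G i := by
  have h : ∀ j, symm G j i = symm G i j := by
    intro j
    simp [symm, add_comm]
  ext j
  simp [basisVec, h]

lemma v_eq_dualVec (p : ℝ) (G : Matrix (Fin n) (Fin n) ℝ) (i : Fin n) :
    v p G i = dualVec p (Real.conjExponent p) (symm G i) := by
  ext j
  simp only [v, dualVec, symm_mulVec_basisVec]

lemma ellpDist_nearOptimizers_le {p : ℝ} (hp : 1 ≤ p) {x : Fin n → ℝ} (hx : ellpNorm p x = 1)
    (G : Matrix (Fin n) (Fin n) ℝ) (i : Fin n) {σ c ε : ℝ} (hσ : |σ| = 1) (hc : 0 ≤ c)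
    (hε : ε < 1) (h : ellpNorm p (x - (c * σ) • (basisVec i + v p G i)) ≤ ε) :
    ellpDist p x (nearOptimizers p G) ≤ 2 * ε := by
  set u := basisVec i + v p G i with hu
  have hsu : ellpNorm p (σ • u) = ellpNorm p u := by
    rw [ellpNorm_smul (by linarith), hσ, one_mul]
  rw [mul_smul] at h
  have h1 := ellpNorm_sub_normalize_le hp hx hc hε h
  rw [hsu] at h1
  refine le_trans (ellpDist_le x ⟨i, ?_⟩) h1
  rcases (abs_eq zero_le_one).1 hσ with rfl | rfl
  · left
    rw [one_smul]
  · right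
    rw [neg_one_smul, smul_neg]

end Decomposition

/-! ### Deterministic stability on the good event -/

section Assembly

variable {n : ℕ} {p q : ℝ}

/-- The constant in the distance bound. -/
noncomputable def stabilityConst (p : ℝ) : ℝ :=
  √(4 / (2 - p)) + 4 + 2 * (4 / (2 - p)) + 4 * √((1 + 4 * √(4 / (2 - p))) / (p - 1))

/-- Cutting `x` at the dyadic threshold leaves only the cross term at leading order. The last clause
is stated for every `u` supported in `S` because it is needed twice: for `y` itself and for `y`
without its largest coordinate. -/
lemma exists_sparse_decomposition {K : ℝ} (hp1 : 1 < p) (hp2 : p < 2)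
    (hpq : p.HolderConjugate q) (hK : 0 ≤ K) (hn : 1 ≤ n) {G : Matrix (Fin n) (Fin n) ℝ}
    (hG : SignBound K G) (hG2 : ColumnBound q K G) {x : Fin n → ℝ} (hx : ellpNorm p x = 1) :
    ∃ (y z : Fin n → ℝ) (S : Finset (Fin n)), x = y + z ∧ (∀ i, i ∉ S → y i = 0) ∧
      (∀ i, i ∈ S → z i = 0) ∧ (∀ i, |y i| ≤ 1) ∧
      bil G x x ≤ 4 * dyadicConst p * K * ((n : ℝ) ^ ((p - 1) / 2) * √(Real.log n)) +
        √2 * bil (symm G) y z ∧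
      ∀ u : Fin n → ℝ, (∀ i, |u i| ≤ 1) → (∀ i, i ∉ S → u i = 0) → √(∑ i, u i ^ 2) ≤ 1 →
        bil (symm G) u z ≤ ellpNorm p z * √(∑ i, u i ^ 2) * (n * absMoment q) ^ (1 / q) +
          6 * K * ((n : ℝ) ^ ((p - 1) / 2) * √(Real.log n)) := by
  have hp0 : 0 < p := by linarith
  have hn1 : (1 : ℝ) ≤ n := by exact_mod_cast hn
  have hn0 : (0 : ℝ) < n := by linarith
  have hD := dyadicConst_pos hp1 hp2
  obtain ⟨k, L, hkL, hL, hs1, hs2, hs3⟩ := exists_dyadic_scales hp1 hp2 hn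
  have hxsum : ∑ i, |x i| ^ p = 1 := by rw [← ellpNorm_rpow hp0, hx, Real.one_rpow]
  have hx1 : ∀ i, |x i| ≤ 1 := fun i => hx ▸ abs_le_ellpNorm hp0 x i
  set X := (n : ℝ) ^ ((p - 1) / 2) with hX
  have hX1 : 1 ≤ X := Real.one_le_rpow hn1 (by linarith)
  set Λ := √(Real.log n) with hΛ
  have hΛ0 : 0 ≤ Λ := Real.sqrt_nonneg _
  set z := trunc x ((1 / 2) ^ k) with hz
  set y := x - z with hy
  have hyz : x = y + z := by rw [hy, sub_add_cancel]
  set S := bigSet x ((1 / 2) ^ k) with hS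
  have hyS : ∀ i, i ∉ S → y i = 0 := by
    intro i hi
    have : |x i| ≤ (1 / 2) ^ k := not_lt.1 fun h => hi (by simpa [hS, bigSet] using h)
    simp only [hy, hz, Pi.sub_apply, trunc, if_pos this, sub_self]
  have hzS : ∀ i, i ∈ S → z i = 0 := by
    intro i hi
    have : (1 / 2) ^ k < |x i| := by simpa only [hS, bigSet, Finset.mem_filter_univ] using hi
    simp only [hz, trunc, if_neg (not_le.2 this)]
  have hy1 : ∀ i, |y i| ≤ 1 := by
    intro i
    simp only [hy, hz, Pi.sub_apply, trunc]
    split_ifs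
    · simp
    · simpa using hx1 i
  have hscard : √S.card ≤ 2 * X := by
    have h1 : (S.card : ℝ) ≤ 4 * (n : ℝ) ^ (p - 1) := (card_bigSet_le hp0 hxsum.le k).trans hs3
    apply Real.sqrt_le_iff.2
    refine ⟨by positivity, h1.trans (le_of_eq ?_)⟩
    rw [mul_pow, hX, ← Real.rpow_natCast, ← Real.rpow_natCast, ← Real.rpow_mul hn0.le]
    congr 1
    · norm_num
    · congr 1
      push_cast
      ring
  refine ⟨y, z, S, hyz, hyS, hzS, hy1, ?_, ?_⟩
  · have h1 := hG.bil_big_le hK hp1 hp2 hxsum.le hx1 k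
    have h2 := hG.bil_small_le hK hp1 hp2 hxsum.le hkL hL
    have h3 : dyadicConst p * (K * Λ) * (2 ^ (p - 1)) ^ k ≤ dyadicConst p * (K * Λ) * (2 * X) := by
      gcongr
    have h4 : dyadicConst p * (K * Λ) * ((2 ^ (p - 1)) ^ L * (2 ^ (p / 2 - 1)) ^ k) ≤
        dyadicConst p * (K * Λ) * (2 * X) := by
      gcongr
    have h5 : bil G x x = bil G y y + bil G z z + √2 * bil (symm G) y z := by
      rw [bil_symm, ← mul_assoc, mul_one_div_cancel (by positivity), one_mul]
      conv_lhs => rw [hyz]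
      rw [bil_add_left, bil_add_right, bil_add_right]
      ring
    rw [h5]
    have h6 : bil G y y ≤ dyadicConst p * (K * Λ) * (2 * X) := h1.trans h3
    have h7 : bil G z z ≤ dyadicConst p * (K * Λ) * (2 * X) := h2.trans h4
    linarith
  · intro u hu huS hu1
    refine (bil_symm_le_of_bounds hK hpq hn hG hG2 hu S huS hzS).trans ?_
    have hZ0 := ellpNorm_nonneg p z
    have hZ1 : ellpNorm p z ≤ 1 := by
      apply ellpNorm_le_of_sum_le hp0 zero_le_one
      rw [Real.one_rpow, ← hxsum, sum_abs_rpow_add_of_disjoint hp0 hyz S hyS hzS]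
      have : 0 ≤ ∑ i, |y i| ^ p := Finset.sum_nonneg fun _ _ => by positivity
      linarith
    set Z := ellpNorm p z
    set T := √(∑ i, u i ^ 2)
    set N := (n * absMoment q) ^ (1 / q)
    have hT0 : 0 ≤ T := Real.sqrt_nonneg _
    have h1 : Z * T ≤ 1 := mul_le_one₀ hZ1 hT0 hu1
    have h2 : Z * T * (K * √S.card * Λ) ≤ 1 * (K * (2 * X) * Λ) :=
      mul_le_mul h1
        (mul_le_mul_of_nonneg_right (mul_le_mul_of_nonneg_left hscard hK) hΛ0)
        (mul_nonneg (mul_nonneg hK (Real.sqrt_nonneg _)) hΛ0) zero_le_one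
    have h3 : Z * (4 * K * Λ) ≤ 1 * (4 * K * (X * Λ)) := by
      gcongr
      exact le_mul_of_one_le_left hΛ0 hX1
    calc Z * (T * (N + K * √S.card * Λ) + 4 * K * Λ)
        = Z * T * N + Z * T * (K * √S.card * Λ) + Z * (4 * K * Λ) := by ring
      _ ≤ Z * T * N + 1 * (K * (2 * X) * Λ) + 1 * (4 * K * (X * Λ)) := by gcongr
      _ = _ := by ring

lemma two_rpow_neg_facts (hp1 : 1 < p) (hp2 : p < 2) :
    ((2 : ℝ) ^ (-(1 / p))) ^ p = 1 / 2 ∧ 1 / 2 ≤ (2 : ℝ) ^ (-(1 / p)) ∧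
      (2 : ℝ) ^ (-(1 / p)) ≤ 1 := by
  have hp0 : 0 < p := by linarith
  refine ⟨?_, ?_, ?_⟩
  · rw [← Real.rpow_mul (by norm_num), neg_mul, one_div_mul_cancel hp0.ne']
    norm_num
  · have h : (1 / 2 : ℝ) = 2 ^ (-1 : ℝ) := by norm_num
    rw [h]
    apply Real.rpow_le_rpow_of_exponent_le (by norm_num)
    have : 1 / p ≤ 1 := (div_le_one hp0).2 hp1.le
    linarith
  · exact Real.rpow_le_one_of_one_le_of_nonpos one_le_two (neg_nonpos.2 (by positivity))

set_option maxHeartbeats 1000000 in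
-- A deficit `τ⁴` leaves `O(τ²)` for the `ℓ_2`-norm of `y` off its main coordinate; this turns into
-- a Hölder deficit `O(τ²)` for `z`, hence a distance `O(τ)`. The `40 K` in the hypothesis is a
-- reserve for the lower-order errors met on the way.
lemma exists_close_of_large {K : ℝ} (hp1 : 1 < p) (hp2 : p < 2)
    (hpq : p.HolderConjugate q) (hK : 0 < K) (hn : 2 ≤ n) {G : Matrix (Fin n) (Fin n) ℝ}
    (hG : SignBound K G) (hG2 : ColumnBound q K G) {x : Fin n → ℝ} (hx : ellpNorm p x = 1)
    {τ : ℝ} (hτ0 : 0 ≤ τ) (hτ1 : τ < 1) (hτ2 : (1 + 4 * √(4 / (2 - p))) * τ ^ 2 ≤ 1)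
    (hlarge : √2 * ((2 : ℝ) ^ (-(1 / p))) ^ 2 * (1 - τ ^ 4) * (n * absMoment q) ^ (1 / q) +
      (4 * dyadicConst p * K + 40 * K) * ((n : ℝ) ^ ((p - 1) / 2) * √(Real.log n)) <
        bil G x x) :
    ∃ i, ∃ σ : ℝ, |σ| = 1 ∧ ellpNorm p (x - ((2 : ℝ) ^ (-(1 / p)) * σ) •
      (basisVec i + dualVec p q (symm G i))) ≤ stabilityConst p * τ := by
  have hp0 : 0 < p := by linarith
  have hpm : 0 < p - 1 := by linarith
  have h2p : 0 < 2 - p := by linarith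
  have hq0 : 0 < q := hpq.symm.pos
  have hq1 : 1 ≤ q := hpq.symm.lt.le
  have hn1 : (2 : ℝ) ≤ n := by exact_mod_cast hn
  have hn0 : (0 : ℝ) < n := by linarith
  have hμ := absMoment_pos hq0
  obtain ⟨hcp, hc1, hc2⟩ := two_rpow_neg_facts hp1 hp2
  set c : ℝ := (2 : ℝ) ^ (-(1 / p)) with hc
  have hc0 : 0 < c := by positivity
  set b := c ^ 2 with hb
  have hb0 : 0 < b := by positivity
  have hb1 : b ≤ 1 := pow_le_one₀ hc0.le hc2
  have hb4 : 1 / 4 ≤ b := by rw [hb]; nlinarith only [hc1]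
  have hbp : b ^ p = 1 / 4 := by
    rw [hb, ← Real.rpow_natCast, ← Real.rpow_mul hc0.le, mul_comm, Real.rpow_mul hc0.le, hcp]
    norm_num
  obtain ⟨y, z, S, hxyz, hyS, hzS, hy1, hdec, hcol⟩ :=
    exists_sparse_decomposition hp1 hp2 hpq hK.le (by omega) hG hG2 hx
  set N := (n * absMoment q) ^ (1 / q) with hN
  have hN0 : 0 < N := by positivity
  set E := (n : ℝ) ^ ((p - 1) / 2) * √(Real.log n) with hE
  have hlog : 0 < Real.log n := Real.log_pos (by linarith)
  have hE0 : 0 < E := by positivity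
  have hΛE : √(Real.log n) ≤ E := by
    have : 1 ≤ (n : ℝ) ^ ((p - 1) / 2) := Real.one_le_rpow (by linarith) (by linarith)
    exact le_mul_of_one_le_left (Real.sqrt_nonneg _) this
  have hKE : 0 < K * E := by positivity
  set B := bil (symm G) y z with hB
  have hBlow : b * (1 - τ ^ 4) * N + 20 * (K * E) ≤ B := by
    have h1 : √2 * (b * (1 - τ ^ 4) * N) + 40 * (K * E) < √2 * B := by
      nlinarith only [hlarge, hdec]
    have h2 : √2 ≤ 2 := Real.sqrt_le_iff.2 ⟨by norm_num, by norm_num⟩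
    have h3 : √2 * (20 * (K * E)) ≤ 40 * (K * E) := by nlinarith only [h2, hKE]
    have h4 : √2 * (b * (1 - τ ^ 4) * N + 20 * (K * E)) ≤ √2 * B := by
      rw [mul_add]
      linarith
    exact le_of_mul_le_mul_left h4 (by positivity)
  set Z := ellpNorm p z with hZ
  have hZ0 : 0 ≤ Z := ellpNorm_nonneg p z
  set a := ∑ i, |y i| ^ p with ha
  have ha0 : 0 ≤ a := Finset.sum_nonneg fun _ _ => by positivity
  have hZp : Z ^ p = 1 - a := by
    have h1 := sum_abs_rpow_add_of_disjoint hp0 hxyz S hyS hzS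
    rw [← ellpNorm_rpow hp0 x, hx, Real.one_rpow, ← ellpNorm_rpow hp0 z] at h1
    linarith
  have ha1 : a ≤ 1 := by
    have : 0 ≤ Z ^ p := by positivity
    linarith
  have hZ1 : Z ≤ 1 := by
    rw [← Real.rpow_le_rpow_iff hZ0 zero_le_one hp0, Real.one_rpow]
    linarith
  have : Nonempty (Fin n) := ⟨⟨0, by omega⟩⟩
  obtain ⟨i, hi⟩ := Finite.exists_max (fun i => |y i|)
  set m := |y i| with hm
  have hm0 : 0 ≤ m := abs_nonneg _
  have hma : m ^ p ≤ a := Finset.single_le_sum (f := fun i => |y i| ^ p)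
    (fun _ _ => by positivity) (Finset.mem_univ i)
  set W := √(∑ i, y i ^ 2) with hW
  have hW0 : 0 ≤ W := Real.sqrt_nonneg _
  have hWsq : W ^ 2 = ∑ i, y i ^ 2 := Real.sq_sqrt (Finset.sum_nonneg fun _ _ => sq_nonneg _)
  have hWm : W ^ 2 ≤ m ^ (2 - p) * a := by
    rw [hWsq]
    exact sum_sq_le_rpow_mul hp2 hp0 hi
  have hW1 : W ≤ 1 := by
    have h1 : m ^ (2 - p) ≤ 1 := Real.rpow_le_one hm0 (hy1 i) h2p.le
    have h2 : m ^ (2 - p) * a ≤ 1 := mul_le_one₀ h1 ha0 ha1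
    nlinarith only [h2, hWm, hW0]
  have hτ4 : τ ^ 4 < 1 := pow_lt_one₀ hτ0 hτ1 (by norm_num)
  have hτ42 : τ ^ 4 ≤ τ ^ 2 := pow_le_pow_of_le_one hτ0 hτ1.le (by norm_num)
  have hτ21 : τ ^ 2 ≤ τ := by nlinarith only [hτ0, hτ1]
  have hZW : b * (1 - τ ^ 4) ≤ Z * W := by
    have h1 := hcol y hy1 hyS hW1
    have h2 : b * (1 - τ ^ 4) * N ≤ Z * W * N := by linarith
    exact le_of_mul_le_mul_right h2 hN0
  obtain ⟨hstab1, hstab2, hstab3⟩ := scalar_stability hp1 hp2 ha0 ha1 hm0 hW0 hZ0 hZp hma hWm hb0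
    hbp (by positivity) hτ4 hZW
  have hZWpos : 0 < Z * W := lt_of_lt_of_le (mul_pos hb0 (by linarith)) hZW
  have hZpos : 0 < Z := pos_of_mul_pos_left hZWpos hW0
  have hWpos : 0 < W := pos_of_mul_pos_right hZWpos hZ0
  have hmpos : 0 < m := by
    rcases hm0.eq_or_lt with h | h
    · rw [← h, Real.zero_rpow h2p.ne', zero_mul] at hWm
      have : 0 < W ^ 2 := by positivity
      linarith
    · exact h
  set Bc := 4 / (2 - p) with hBc
  have hBc0 : 0 < Bc := by positivity
  set B1 := 1 + 4 * √Bc with hB1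
  have hB10 : 0 < B1 := by positivity
  set y' : Fin n → ℝ := y - y i • basisVec i with hy'
  have hy'i : y' i = 0 := by simp [hy', basisVec]
  have hy'j : ∀ j, j ≠ i → y' j = y j := fun j hj => by simp [hy', basisVec, hj]
  have hy'1 : ∀ j, |y' j| ≤ 1 := by
    intro j
    by_cases hj : j = i
    · rw [hj, hy'i]
      simp
    · rw [hy'j j hj]
      exact hy1 j
  have hy'S : ∀ j, j ∉ S → y' j = 0 := by
    intro j hjS
    by_cases hj : j = i
    · rw [hj, hy'i]
    · rw [hy'j j hj, hyS j hjS]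
  have hy'sum : ∑ j, |y' j| ^ p ≤ Bc * τ ^ 4 := by
    have h1 : ∑ j, |y' j| ^ p = a - m ^ p := by
      rw [ha, ← Finset.sum_erase_add _ _ (Finset.mem_univ i), hy'i, abs_zero,
        Real.zero_rpow hp0.ne', add_zero,
        ← Finset.sum_erase_add Finset.univ (fun j => |y j| ^ p) (Finset.mem_univ i),
        add_sub_cancel_right]
      refine Finset.sum_congr rfl fun j hj => ?_
      rw [hy'j j (Finset.ne_of_mem_erase hj)]
    rw [h1]
    exact hstab2
  -- `ε²` is the bound for the mass of `y'`. As `ε ≤ 1` and `p < 2`, also `ε² ≤ ε ^ p`, so `ε`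
  -- bounds both the `ℓ_p`- and the `ℓ_2`-norm of `y'`.
  set ε := √Bc * τ ^ 2 with hε
  have hε0 : 0 ≤ ε := by positivity
  have hε1 : ε ≤ 1 := by
    have : B1 * τ ^ 2 = τ ^ 2 + 4 * ε := by rw [hB1, hε]; ring
    nlinarith only [this, hτ2, sq_nonneg τ, hε0]
  have hεsq : ε ^ 2 = Bc * τ ^ 4 := by
    rw [hε, mul_pow, Real.sq_sqrt hBc0.le]
    ring
  have hy'p : ellpNorm p y' ≤ ε := by
    apply ellpNorm_le_of_sum_le hp0 hε0
    refine hy'sum.trans ?_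
    rw [← hεsq, ← Real.rpow_natCast]
    exact Real.rpow_le_rpow_of_exponent_ge_of_imp hε0 hε1 (by push_cast; exact hp2.le)
      (fun _ h => absurd h (by norm_num))
  have hy'2 : √(∑ j, y' j ^ 2) ≤ ε := by
    apply Real.sqrt_le_iff.2
    refine ⟨hε0, ?_⟩
    rw [hεsq]
    refine le_trans ?_ hy'sum
    have := sum_sq_le_rpow_mul hp2 hp0 hy'1
    rwa [Real.one_rpow, one_mul] at this
  set w := symm G i with hw
  set I := ∑ j, w j * z j with hI
  have hBsplit : B = y i * I + bil (symm G) y' z := by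
    have h1 : y = y i • basisVec i + y' := by rw [hy', add_sub_cancel]
    have h2 : bil (symm G) (y i • basisVec i) z = y i * I := by
      rw [bil_eq_sum_left, Finset.sum_eq_single i]
      · simp [basisVec, hI, hw]
      · intro j _ hj
        simp [basisVec, hj]
      · simp
    rw [hB, ← h2, ← bil_add_left, ← h1]
  have hB' : bil (symm G) y' z ≤ ε * N + 6 * (K * E) := by
    have h1 := hcol y' hy'1 hy'S (hy'2.trans hε1)
    have h2 : Z * √(∑ j, y' j ^ 2) * N ≤ 1 * ε * N := by gcongr
    linarith
  set η := B1 * τ ^ 2 with hη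
  have hη0 : 0 ≤ η := by positivity
  -- Of the reserve `20 K E`, the part `y'` uses `6`; its main contribution `ε N` goes into `η`, by
  -- `b ≥ 1/4`.
  have hIlow : b * (1 - η) * N + 14 * (K * E) ≤ y i * I := by
    have h1 : ε ≤ b * (4 * ε) := by nlinarith only [hb4, hε0]
    have h2 : η = τ ^ 2 + 4 * ε := by rw [hη, hB1, hε]; ring
    have h3 : b * (1 - η) ≤ b * (1 - τ ^ 4) - ε := by
      rw [h2]
      nlinarith only [h1, hτ42, hb0]
    have h4 : b * (1 - η) * N ≤ (b * (1 - τ ^ 4) - ε) * N := by gcongr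
    linarith
  have hIpos : 0 < y i * I := by
    have : 0 ≤ b * (1 - η) * N := mul_nonneg (mul_nonneg hb0.le (by linarith)) hN0.le
    linarith
  set Q := ellpNorm q w with hQ
  have hQN : Q ≤ N + 5 * (K * E) := by
    have h1 := ellpNorm_symm_row_le hK.le hq1 (by omega) hG hG2 i
    have h2 : K * √(Real.log n) ≤ K * E := by gcongr
    linarith
  have hQ0 : 0 < Q := by
    rcases (ellpNorm_nonneg q w).eq_or_lt with h | h
    · have hw0 : w = 0 := ellpNorm_eq_zero hq0 h.symm
      simp [hI, hw0] at hIpos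
    · exact h
  -- The remaining reserve covers the excess `5 K E` of the actual row norm `Q` over `N`, so the
  -- deficit becomes relative to `Q` and Hölder stability applies.
  have hIQ : (1 - η) * (m * Z * Q) ≤ y i * I := by
    have h1 : m * Z * Q ≤ b * (N + 5 * (K * E)) := by gcongr
    have h2 : (1 - η) * (m * Z * Q) ≤ (1 - η) * (b * (N + 5 * (K * E))) :=
      mul_le_mul_of_nonneg_left h1 (by linarith)
    have h3 : (1 - η) * (b * (5 * (K * E))) ≤ 1 * (1 * (5 * (K * E))) := by
      gcongr
      linarith
    nlinarith only [h2, h3, hIlow, hKE]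
  set σ := sgn (y i) with hσ
  have hσm : y i = σ * m := (sgn_mul_abs (y i)).symm
  have hσσ : σ * σ = 1 := sgn_mul_self _
  have hσabs : |σ| = 1 := abs_sgn _
  set z' : Fin n → ℝ := (σ / Z) • z with hz'
  have hz'1 : ellpNorm p z' = 1 := by
    rw [hz', ellpNorm_smul hp0, abs_div, hσabs, abs_of_pos hZpos, ← hZ, one_div_mul_cancel hZpos.ne']
  have hz'w : (1 - η) * Q ≤ ∑ j, w j * z' j := by
    have h1 : ∑ j, w j * z' j = σ / Z * I := by
      rw [hI, Finset.mul_sum]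
      refine Finset.sum_congr rfl fun j _ => ?_
      simp only [hz', Pi.smul_apply, smul_eq_mul]
      ring
    rw [h1, div_mul_eq_mul_div, le_div_iff₀ hZpos]
    rw [hσm] at hIQ
    have h2 : m * ((1 - η) * Q * Z) ≤ m * (σ * I) := by linarith
    exact le_of_mul_le_mul_left h2 hmpos
  have hdual := ellpNorm_sub_dualVec_le hp1 hp2 hpq hQ0 hz'1 hη0 hz'w
  have hdual' : 4 * √(η / (p - 1)) = 4 * √(B1 / (p - 1)) * τ := by
    rw [hη, mul_div_right_comm, Real.sqrt_mul (by positivity), Real.sqrt_sq hτ0, mul_assoc]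
  rw [hdual'] at hdual
  have hahalf : |a - 1 / 2| ≤ τ ^ 2 := by
    apply abs_le_of_sq_le_sq _ (by positivity)
    calc (a - 1 / 2) ^ 2 ≤ τ ^ 4 := hstab1
      _ = (τ ^ 2) ^ 2 := by ring
  have hZc : |Z - c| ≤ 2 * τ ^ 2 := by
    refine (abs_sub_le_two_mul_abs_rpow_sub hp1 hp2 hc1 hc2 hZ0).trans ?_
    rw [hZp, hcp, show 1 - a - 1 / 2 = -(a - 1 / 2) by ring, abs_neg]
    linarith
  have hmc : |m - c| ≤ 2 * τ ^ 2 + 2 * (Bc * τ ^ 4) := by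
    refine (abs_sub_le_two_mul_abs_rpow_sub hp1 hp2 hc1 hc2 hm0).trans ?_
    rw [hcp]
    have h1 : |m ^ p - 1 / 2| ≤ τ ^ 2 + Bc * τ ^ 4 := by
      rw [abs_le] at hahalf ⊢
      constructor <;> linarith [hahalf.1, hahalf.2, mul_nonneg hBc0.le (pow_nonneg hτ0 4)]
    linarith
  refine ⟨i, σ, hσabs, ?_⟩
  set u := dualVec p q w with hu
  have hu1 : ellpNorm p u = 1 := ellpNorm_dualVec hp0 hq0 hQ0
  -- Four errors: the discarded part of `y`, the size of its main coordinate, the direction of `z`,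
  -- and the norm of `z`.
  have hdecomp : x - (c * σ) • (basisVec i + u) =
      y' + (σ * (m - c)) • basisVec i + ((σ * Z) • (z' - u) + (σ * (Z - c)) • u) := by
    ext j
    have hzj : z j = (σ * Z) * z' j := by
      simp only [hz', Pi.smul_apply, smul_eq_mul]
      field_simp
      rw [sq, hσσ, mul_one]
    simp only [hxyz, hy', Pi.add_apply, Pi.sub_apply, Pi.smul_apply, smul_eq_mul]
    rw [hzj, hσm]
    ring
  rw [hdecomp]
  have hn1' := ellpNorm_add_le hp1.le (y' + (σ * (m - c)) • basisVec i)
    ((σ * Z) • (z' - u) + (σ * (Z - c)) • u)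
  have hn2' := ellpNorm_add_le hp1.le y' ((σ * (m - c)) • basisVec i)
  have hn3' := ellpNorm_add_le hp1.le ((σ * Z) • (z' - u)) ((σ * (Z - c)) • u)
  rw [ellpNorm_smul hp0, ellpNorm_basisVec hp0, abs_mul, hσabs, one_mul, mul_one] at hn2'
  rw [ellpNorm_smul hp0, ellpNorm_smul hp0, abs_mul, abs_mul, hσabs, hu1, one_mul, one_mul, mul_one,
    abs_of_pos hZpos] at hn3'
  have h1 : Z * ellpNorm p (z' - u) ≤ 1 * (4 * √(B1 / (p - 1)) * τ) := by
    have := ellpNorm_nonneg p (z' - u)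
    gcongr
  have h2 : ε ≤ √Bc * τ := by rw [hε]; gcongr
  have h3 : Bc * τ ^ 4 ≤ Bc * τ := by
    gcongr
    linarith
  have h4 : stabilityConst p * τ = √Bc * τ + 4 * τ + 2 * (Bc * τ) + 4 * √(B1 / (p - 1)) * τ := by
    rw [stabilityConst]
    ring
  rw [h4]
  linarith

/-- The deterministic form of the stability theorem, on the event where both bounds hold. -/
lemma exists_const_ellpDist_lt {K : ℝ} (hp1 : 1 < p) (hp2 : p < 2) (hK : 0 < K) :
    ∃ C₁ C₂ : ℝ, 0 < C₁ ∧ 0 < C₂ ∧ ∀ n : ℕ, 2 ≤ n → ∀ G : Matrix (Fin n) (Fin n) ℝ,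
      SignBound K G → ColumnBound (Real.conjExponent p) K G → ∀ δ : ℝ, 0 < δ → δ ≤ 1 →
      ∀ x : Fin n → ℝ, ellpNorm p x = 1 → δ ≤ ellpDist p x (nearOptimizers p G) →
        (G *ᵥ x) ⬝ᵥ x ≤
          2 ^ (1 / 2 - 2 / p : ℝ) * (1 - C₁ * δ ^ 6) * xi (Real.conjExponent p) *
            (n : ℝ) ^ (1 / Real.conjExponent p) +
            C₂ * (n : ℝ) ^ (p / (2 * Real.conjExponent p)) * √(Real.log n) := by
  have hp0 : 0 < p := by linarith
  have hpm : 0 < p - 1 := by linarith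
  have h2p : 0 < 2 - p := by linarith
  have hpq : p.HolderConjugate (Real.conjExponent p) := .conjExponent hp1
  set q := Real.conjExponent p with hq
  have hq0 : 0 < q := hpq.symm.pos
  have hμ := absMoment_pos hq0
  have hD := dyadicConst_pos hp1 hp2
  set B1 := 1 + 4 * √(4 / (2 - p)) with hB1
  have hB10 : 0 < B1 := by positivity
  have hC : 0 < stabilityConst p := by
    unfold stabilityConst
    positivity
  -- The three summands make, for `τ = c₀ δ`, the final distance less than `δ`, `τ < 1`, and `B1 τ²
  -- ≤ 1`.
  set c₀ : ℝ := 1 / (2 * stabilityConst p + 1 + B1) with hc₀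
  have hc₀0 : 0 < c₀ := by positivity
  have hden : c₀ * (2 * stabilityConst p + 1 + B1) = 1 := by
    rw [hc₀]
    field_simp
  have hcC : 0 < c₀ * stabilityConst p := by positivity
  have hcB : 0 < c₀ * B1 := by positivity
  refine ⟨c₀ ^ 4, 4 * dyadicConst p * K + 40 * K, by positivity, by positivity, ?_⟩
  intro n hn G hG hG2 δ hδ0 hδ1 x hx hdist
  by_contra! hlt
  have hn0 : (0 : ℝ) < n := by positivity
  set τ := c₀ * δ with hτ
  have hτ0 : 0 ≤ τ := by positivity
  have hτc : τ ≤ c₀ := mul_le_of_le_one_right hc₀0.le hδ1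
  have hc₀1 : c₀ < 1 := by nlinarith only [hden, hcC, hcB]
  have hτ1 : τ < 1 := hτc.trans_lt hc₀1
  have hτ2 : B1 * τ ^ 2 ≤ 1 := by
    have h1 : τ ^ 2 ≤ τ := by nlinarith only [hτ0, hτ1]
    have h2 : B1 * τ ^ 2 ≤ B1 * c₀ := by gcongr; exact h1.trans hτc
    nlinarith only [h2, hden, hcC, hc₀0]
  have hbil : bil G x x = (G *ᵥ x) ⬝ᵥ x := by
    rw [bil_eq_sum_left]
    simp only [dotProduct, Matrix.mulVec]
    refine Finset.sum_congr rfl fun i _ => ?_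
    ring
  have hconst : (2 : ℝ) ^ (1 / 2 - 2 / p : ℝ) = √2 * ((2 : ℝ) ^ (-(1 / p))) ^ 2 := by
    rw [Real.sqrt_eq_rpow, ← Real.rpow_natCast, ← Real.rpow_mul (by norm_num),
      ← Real.rpow_add (by norm_num)]
    congr 1
    push_cast
    ring
  have hxi : xi q * (n : ℝ) ^ (1 / q) = (n * absMoment q) ^ (1 / q) := by
    rw [Real.mul_rpow hn0.le hμ.le, mul_comm]
    rfl
  have hexp : p / (2 * q) = (p - 1) / 2 := by
    rw [hq, Real.conjExponent]
    field_simp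
  have hlarge : √2 * ((2 : ℝ) ^ (-(1 / p))) ^ 2 * (1 - τ ^ 4) * (n * absMoment q) ^ (1 / q) +
      (4 * dyadicConst p * K + 40 * K) * ((n : ℝ) ^ ((p - 1) / 2) * √(Real.log n)) <
        bil G x x := by
    rw [hbil]
    refine lt_of_le_of_lt ?_ hlt
    rw [hexp, ← hxi, ← hconst, ← mul_assoc, ← mul_assoc]
    have hxi0 : 0 ≤ xi q := by
      have : 0 ≤ absMoment q ^ (1 / q) := by positivity
      exact this
    gcongr
    -- The argument yields a gain `c₀⁴ δ⁴`; the sixth power is a weakening.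
    have : δ ^ 6 ≤ δ ^ 4 := pow_le_pow_of_le_one hδ0.le hδ1 (by norm_num)
    rw [hτ, mul_pow]
    gcongr
  obtain ⟨i, σ, hσ, hclose⟩ := exists_close_of_large hp1 hp2 hpq hK hn hG hG2 hx hτ0 hτ1 hτ2 hlarge
  rw [← v_eq_dualVec] at hclose
  have hε : 2 * (stabilityConst p * τ) < δ := by
    have h1 : 2 * (c₀ * stabilityConst p) < 1 := by nlinarith only [hden, hcB, hc₀0]
    calc 2 * (stabilityConst p * τ) = 2 * (c₀ * stabilityConst p) * δ := by rw [hτ]; ring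
      _ < 1 * δ := by gcongr
      _ = δ := one_mul δ
  have hd := ellpDist_nearOptimizers_le hp1.le hx G i hσ (by positivity) (by linarith) hclose
  linarith

end Assembly

end GaussianGrothendieck

/-! ### The probabilistic statement -/

theorem theorem1p3 (p : ℝ) (hp1 : 1 < p) (hp2 : p < 2) (κ : ℝ) (hκ0 : 0 < κ)
    (hκ : κ < 1 / (3 * p)) (d : ℝ) (hd : 0 < d) :
    ∃ C₁ C₂ C₃ : ℝ, 0 < C₁ ∧ 0 < C₂ ∧ 0 < C₃ ∧
      ∀ (n : ℕ), 1 ≤ n →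
      ∀ (Ω : Type*) [MeasurableSpace Ω] (P : Measure Ω) [IsProbabilityMeasure P]
        (G : Ω → Matrix (Fin n) (Fin n) ℝ), GaussianGrothendieck.IsStdGaussianMatrix P G →
      ∀ δ : ℝ, (n : ℝ) ^ (-κ) ≤ δ → δ ≤ 1 →
        1 - C₃ * (n : ℝ) ^ (-d) ≤
          P.real {ω | ∀ x : Fin n → ℝ, GaussianGrothendieck.ellpNorm p x = 1 →
            δ ≤ GaussianGrothendieck.ellpDist p x (GaussianGrothendieck.nearOptimizers p (G ω)) →
            (G ω *ᵥ x) ⬝ᵥ x ≤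
              2 ^ (1 / 2 - 2 / p : ℝ) * (1 - C₁ * δ ^ 6) *
                  GaussianGrothendieck.xi (Real.conjExponent p) *
                  (n : ℝ) ^ (1 / Real.conjExponent p) +
                C₂ * (n : ℝ) ^ (p / (2 * Real.conjExponent p)) * √(Real.log n)} := by
  have hq : 2 ≤ Real.conjExponent p := by
    rw [Real.conjExponent, le_div_iff₀ (by linarith)]
    linarith
  obtain ⟨K, C, hK, hC, hprob⟩ := GaussianGrothendieck.exists_signBound_columnBound hq hd
  obtain ⟨C₁, C₂, hC₁, hC₂, hdet⟩ :=
    GaussianGrothendieck.exists_const_ellpDist_lt (K := K) hp1 hp2 hK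
  -- The extra `1` makes the claim void for `n = 1`, where the good-event bound is not available.
  refine ⟨C₁, C₂, C + 1, hC₁, hC₂, by positivity, ?_⟩
  intro n hn Ω _ P _ G hG δ hδ hδ1
  rcases hn.eq_or_lt with rfl | hn2
  · have h0 : 1 - (C + 1) * ((1 : ℕ) : ℝ) ^ (-d) ≤ 0 := by
      rw [Nat.cast_one, Real.one_rpow]
      linarith
    exact h0.trans measureReal_nonneg
  have hn0 : (0 : ℝ) < n := by positivity
  have hδ0 : 0 < δ := lt_of_lt_of_le (by positivity) hδ
  set A := {ω | ∀ x : Fin n → ℝ, GaussianGrothendieck.ellpNorm p x = 1 →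
    δ ≤ GaussianGrothendieck.ellpDist p x (GaussianGrothendieck.nearOptimizers p (G ω)) →
    (G ω *ᵥ x) ⬝ᵥ x ≤
      2 ^ (1 / 2 - 2 / p : ℝ) * (1 - C₁ * δ ^ 6) *
          GaussianGrothendieck.xi (Real.conjExponent p) *
          (n : ℝ) ^ (1 / Real.conjExponent p) +
        C₂ * (n : ℝ) ^ (p / (2 * Real.conjExponent p)) * √(Real.log n)} with hA
  set bad := {ω | ¬ (GaussianGrothendieck.SignBound K (G ω) ∧
    GaussianGrothendieck.ColumnBound (Real.conjExponent p) K (G ω))} with hbad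
  -- Subadditivity over this cover bounds the probability of `A` from below without measurability of
  -- `A` or `bad`.
  have hcover : (Set.univ : Set Ω) ⊆ A ∪ bad := by
    intro ω _
    by_cases h : GaussianGrothendieck.SignBound K (G ω) ∧
      GaussianGrothendieck.ColumnBound (Real.conjExponent p) K (G ω)
    · left
      exact fun x hx hdist => hdet n hn2 (G ω) h.1 h.2 δ hδ0 hδ1 x hx hdist
    · right
      exact h
  have hbadle : P.real bad ≤ C * (n : ℝ) ^ (-d) := by
    apply ENNReal.toReal_le_of_le_ofReal (by positivity)
    exact hprob n hn2 Ω P G hG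
  have hone : 1 ≤ P.real A + P.real bad := by
    have h1 := (measureReal_mono hcover (measure_ne_top P _)).trans (measureReal_union_le A bad)
    rwa [probReal_univ] at h1
  have hpow : 0 < (n : ℝ) ^ (-d) := by positivity
  linarith
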